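/- All graphs are finite and simple. A graph $G$ is $k$-thin if there are a strict total order $<$ on $V(G)$ and a partition of $V(G)$ into $k$ classes such that, whenever $u<v<w$, $u$ and $v$ are in the same class and $uw\in E(G)$, also $vw\in E(G)$; the thinness $\mathrm{thin}(G)$ is the least such $k$. A module of $G$ is a set $X\subseteq V(G)$ such that every vertex outside $X$ is adjacent to all of $X$ or to none of $X$. An interval-modular partition of $G$ is a partition of $V(G)$ into nonempty modules, each inducing an interval graph; the interval-modular cardinality $\mathrm{imc}(G)$ is the minimum number of parts of such a partition, and a partition attaining it is called optimal. For a partition $P$ of $V(G)$ into modules, let $G_P$ be the graph obtained from $G$ by contracting each part that is complete to a single vertex and each other part to two nonadjacent vertices. The problem Thinness asks, given $(G,t)$, whether $\mathrm{thin}(G)\le t$. Parameterized by the interval-modular cardinality, it is the set $Q$ of pairs $((G,t),k)$ with $k=\mathrm{imc}(G)$ and $\mathrm{thin}(G)\le t$. A kernelization for $Q$ is a polynomial-time algorithm that maps every pair $(x,k)$, where $x=(G,t)$, to a pair $(x',k')$ such that $(x',k')\in Q$ if and only if $(x,k)\in Q$, and the bit length of $x'$ and the number $k'$ are both at most $g(k)$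 for some computable function $g$. **Theorem.** 1. For every graph $G$, $\mathrm{thin}(G)\le 2\cdot\mathrm{imc}(G)$. 2. For every graph $G$ and every optimal interval-modular partition $P$ of $G$, the graph $G_P$ has at most $2\cdot\mathrm{imc}(G)$ vertices, and $\mathrm{thin}(G_P)=\mathrm{thin}(G)$. 3. Thinness admits a linear kernel parameterized by the interval-modular cardinality: there is a kernelization for $Q$, running in time polynomial in $|V(G)|$, that maps each $((G,t),k)$ to some $((G',t'),k')$ with $|V(G')|\le 2k$. Moreover, whenever $k=\mathrm{imc}(G)$, it has $k'=k$, $t'=\min\{t,2k\}$, $\mathrm{thin}(G')=\mathrm{thin}(G)$, and $G'$ is isomorphic to $G_P$ for some optimal interval-modular partition $P$ of $G$. -/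

import Mathlib

universe u

/-! ### Thinness, interval graphs, modules -/

namespace SimpleGraph

/-- The graph `G` is `k`-thin: there are a strict total order on the vertices and an assignment of
the vertices to `k` classes such that, whenever `a < b < c`, `a` and `b` are in the same class and
`a` is adjacent to `c`, also `b` is adjacent to `c`.  (A class may be left empty; this does not
change the least possible `k`.) -/
def IsThin {V : Type u} (G : SimpleGraph V) (k : ℕ) : Prop :=
  ∃ (lt : V → V → Prop) (cls : V → Fin k), IsStrictTotalOrder V lt ∧
    ∀ a b c : V, lt a b → lt b c → cls a = cls b → G.Adj a c → G.Adj b c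

/-- The thinness of a graph: the least `k` for which it is `k`-thin. -/
noncomputable def thinness {V : Type u} (G : SimpleGraph V) : ℕ :=
  sInf {k | G.IsThin k}

/-- An interval graph: the intersection graph of a family of nonempty closed real intervals. -/
def IsIntervalGraph {V : Type u} (G : SimpleGraph V) : Prop :=
  ∃ l r : V → ℝ, (∀ v, l v ≤ r v) ∧
    ∀ v w : V, v ≠ w → (G.Adj v w ↔ (Set.Icc (l v) (r v) ∩ Set.Icc (l w) (r w)).Nonempty)

/-- A module: every outside vertex is adjacent to all of `X` or to none of `X`. -/
def IsModule {V : Type u} (G : SimpleGraph V) (X : Set V) : Prop :=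
  ∀ v, v ∉ X → (∀ x ∈ X, G.Adj v x) ∨ (∀ x ∈ X, ¬ G.Adj v x)

/-- A partition of the vertex set into (nonempty) modules that induce interval graphs. -/
def IsIntervalModularPartition {V : Type u} [Fintype V] [DecidableEq V] (G : SimpleGraph V)
    (P : Finpartition (Finset.univ : Finset V)) : Prop :=
  ∀ M ∈ P.parts, G.IsModule (M : Set V) ∧ (G.induce (M : Set V)).IsIntervalGraph

/-- The interval-modular cardinality: the least number of parts of an interval-modular
partition. -/
noncomputable def intervalModularCardinality {V : Type u} [Fintype V] [DecidableEq V]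
    (G : SimpleGraph V) : ℕ :=
  sInf {k | ∃ P : Finpartition (Finset.univ : Finset V),
    G.IsIntervalModularPartition P ∧ P.parts.card = k}

/-- An interval-modular partition with the least possible number of parts. -/
def IsOptimalIntervalModularPartition {V : Type u} [Fintype V] [DecidableEq V]
    (G : SimpleGraph V) (P : Finpartition (Finset.univ : Finset V)) : Prop :=
  G.IsIntervalModularPartition P ∧ P.parts.card = G.intervalModularCardinality

open Classical in
/-- The vertices of the contracted graph: one for every part of `P` that is complete in `G`, and
two for every other part. -/
def ContractVertex {V : Type u} [Fintype V] [DecidableEq V] (G : SimpleGraph V)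
    (P : Finpartition (Finset.univ : Finset V)) : Type u :=
  Σ M : {M : Finset V // M ∈ P.parts}, Fin (if G.IsClique (M.1 : Set V) then 1 else 2)

/-- The graph obtained from `G` by contracting every complete part of `P` to one vertex and every
other part to two nonadjacent vertices: two vertices that stem from different parts are adjacent
when these parts are joined by an edge of `G`. -/
def contractPartition {V : Type u} [Fintype V] [DecidableEq V] (G : SimpleGraph V)
    (P : Finpartition (Finset.univ : Finset V)) : SimpleGraph (G.ContractVertex P) where
  Adj a b := a.1 ≠ b.1 ∧ ∃ v ∈ a.1.1, ∃ w ∈ b.1.1, G.Adj v w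
  symm := ⟨fun _ _ ⟨hne, v, hv, w, hw, hvw⟩ => ⟨hne.symm, w, hw, v, hv, hvw.symm⟩⟩
  loopless := ⟨fun _ h => h.1 rfl⟩

end SimpleGraph

/-! ### Random access machines -/

/-- A memory configuration of a random access machine: registers and arrays of natural numbers. -/
structure RamState where
  reg : ℕ → ℕ
  arr : ℕ → ℕ → ℕ

/-- Programs of the random access machine.  Registers and arrays are named by fixed numbers in the
program text; the position at which an array is read or written is taken from a register. -/
inductive RamProg : Type
  /-- do nothing -/
  | skip : RamProg
  /-- `reg x := c` for a constant `c` -/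
  | const (x c : ℕ) : RamProg
  /-- `reg x := reg y + reg z` -/
  | add (x y z : ℕ) : RamProg
  /-- `reg x := reg y - reg z`, truncated at zero -/
  | sub (x y z : ℕ) : RamProg
  /-- `reg x := arr a [reg y]` -/
  | read (x a y : ℕ) : RamProg
  /-- `arr a [reg x] := reg y` -/
  | write (a x y : ℕ) : RamProg
  /-- first `p`, then `q` -/
  | seq (p q : RamProg) : RamProg
  /-- if `reg x` is nonzero then `p` else `q` -/
  | cond (x : ℕ) (p q : RamProg) : RamProg
  /-- while `reg x` is nonzero do `p` -/
  | loop (x : ℕ) (p : RamProg) : RamProg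

/-- `RamExec p s τ s'`: started in `s`, the program `p` halts after exactly `τ` steps in `s'`.  Every
elementary instruction and every test of a register takes one step.  As addition and truncated
subtraction are the only arithmetic, every step adds at most one bit to the largest number (constants of
the program text aside), so polynomial time
here is polynomial time on Turing machines. -/
inductive RamExec : RamProg → RamState → ℕ → RamState → Prop
  | skip (s : RamState) : RamExec RamProg.skip s 1 s
  | const (x c : ℕ) (s : RamState) :
      RamExec (RamProg.const x c) s 1 { s with reg := Function.update s.reg x c }
  | add (x y z : ℕ) (s : RamState) :
      RamExec (RamProg.add x y z) s 1
        { s with reg := Function.update s.reg x (s.reg y + s.reg z) }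
  | sub (x y z : ℕ) (s : RamState) :
      RamExec (RamProg.sub x y z) s 1
        { s with reg := Function.update s.reg x (s.reg y - s.reg z) }
  | read (x a y : ℕ) (s : RamState) :
      RamExec (RamProg.read x a y) s 1
        { s with reg := Function.update s.reg x (s.arr a (s.reg y)) }
  | write (a x y : ℕ) (s : RamState) :
      RamExec (RamProg.write a x y) s 1
        { s with arr := Function.update s.arr a (Function.update (s.arr a) (s.reg x) (s.reg y)) }
  | seq (p q : RamProg) (s s₁ s₂ : RamState) (τ₁ τ₂ : ℕ) :
      RamExec p s τ₁ s₁ → RamExec q s₁ τ₂ s₂ → RamExec (RamProg.seq p q) s (τ₁ + τ₂) s₂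
  | cond_pos (x : ℕ) (p q : RamProg) (s s₁ : RamState) (τ : ℕ) :
      s.reg x ≠ 0 → RamExec p s τ s₁ → RamExec (RamProg.cond x p q) s (τ + 1) s₁
  | cond_zero (x : ℕ) (p q : RamProg) (s s₁ : RamState) (τ : ℕ) :
      s.reg x = 0 → RamExec q s τ s₁ → RamExec (RamProg.cond x p q) s (τ + 1) s₁
  | loop_done (x : ℕ) (p : RamProg) (s : RamState) :
      s.reg x = 0 → RamExec (RamProg.loop x p) s 1 s
  | loop_step (x : ℕ) (p : RamProg) (s s₁ s₂ : RamState) (τ₁ τ₂ : ℕ) :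
      s.reg x ≠ 0 → RamExec p s τ₁ s₁ → RamExec (RamProg.loop x p) s₁ τ₂ s₂ →
        RamExec (RamProg.loop x p) s (τ₁ + τ₂ + 1) s₂

/-! ### The parameterized problem and kernelizations -/

/-- An instance of the problem `Thinness`: a finite graph (on the vertices `0, …, n - 1`) and a
threshold `t`. -/
structure ThinInstance where
  n : ℕ
  graph : SimpleGraph (Fin n)
  t : ℕ

/-- The number of bits of an instance: `n` and `t` in binary, and the adjacency matrix. -/
def ThinInstance.size (x : ThinInstance) : ℕ :=
  Nat.size x.n + x.n * x.n + Nat.size x.t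

open Classical in
/-- The initial memory on input `(x, k)`: registers `0`, `1`, `2` hold the number of vertices, the
threshold and the parameter, array `0` holds the adjacency matrix row by row, and everything else
is zero. -/
noncomputable def ramInput (y : ThinInstance × ℕ) : RamState where
  reg i := if i = 0 then y.1.n else if i = 1 then y.1.t else if i = 2 then y.2 else 0
  arr a m := if a = 0 ∧ ∃ i j : Fin y.1.n, m = i.1 * y.1.n + j.1 ∧ y.1.graph.Adj i j then 1 else 0

open Classical in
/-- The memory `s` holds the result `(x, k)`, in the same format; the rest of the memory may hold
anything. -/
def RamOutput (s : RamState) (y : ThinInstance × ℕ) : Prop :=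
  s.reg 0 = y.1.n ∧ s.reg 1 = y.1.t ∧ s.reg 2 = y.2 ∧
    ∀ i j : Fin y.1.n, s.arr 0 (i.1 * y.1.n + j.1) = if y.1.graph.Adj i j then 1 else 0

/-- `f` is computed by a single program whose running time is bounded by a polynomial in the number
of vertices of the input graph (hence in the bit length of the input). -/
def IsPolyTime (f : ThinInstance × ℕ → ThinInstance × ℕ) : Prop :=
  ∃ (p : RamProg) (q : Polynomial ℕ), ∀ y : ThinInstance × ℕ,
    ∃ (τ : ℕ) (s : RamState), τ ≤ q.eval y.1.n ∧ RamExec p (ramInput y) τ s ∧ RamOutput s (f y)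

/-- `f` is a kernelization for the parameterized problem `Q`: a polynomial-time computable map of
instances `(x, k)` to equivalent instances `(x', k')` such that the bit length of `x'` and the
number `k'` are bounded by a computable function of `k`. -/
def IsKernelization (Q : Set (ThinInstance × ℕ))
    (f : ThinInstance × ℕ → ThinInstance × ℕ) : Prop :=
  IsPolyTime f ∧ (∀ y, f y ∈ Q ↔ y ∈ Q) ∧
    ∃ g : ℕ → ℕ, Computable g ∧ ∀ y, (f y).1.size ≤ g y.2 ∧ (f y).2 ≤ g y.2

/-- The problem `Thinness` parameterized by the interval-modular cardinality of the input graph: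
the pairs `((G, t), k)` where `k` is the interval-modular cardinality of `G` and the thinness of
`G` is at most `t`. -/
def thinnessByIntervalModularCardinality : Set (ThinInstance × ℕ) :=
  {y | y.1.graph.intervalModularCardinality = y.2 ∧ y.1.graph.thinness ≤ y.1.t}

/-!
Two facts carry the result.

*Contraction.* An interval-modular partition is handled as a labelling of the vertices whose
fibers are modules that induce interval graphs. Keep one vertex of every complete part and two
nonadjacent vertices of every other part. This induced subgraph is the contracted graph
(`IsContraction.nonempty_iso`), and it has the same thinness (`IsContraction.thinness_eq`): in a
thin order of the subgraph every part is inserted, sorted by right endpoints of intervals, in the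
place of its first representative. If two vertices `b < c` of a part that are not adjacent come
after a vertex `a` of the same class as `b` that is adjacent to `c`, then the part has a second
representative, which is adjacent to `a` but not to the first one; this contradicts thinness of
the order below. The first two claims follow, because the contracted graph has at most two
vertices for every part.

*Exchange.* Call a partition unmergeable if no interval module is the union of two or more of its
parts. An unmergeable partition has the least possible number of parts
(`IsUnmergeable.card_image_eq`). Indeed, if a part `A` of it is not a part of a minimum partition
`c`, then some such `A` overlaps a part of `c`, and overlapping parts are completely joined
outside their intersection (`IsUnmergeable.adj_of_overlap`). From this one finds a partition with
at most as many parts as `c` that contains `A` and all parts that the two have in common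
(`IsMinimumColoring.exchange`). Unmergeability is inherited by the contraction
(`IsContraction.isUnmergeable`), so the contraction also preserves the interval-modular
cardinality, and equivalence of the kernel follows.

An unmergeable partition can be computed greedily. Starting with single vertices, take the least
module that contains two given vertices and is a union of parts, and merge its parts if it passes
a test for being an interval graph. The test guesses a leftmost part and propagates the order that
this forces; it succeeds if all nonadjacent pairs of parts get ordered, the order is an interval
order, and there is no induced cycle of length four. For sets that pass, interval representations
of the parts can be substituted into the order of the parts (`isIntervalOn_of_quotient`).
Conversely, in a smallest interval module that is a union of several parts the test succeeds: the
components of the graph formed by pairs without a forced order would be smaller such modules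
(`IsIntervalModularRel.isUnmergeable`).

All steps of this algorithm are definable by first-order formulas over the current relations, and
are iterated a quadratic number of times. It is therefore written in a small relational language,
whose programs compile to random access machine programs of polynomial running time
(`RelProg.runs_compile`). The number of classes found is the interval-modular cardinality, and it
is compared with the parameter in the end.
-/

namespace SimpleGraph

/-! ### Interval graphs and interval orders -/

section Interval

variable {V : Type*} {G : SimpleGraph V} {X Y : Set V}

/-- The relation `R` is an interval order on `X` (irreflexive, and without two incomparable
disjoint pairs) whose incomparability graph is the subgraph induced by `X`.  Think of `R x y` as
"the interval of `x` lies to the left of the interval of `y`". -/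
def IntervalOrderOn (G : SimpleGraph V) (X : Set V) (R : V → V → Prop) : Prop :=
  (∀ x ∈ X, ¬ R x x) ∧
  (∀ x ∈ X, ∀ y ∈ X, ∀ z ∈ X, ∀ w ∈ X, R x y → R z w → R x w ∨ R z y) ∧
  (∀ x ∈ X, ∀ y ∈ X, x ≠ y → (G.Adj x y ↔ ¬ R x y ∧ ¬ R y x))

/-- The set `X` induces an interval graph, in terms of interval orders. -/
def IsIntervalOn (G : SimpleGraph V) (X : Set V) : Prop :=
  ∃ R, G.IntervalOrderOn X R

/-- No four vertices of `X` induce a cycle. -/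
def NoC4On (G : SimpleGraph V) (X : Set V) : Prop :=
  ∀ x ∈ X, ∀ y ∈ X, ∀ z ∈ X, ∀ w ∈ X, G.Adj x z → G.Adj x w → G.Adj y z → G.Adj y w →
    x ≠ y → z ≠ w → G.Adj x y ∨ G.Adj z w

theorem IsIntervalOn.mono (h : G.IsIntervalOn Y) (hXY : X ⊆ Y) : G.IsIntervalOn X := by
  obtain ⟨R, h1, h2, h3⟩ := h
  exact ⟨R, fun x hx => h1 x (hXY hx),
    fun x hx y hy z hz w hw => h2 x (hXY hx) y (hXY hy) z (hXY hz) w (hXY hw),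
    fun x hx y hy => h3 x (hXY hx) y (hXY hy)⟩

theorem IsIntervalOn.noC4On (h : G.IsIntervalOn X) : G.NoC4On X := by
  obtain ⟨R, h1, h2, h3⟩ := h
  intro x hx y hy z hz w hw hxz hxw hyz hyw hxy hzw
  rw [h3 x hx y hy hxy, h3 z hz w hw hzw]
  rw [h3 x hx z hz hxz.ne] at hxz
  rw [h3 x hx w hw hxw.ne] at hxw
  rw [h3 y hy z hz hyz.ne] at hyz
  rw [h3 y hy w hw hyw.ne] at hyw
  by_contra hcon
  have := h2 x hx y hy z hz w hw
  have := h2 x hx y hy w hw z hz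
  have := h2 y hy x hx z hz w hw
  have := h2 y hy x hx w hw z hz
  tauto

/-- A finite interval order has a representation by left and right endpoints: `l y` counts the
predecessors of `y`, and `r x + 1` counts the vertices that lie to the left of everything to the
right of `x`. -/
theorem IntervalOrderOn.exists_endpoints [Finite V] {R : V → V → Prop}
    (h : G.IntervalOrderOn X R) :
    ∃ l r : V → ℝ, ∀ x ∈ X, ∀ y ∈ X, R x y ↔ r x < l y := by
  obtain ⟨h1, h2, -⟩ := h
  let D : V → Set V := fun y => {v | v ∈ X ∧ R v y}
  let W : V → Set V := fun x => {v | v ∈ X ∧ ∀ y ∈ X, R x y → R v y}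
  refine ⟨fun y => ((D y).ncard : ℝ), fun x => ((W x).ncard : ℝ) - 1, fun x hx y hy => ?_⟩
  constructor
  · intro hxy
    have : W x ⊆ D y := fun v hv => ⟨hv.1, hv.2 y hy hxy⟩
    have := Set.ncard_le_ncard this (Set.toFinite _)
    have : ((W x).ncard : ℝ) ≤ (D y).ncard := by exact_mod_cast this
    linarith
  · intro hlt
    by_contra hxy
    have hss : D y ⊂ W x := by
      refine ⟨fun v hv => ⟨hv.1, fun y' hy' hxy' => ?_⟩, fun hsub => ?_⟩
      · rcases h2 v hv.1 y hy x hx y' hy' hv.2 hxy' with h | h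
        · exact h
        · exact absurd h hxy
      · exact hxy (hsub (show x ∈ W x from ⟨hx, fun _ _ h => h⟩)).2
    have := Set.ncard_lt_ncard hss (Set.toFinite _)
    have : ((D y).ncard : ℝ) + 1 ≤ (W x).ncard := by exact_mod_cast this
    linarith

theorem isIntervalGraph_induce_iff [Finite V] :
    (G.induce X).IsIntervalGraph ↔ G.IsIntervalOn X := by
  have key : ∀ a b c d : ℝ, a ≤ b → c ≤ d →
      ((Set.Icc a b ∩ Set.Icc c d).Nonempty ↔ ¬ b < c ∧ ¬ d < a) := by
    intro a b c d hab hcd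
    rw [Set.Icc_inter_Icc, Set.nonempty_Icc]
    simp only [not_lt, sup_le_iff, le_inf_iff]
    tauto
  constructor
  · rintro ⟨l, r, hlr, hadj⟩
    refine ⟨fun x y => ∃ (hx : x ∈ X) (hy : y ∈ X), r ⟨x, hx⟩ < l ⟨y, hy⟩, ?_, ?_, ?_⟩
    · rintro x hx ⟨_, _, h⟩
      exact absurd (hlr ⟨x, hx⟩) (not_le.2 h)
    · rintro x hx y hy z hz w hw ⟨_, _, h⟩ ⟨_, _, h'⟩
      rcases lt_or_ge (r ⟨x, hx⟩) (l ⟨w, hw⟩) with h2 | h2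
      · exact Or.inl ⟨hx, hw, h2⟩
      · exact Or.inr ⟨hz, hy, by linarith⟩
    · intro x hx y hy hxy
      have := hadj ⟨x, hx⟩ ⟨y, hy⟩ (by simpa using hxy)
      rw [key _ _ _ _ (hlr _) (hlr _)] at this
      simp only [comap_adj, Function.Embedding.subtype_apply] at this
      rw [this]
      simp [hx, hy]
  · rintro ⟨R, hR⟩
    obtain ⟨l, r, hlr⟩ := hR.exists_endpoints
    obtain ⟨h1, h2, h3⟩ := hR
    refine ⟨fun v => l v, fun v => r v, fun v => ?_, fun v w hvw => ?_⟩
    · have := h1 v v.2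
      rw [hlr _ v.2 _ v.2] at this
      exact not_lt.1 this
    · have hle : ∀ v ∈ X, l v ≤ r v := fun v hv => by
        have := h1 v hv
        rw [hlr _ hv _ hv] at this
        exact not_lt.1 this
      rw [key _ _ _ _ (hle v v.2) (hle w w.2), ← hlr _ v.2 _ w.2, ← hlr _ w.2 _ v.2]
      simp only [comap_adj, Function.Embedding.subtype_apply]
      exact h3 v v.2 w w.2 (by simpa [Subtype.ext_iff] using hvw)

/-- Right endpoints of an interval representation: sorting by them gives a `1`-thin order. -/
theorem IsIntervalOn.exists_right_endpoint [Finite V] (h : G.IsIntervalOn X) :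
    ∃ r : V → ℝ, ∀ a ∈ X, ∀ b ∈ X, ∀ c ∈ X, r a ≤ r b → r b ≤ r c → b ≠ c →
      a ≠ c → G.Adj a c → G.Adj b c := by
  obtain ⟨R, hR⟩ := h
  obtain ⟨l, r, hlr⟩ := hR.exists_endpoints
  obtain ⟨h1, h2, h3⟩ := hR
  refine ⟨r, fun a ha b hb c hc hab hbc hne hne' hadj => ?_⟩
  rw [h3 a ha c hc hne', hlr _ ha _ hc, hlr _ hc _ ha] at hadj
  rw [h3 b hb c hc hne, hlr _ hb _ hc, hlr _ hc _ hb]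
  have := h1 b hb
  rw [hlr _ hb _ hb] at this
  constructor <;> linarith [hadj.1, hadj.2]

/-- Substitution: if the pieces `q ⁻¹ {i}` of `X` induce interval graphs, the adjacency of
different pieces is given by an interval order `R` on the labels, and `X` contains no induced
cycle of length four, then `X` induces an interval graph. -/
theorem isIntervalOn_of_quotient {ι : Type*} (q : V → ι) (R : ι → ι → Prop)
    (hirr : ∀ x ∈ X, ¬ R (q x) (q x))
    (hF : ∀ x ∈ X, ∀ y ∈ X, ∀ z ∈ X, ∀ w ∈ X, R (q x) (q y) → R (q z) (q w) →
      R (q x) (q w) ∨ R (q z) (q y))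
    (hadj : ∀ x ∈ X, ∀ y ∈ X, q x ≠ q y →
      (G.Adj x y ↔ ¬ R (q x) (q y) ∧ ¬ R (q y) (q x)))
    (hpart : ∀ i, G.IsIntervalOn {y | y ∈ X ∧ q y = i}) (hC : G.NoC4On X) :
    G.IsIntervalOn X := by
  choose S hS1 hS2 hS3 using hpart
  have hR : ∀ x ∈ X, ∀ y ∈ X, R (q x) (q y) → q x ≠ q y := fun x hx y hy h e => by
    rw [← e] at h
    exact hirr x hx h
  -- within a piece, comparable vertices are nonadjacent
  have hSn : ∀ x ∈ X, ∀ y ∈ X, q x = q y → S (q x) x y → x ≠ y ∧ ¬ G.Adj x y := by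
    intro x hx y hy e h
    have hne : x ≠ y := by
      rintro rfl
      exact hS1 (q x) x ⟨hx, rfl⟩ h
    refine ⟨hne, fun ha => ?_⟩
    exact ((hS3 (q x) x ⟨hx, rfl⟩ y ⟨hy, e.symm⟩ hne).1 ha).1 h
  -- a comparable pair of labels, and a comparable pair within a third piece
  have hmix : ∀ x ∈ X, ∀ y ∈ X, ∀ z ∈ X, ∀ w ∈ X, R (q x) (q y) → q z = q w →
      S (q z) z w → R (q x) (q z) ∨ R (q z) (q y) := by
    intro x hx y hy z hz w hw hxy e hs
    by_contra hcon
    push Not at hcon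
    obtain ⟨hc1, hc2⟩ := hcon
    have hxz : q x ≠ q z := fun e' => hc2 (e' ▸ hxy)
    have hzy : q z ≠ q y := fun e' => hc1 (e' ▸ hxy)
    have h1 : ¬ R (q z) (q x) := fun h => by
      rcases hF z hz x hx x hx y hy h hxy with h | h
      · exact hc2 h
      · exact hirr x hx h
    have h2 : ¬ R (q y) (q z) := fun h => by
      rcases hF x hx y hy y hy z hz hxy h with h | h
      · exact hc1 h
      · exact hirr y hy h
    have a1 : G.Adj x z := (hadj x hx z hz hxz).2 ⟨hc1, h1⟩
    have a2 : G.Adj x w := (hadj x hx w hw (e ▸ hxz)).2 (e ▸ ⟨hc1, h1⟩)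
    have a3 : G.Adj y z := (hadj y hy z hz hzy.symm).2 ⟨h2, hc2⟩
    have a4 : G.Adj y w := (hadj y hy w hw (e ▸ hzy.symm)).2 (e ▸ ⟨h2, hc2⟩)
    have hne := hR x hx y hy hxy
    obtain ⟨n1, n2⟩ := hSn z hz w hw e hs
    rcases hC x hx y hy z hz w hw a1 a2 a3 a4 (fun h => hne (h ▸ rfl)) n1 with h | h
    · exact ((hadj x hx y hy hne).1 h).1 hxy
    · exact n2 h
  refine ⟨fun x y => (q x = q y ∧ S (q x) x y) ∨ R (q x) (q y), ?_, ?_, ?_⟩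
  · rintro x hx (⟨-, h⟩ | h)
    · exact hS1 (q x) x ⟨hx, rfl⟩ h
    · exact hirr x hx h
  · rintro x hx y hy z hz w hw (⟨e, h⟩ | h) (⟨e', h'⟩ | h')
    · by_cases hxz : q x = q z
      · have := hS2 (q x) x ⟨hx, rfl⟩ y ⟨hy, e.symm⟩ z ⟨hz, hxz.symm⟩ w ⟨hw, by rw [← e', hxz]⟩ h
          (hxz ▸ h')
        rcases this with h | h
        · exact Or.inl (Or.inl ⟨by rw [hxz, e'], h⟩)
        · exact Or.inr (Or.inl ⟨by rw [← e, hxz], hxz ▸ h⟩)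
      · obtain ⟨n1, n2⟩ := hSn x hx y hy e h
        obtain ⟨n3, n4⟩ := hSn z hz w hw e' h'
        by_contra hcon
        have hnl : ¬ R (q x) (q z) ∧ ¬ R (q z) (q x) :=
          ⟨fun h => hcon (Or.inl (Or.inr (e' ▸ h))), fun h => hcon (Or.inr (Or.inr (e ▸ h)))⟩
        have a1 := (hadj x hx z hz hxz).2 hnl
        have a2 := (hadj x hx w hw (e' ▸ hxz)).2 (e' ▸ hnl)
        have a3 := (hadj y hy z hz (e ▸ hxz)).2 (e ▸ hnl)
        have a4 := (hadj y hy w hw (e' ▸ e ▸ hxz)).2 (e' ▸ e ▸ hnl)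
        rcases hC x hx y hy z hz w hw a1 a2 a3 a4 n1 n3 with h | h
        · exact n2 h
        · exact n4 h
    · rcases hmix z hz w hw x hx y hy h' e h with h2 | h2
      · exact Or.inr (Or.inr (e ▸ h2))
      · exact Or.inl (Or.inr h2)
    · rcases hmix x hx y hy z hz w hw h e' h' with h2 | h2
      · exact Or.inl (Or.inr (e' ▸ h2))
      · exact Or.inr (Or.inr h2)
    · rcases hF x hx y hy z hz w hw h h' with h | h
      · exact Or.inl (Or.inr h)
      · exact Or.inr (Or.inr h)
  · intro x hx y hy hxy
    by_cases e : q x = q y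
    · have h1 : ¬ R (q x) (q y) := fun h => hR x hx y hy h e
      have := hS3 (q x) x ⟨hx, rfl⟩ y ⟨hy, e.symm⟩ hxy
      rw [e] at h1
      simp only [h1, or_false, e, true_and]
      rw [this, e]
    · rw [hadj x hx y hy e]
      simp [e, Ne.symm e]

/-- A clique that is completely joined to an interval graph can be represented by intervals that
cover everything. -/
theorem IsIntervalOn.join_clique (hX : G.IsIntervalOn X) (hY : G.IsClique Y)
    (hXY : ∀ x ∈ X, ∀ y ∈ Y, G.Adj x y) : G.IsIntervalOn (X ∪ Y) := by
  classical
  obtain ⟨R, h1, h2, h3⟩ := hX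
  refine ⟨fun x y => x ∈ X ∧ y ∈ X ∧ R x y, ?_, ?_, ?_⟩
  · rintro x - ⟨hx, -, h⟩
    exact h1 x hx h
  · rintro x - y - z - w - ⟨hx, hy, h⟩ ⟨hz, hw, h'⟩
    rcases h2 x hx y hy z hz w hw h h' with h | h
    · exact Or.inl ⟨hx, hw, h⟩
    · exact Or.inr ⟨hz, hy, h⟩
  · rintro x hx y hy hxy
    by_cases hxX : x ∈ X
    · by_cases hyX : y ∈ X
      · simpa [hxX, hyX] using h3 x hxX y hyX hxy
      · have : G.Adj x y := hXY x hxX y (hy.resolve_left hyX)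
        simp [hyX, this]
    · have hxY := hx.resolve_left hxX
      by_cases hyX : y ∈ X
      · have : G.Adj x y := (hXY y hyX x hxY).symm
        simp [hxX, this]
      · have : G.Adj x y := hY hxY (hy.resolve_left hyX) hxy
        simp [hxX, this]

end Interval

/-! ### Modules -/

section Module

variable {V : Type*} {G : SimpleGraph V} {A B : Set V}

theorem isModule_iff :
    G.IsModule A ↔ ∀ v, v ∉ A → ∀ x ∈ A, ∀ y ∈ A, G.Adj v x → G.Adj v y := by
  constructor
  · intro h v hv x hx y hy hvx
    rcases h v hv with h | h
    · exact h y hy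
    · exact absurd hvx (h x hx)
  · intro h v hv
    by_cases hx : ∃ x ∈ A, G.Adj v x
    · obtain ⟨x, hx, hvx⟩ := hx
      exact Or.inl fun y hy => h v hv x hx y hy hvx
    · push Not at hx
      exact Or.inr hx

theorem IsModule.adj_of_adj (h : G.IsModule A) {v x y : V} (hv : v ∉ A) (hx : x ∈ A) (hy : y ∈ A)
    (hvx : G.Adj v x) : G.Adj v y :=
  isModule_iff.1 h v hv x hx y hy hvx

theorem IsModule.union (hA : G.IsModule A) (hB : G.IsModule B) (h : (A ∩ B).Nonempty) :
    G.IsModule (A ∪ B) := by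
  obtain ⟨c, hcA, hcB⟩ := h
  rw [isModule_iff]
  intro v hv x hx y hy hvx
  rw [Set.mem_union, not_or] at hv
  have hvc : G.Adj v c := by
    rcases hx with hx | hx
    · exact hA.adj_of_adj hv.1 hx hcA hvx
    · exact hB.adj_of_adj hv.2 hx hcB hvx
  rcases hy with hy | hy
  · exact hA.adj_of_adj hv.1 hcA hy hvc
  · exact hB.adj_of_adj hv.2 hcB hy hvc

theorem IsModule.diff (hB : G.IsModule B) (hA : G.IsModule A) (h : (A \ B).Nonempty) :
    G.IsModule (B \ A) := by
  obtain ⟨c, hcA, hcB⟩ := h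
  rw [isModule_iff]
  intro v hv x hx y hy hvx
  by_cases hvB : v ∈ B
  · have hvA : v ∈ A := by_contra fun h => hv ⟨hvB, h⟩
    have h1 := hA.adj_of_adj hx.2 hvA hcA hvx.symm
    have h2 := hB.adj_of_adj hcB hx.1 hy.1 h1.symm
    exact (hA.adj_of_adj hy.2 hcA hvA h2.symm).symm
  · exact hB.adj_of_adj hvB hx.1 hy.1 hvx

/-- A module that induces an interval graph. -/
def IsIntervalModule (G : SimpleGraph V) (A : Set V) : Prop :=
  G.IsModule A ∧ G.IsIntervalOn A

theorem isIntervalModule_of_forall_eq {v : V} (h : ∀ x ∈ A, x = v) : G.IsIntervalModule A := by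
  refine ⟨isModule_iff.2 fun u _ x hx y hy hux => ?_, fun _ _ => False, by simp, by simp, ?_⟩
  · rw [h y hy, ← h x hx]
    exact hux
  · intro x hx y hy hxy
    exact absurd ((h x hx).trans (h y hy).symm) hxy

end Module

/-! ### Interval-modular colorings -/

section Coloring

variable {V ι κ : Type*} {G : SimpleGraph V}

/-- An interval-modular partition, presented as the fibers of a labelling. -/
def IsIntervalModularColoring (G : SimpleGraph V) (c : V → ι) : Prop :=
  ∀ i, G.IsIntervalModule {v | c v = i}

/-- No two or more parts can be merged: an interval module that is a union of parts lies in a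
single part. -/
def IsUnmergeable (G : SimpleGraph V) (c : V → ι) : Prop :=
  ∀ Y : Set V, G.IsIntervalModule Y → (∀ x ∈ Y, ∀ y, c y = c x → y ∈ Y) →
    ∀ x ∈ Y, ∀ y ∈ Y, c x = c y

/-- The fibers have the least number among all interval-modular colorings by the same labels. -/
def IsMinimumColoring [Fintype V] [DecidableEq ι] (G : SimpleGraph V) (c : V → ι) : Prop :=
  G.IsIntervalModularColoring c ∧ ∀ c' : V → ι, G.IsIntervalModularColoring c' →
    (Finset.univ.image c).card ≤ (Finset.univ.image c').card

/-- Merging all of a saturated interval module. -/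
theorem IsIntervalModularColoring.merge {c : V → ι} (hc : G.IsIntervalModularColoring c)
    {Y : Set V} [DecidablePred (· ∈ Y)] (hY : G.IsIntervalModule Y)
    (hsat : ∀ x ∈ Y, ∀ y, c y = c x → y ∈ Y) {x : V} (hx : x ∈ Y) :
    G.IsIntervalModularColoring fun v => if v ∈ Y then c x else c v := by
  intro i
  by_cases hi : i = c x
  · convert hY using 1
    ext v
    simp only [Set.mem_ofPred_eq]
    split_ifs with hv
    · simp [hv, hi]
    · simp only [hv, iff_false]
      exact fun h => hv (hsat x hx v (h.trans hi))
  · by_cases hv : ∃ v, v ∉ Y ∧ c v = i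
    · obtain ⟨v, hvY, hv⟩ := hv
      convert hc i using 1
      ext w
      simp only [Set.mem_ofPred_eq]
      split_ifs with hw
      · simp only [Ne.symm hi, false_iff]
        exact fun h => hvY (hsat w hw v (hv.trans h.symm))
      · rfl
    · apply isIntervalModule_of_forall_eq (v := x)
      intro w hw
      simp only [Set.mem_ofPred_eq] at hw
      split_ifs at hw with h
      · exact absurd hw.symm hi
      · exact absurd ⟨w, h, hw⟩ hv

theorem IsMinimumColoring.isUnmergeable [Fintype V] [DecidableEq ι] {c : V → ι}
    (hc : G.IsMinimumColoring c) : G.IsUnmergeable c := by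
  classical
  intro Y hY hsat x hx y hy
  by_contra hne
  have h1 := hc.2 _ (hc.1.merge hY hsat hx)
  refine absurd h1 (not_le.2 (Finset.card_lt_card ?_))
  refine ⟨fun i hi => ?_, fun hsub => ?_⟩
  · obtain ⟨v, -, rfl⟩ := Finset.mem_image.1 hi
    split_ifs <;> simp
  · obtain ⟨v, -, hv⟩ := Finset.mem_image.1 (hsub (Finset.mem_image_of_mem c (Finset.mem_univ y)))
    split_ifs at hv with h
    · exact hne hv
    · exact h (hsat y hy v hv)

/-- If a part of an unmergeable partition overlaps an interval module, then the two are completely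
joined outside their intersection: were there no edge, the union of all parts that meet the module
would consist of disjoint interval graphs without edges between them. -/
theorem IsUnmergeable.adj_of_overlap {p : V → ι} (hm : G.IsUnmergeable p)
    (hp : G.IsIntervalModularColoring p) {B : Set V} (hB : G.IsIntervalModule B) {x y z : V}
    (hxy : p x = p y) (hx : x ∈ B) (hy : y ∉ B) (hz : z ∈ B) (hxz : p x ≠ p z) : G.Adj y z := by
  classical
  by_contra hyz
  have hyB : ∀ b ∈ B, ¬ G.Adj y b := fun b hb h => hyz (hB.1.adj_of_adj hy hb hz h)
  -- vertices outside `B` that share a part with an element of `B` have no neighbour in `B`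
  have key : ∀ v, v ∉ B → (∃ b ∈ B, p v = p b) → ∀ b ∈ B, ¬ G.Adj v b := by
    rintro v hv ⟨b, hb, hvb⟩ b' hb' hadj
    by_cases hvx : p v = p x
    · have h1 := hB.1.adj_of_adj hv hb' hz hadj
      have := (hp (p x)).1.adj_of_adj (v := z) (x := v) (y := y) (fun h => hxz h.symm) hvx
        hxy.symm h1.symm
      exact hyz this.symm
    · have h1 := hB.1.adj_of_adj hv hb' hx hadj
      have h2 := (hp (p v)).1.adj_of_adj (v := x) (x := v) (y := b) (fun h => hvx h.symm) rfl
        hvb.symm h1.symm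
      have h3 := (hp (p x)).1.adj_of_adj (v := b) (x := x) (y := y)
        (fun h => hvx (hvb.trans h)) rfl hxy.symm h2.symm
      exact hyB b hb h3.symm
  let Y : Set V := {v | ∃ b ∈ B, p v = p b}
  have hBY : B ⊆ Y := fun b hb => ⟨b, hb, rfl⟩
  let q : V → Option ι := fun v => if v ∈ B then none else some (p v)
  have hq : ∀ v ∈ Y, ∀ w ∈ Y, G.Adj v w → q v = q w := by
    intro v hv w hw hvw
    by_cases hvB : v ∈ B
    · by_cases hwB : w ∈ B
      · simp [q, hvB, hwB]
      · exact absurd hvw.symm (key w hwB hw v hvB)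
    · by_cases hwB : w ∈ B
      · exact absurd hvw (key v hvB hv w hwB)
      · simp only [q, hvB, hwB, if_false, Option.some.injEq]
        by_contra hne
        obtain ⟨b, hb, hwb⟩ := hw
        exact key v hvB hv b hb ((hp (p w)).1.adj_of_adj hne rfl hwb.symm hvw)
  have hpart : ∀ i, G.IsIntervalOn {v | v ∈ Y ∧ q v = i} := by
    rintro (_ | i)
    · refine hB.2.mono ?_
      rintro v ⟨-, hv⟩
      by_contra h
      simp [q, h] at hv
    · refine (hp i).2.mono ?_
      rintro v ⟨-, hv⟩
      by_cases h : v ∈ B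
      · simp [q, h] at hv
      · simpa [q, h] using hv
  have hY : G.IsIntervalModule Y := by
    constructor
    · rw [isModule_iff]
      rintro v hv a ⟨b, hb, hab⟩ a' ⟨b', hb', hab'⟩ hva
      have hvn : ∀ u ∈ Y, p v ≠ p u := by
        rintro u ⟨b, hb, hu⟩ h
        exact hv ⟨b, hb, h.trans hu⟩
      have h1 := (hp (p a)).1.adj_of_adj (hvn a ⟨b, hb, hab⟩) rfl hab.symm hva
      have h2 := hB.1.adj_of_adj (fun h => hv (hBY h)) hb hb' h1
      exact (hp (p a')).1.adj_of_adj (hvn a' ⟨b', hb', hab'⟩) hab'.symm rfl h2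
    · refine isIntervalOn_of_quotient q WellOrderingRel (fun x _ => irrefl _) ?_ ?_ hpart ?_
      · intro a _ b _ c _ d _ hab hcd
        rcases trichotomous_of WellOrderingRel (q a) (q d) with h | h | h
        · exact Or.inl h
        · exact Or.inr (_root_.trans (h ▸ hcd : WellOrderingRel (q c) (q a)) hab)
        · exact Or.inr (_root_.trans hcd (_root_.trans h hab))
      · intro a ha b hb hab
        constructor
        · exact fun h => absurd (hq a ha b hb h) hab
        · rintro ⟨h1, h2⟩
          rcases trichotomous_of WellOrderingRel (q a) (q b) with h | h | h
          · exact absurd h h1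
          · exact absurd h hab
          · exact absurd h h2
      · intro a ha b hb c hc d hd hac had hbc hbd
        exact (hpart (q a)).noC4On a ⟨ha, rfl⟩ b
          ⟨hb, (hq b hb c hc hbc).trans (hq a ha c hc hac).symm⟩ c ⟨hc, (hq a ha c hc hac).symm⟩ d
          ⟨hd, (hq a ha d hd had).symm⟩ hac had hbc hbd
  refine hxz (hm Y hY ?_ x ⟨x, hx, rfl⟩ z ⟨z, hz, rfl⟩)
  rintro v ⟨b, hb, hvb⟩ w hwv
  exact ⟨b, hb, hwv.trans hvb⟩

/-- Two unmergeable partitions that differ have overlapping parts. -/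
theorem exists_overlap {p : V → ι} {c : V → κ} (hp : G.IsIntervalModularColoring p)
    (hc : G.IsIntervalModularColoring c) (hpm : G.IsUnmergeable p) (hcm : G.IsUnmergeable c)
    (h : ¬ ∀ x y, p x = p y ↔ c x = c y) :
    ∃ x y z, p x = p y ∧ c x ≠ c y ∧ c x = c z ∧ p x ≠ p z := by
  by_contra hno
  push Not at hno
  refine h fun x y => ⟨fun hxy => ?_, fun hxy => ?_⟩
  · by_contra hne
    refine hne (hcm {w | p w = p x} (hp _) (fun w hw z hz => ?_) x rfl y hxy.symm)
    simp only [Set.mem_ofPred_eq] at hw ⊢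
    by_cases hwx : c w = c x
    · rw [← hno w y z (hw.trans hxy) (fun h => hne (hwx.symm.trans h)) hz.symm, hw]
    · rw [← hno w x z hw hwx hz.symm, hw]
  · by_contra hne
    refine hne (hpm {w | c w = c x} (hc _) (fun w hw z hz => ?_) x rfl y hxy.symm)
    simp only [Set.mem_ofPred_eq] at hw ⊢
    by_contra hcz
    rw [← hw] at hcz
    by_cases hwx : p w = p x
    · exact hne (hwx.symm.trans (hno w z y hz.symm (Ne.symm hcz) (hw.trans hxy)))
    · exact hwx (hno w z x hz.symm (Ne.symm hcz) hw)

/-- The exchange step: a minimum partition `c` that differs from an unmergeable partition `p` can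
be changed, without new labels, so that it has one more part in common with `p`. -/
theorem IsMinimumColoring.exchange [Fintype V] [DecidableEq κ] {p : V → ι} {c : V → κ}
    (hp : G.IsIntervalModularColoring p) (hpm : G.IsUnmergeable p) (hc : G.IsMinimumColoring c)
    (h : ¬ ∀ x y, p x = p y ↔ c x = c y) :
    ∃ (c' : V → κ) (x z : V), G.IsIntervalModularColoring c' ∧
      (c x = c z ∧ p x ≠ p z) ∧ (∀ v w, p v = p x → (c' v = c' w ↔ p w = p x)) ∧
      ∀ v, c' v = c v ∨ (∃ a, p a = p x ∧ c v = c a) ∧ (∃ a, p a = p x ∧ c' v = c a) := by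
  classical
  have hcm := hc.isUnmergeable
  have hcc := hc.1
  obtain ⟨x, y, z, hxy, hcxy, hcxz, hxz⟩ := exists_overlap hp hcc hpm hcm h
  have hAm := hp (p x)
  by_cases hI : ∃ b, p b = p x ∧ ∀ w, c w = c b → p w = p x
  · -- a part of `c` lies inside the part `A` of `x`: its label becomes the label of `A`
    obtain ⟨b, hb, hbw⟩ := hI
    refine ⟨fun v => if p v = p x then c b else c v, x, z, ?_, ⟨hcxz, hxz⟩, ?_, ?_⟩
    · intro i
      by_cases hi : i = c b
      · convert hAm using 1
        ext v
        simp only [Set.mem_ofPred_eq]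
        split_ifs with hv
        · simp [hi, hv]
        · simp only [hv, iff_false, hi]
          exact fun h => hv (hbw v h)
      · have : {v | (if p v = p x then c b else c v) = i} = {v | c v = i} \ {v | p v = p x} := by
          ext v
          simp only [Set.mem_ofPred_eq, Set.mem_sdiff]
          split_ifs with hv
          · simp [Ne.symm hi, hv]
          · simp [hv]
        rw [this]
        exact ⟨(hcc i).1.diff hAm.1 ⟨b, hb, fun h => hi (Eq.symm h)⟩,
          (hcc i).2.mono Set.sdiff_subset⟩
    · intro v w hv
      simp only [hv, if_true]
      split_ifs with hw
      · simp [hw]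
      · simp only [hw, iff_false]
        exact fun h => hw (hbw w h.symm)
    · intro v
      dsimp only
      split_ifs with hv
      · exact Or.inr ⟨⟨v, hv, rfl⟩, ⟨b, hb, rfl⟩⟩
      · exact Or.inl rfl
  · push Not at hI
    have hother : ∀ b : κ, ∃ y', p y' = p x ∧ c y' ≠ b := by
      intro b
      by_cases hb : c x = b
      · exact ⟨y, hxy.symm, fun h => hcxy (hb.trans h.symm)⟩
      · exact ⟨x, rfl, hb⟩
    -- the parts of `c` that meet `A` are completely joined to `A` outside `A`
    have S1 : ∀ b, p b = p x → ∀ w, c w = c b → p w ≠ p x → ∀ a, p a = p x → G.Adj w a := by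
      intro b hb w hw hwx a ha
      obtain ⟨y', hy', hcy'⟩ := hother (c b)
      have := hpm.adj_of_overlap hp (hcc (c b)) (x := b) (y := y') (z := w) (hb.trans hy'.symm)
        rfl hcy' hw (fun h => hwx (h.symm.trans hb))
      exact hAm.1.adj_of_adj hwx hy' ha this.symm
    -- and they are completely joined to each other
    have S2 : ∀ b b', p b = p x → p b' = p x → c b ≠ c b' → ∀ v v', c v = c b → c v' = c b' →
        G.Adj v v' := by
      intro b b' hb hb' hne v v' hv hv'
      obtain ⟨w, hw, hwx⟩ := hI b hb
      have h1 := S1 b hb w hw hwx b' hb'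
      have h2 := (hcc (c b')).1.adj_of_adj (v := w) (x := b') (y := v')
        (fun h => hne (hw.symm.trans h)) rfl hv' h1
      exact ((hcc (c b)).1.adj_of_adj (v := v') (x := w) (y := v)
        (fun h => hne (Eq.trans h.symm hv')) hw hv h2.symm).symm
    have S3 : ∀ b b', p b = p x → p b' = p x → G.IsModule ({v | c v = c b} ∪ {v | c v = c b'}) := by
      intro b b' hb hb'
      rw [isModule_iff]
      intro u hu
      simp only [Set.mem_union, Set.mem_ofPred_eq, not_or] at hu
      by_cases hux : p u = p x
      · rintro - - v (hv | hv) -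
        · exact S2 u b hux hb hu.1 u v rfl hv
        · exact S2 u b' hux hb' hu.2 u v rfl hv
      · have e1 := (hcc (c b)).1
        have e2 := (hcc (c b')).1
        rintro v (hv | hv) v' (hv' | hv') huv
        · exact e1.adj_of_adj hu.1 hv hv' huv
        · exact e2.adj_of_adj hu.2 rfl hv'
            (hAm.1.adj_of_adj hux hb hb' (e1.adj_of_adj hu.1 hv rfl huv))
        · exact e1.adj_of_adj hu.1 rfl hv'
            (hAm.1.adj_of_adj hux hb' hb (e2.adj_of_adj hu.2 hv rfl huv))
        · exact e2.adj_of_adj hu.2 hv hv' huv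
    -- `A` is not a clique
    have hAc : ¬ G.IsClique {v | p v = p x} := by
      intro hcl
      have hBs : ∀ u, c u = c x → p u ≠ p x → ∀ u', p u' = p u → c u' = c x := by
        intro u hu hux u' hu'
        by_contra hcu'
        have hA2 := hp (p u)
        have hjoin : ∀ a, p a = p x → ∀ v, p v = p u → G.Adj a v := fun a ha v hv =>
          hA2.1.adj_of_adj (fun h => hux (Eq.trans h.symm ha)) rfl hv (S1 x rfl u hu hux a ha).symm
        refine hux (hpm ({v | p v = p u} ∪ {v | p v = p x}) ⟨?_, ?_⟩ ?_ u (Or.inl rfl) x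
          (Or.inr rfl))
        · rw [isModule_iff]
          intro w hw
          simp only [Set.mem_union, Set.mem_ofPred_eq, not_or] at hw
          have hw' : G.Adj w u ↔ G.Adj w x := by
            by_cases hwB : c w = c x
            · have h1 : G.Adj w x := S1 x rfl w hwB hw.2 x rfl
              have h2 := hpm.adj_of_overlap hp (hcc (c x)) (x := u) (y := u') (z := w) hu'.symm hu
                hcu' hwB (Ne.symm hw.1)
              exact iff_of_true (hA2.1.adj_of_adj hw.1 hu' rfl h2.symm) h1
            · exact ⟨(hcc (c x)).1.adj_of_adj hwB hu rfl, (hcc (c x)).1.adj_of_adj hwB rfl hu⟩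
          rintro v (hv | hv) v' (hv' | hv') hwv
          · exact hA2.1.adj_of_adj hw.1 hv hv' hwv
          · exact hAm.1.adj_of_adj hw.2 rfl hv' (hw'.1 (hA2.1.adj_of_adj hw.1 hv rfl hwv))
          · exact hA2.1.adj_of_adj hw.1 rfl hv' (hw'.2 (hAm.1.adj_of_adj hw.2 hv rfl hwv))
          · exact hAm.1.adj_of_adj hw.2 hv hv' hwv
        · exact hA2.2.join_clique hcl fun v hv a ha => (hjoin a ha v hv).symm
        · rintro v (hv | hv) w hw
          · exact Or.inl (hw.trans hv)
          · exact Or.inr (hw.trans hv)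
      refine hxz (hpm ({v | c v = c x} ∪ {v | p v = p x})
        ⟨(hcc _).1.union hAm.1 ⟨x, rfl, rfl⟩, ?_⟩ ?_ x (Or.inl rfl) z (Or.inl hcxz.symm))
      · have : ({v | c v = c x} ∪ {v | p v = p x} : Set V) =
            {v | c v = c x} ∪ ({v | p v = p x} \ {v | c v = c x}) := by
          rw [Set.union_sdiff_self]
        rw [this]
        refine (hcc _).2.join_clique (hcl.subset Set.sdiff_subset) fun v hv a ha => ?_
        exact S2 x a rfl ha.1 (fun h => ha.2 h.symm) v a hv rfl
      · rintro v hv w hw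
        by_cases hvx : p v = p x
        · exact Or.inr (hw.trans hvx)
        · exact Or.inl (hBs v (hv.resolve_right hvx) hvx w hw)
    obtain ⟨a, ha, a', ha', hne, hna⟩ : ∃ a, p a = p x ∧ ∃ a', p a' = p x ∧ a ≠ a' ∧
        ¬ G.Adj a a' := by
      simpa [IsClique, Set.Pairwise] using hAc
    have hcaa : c a = c a' := by
      by_contra hcon
      exact hna (S2 a a' ha ha' hcon a a' rfl rfl)
    obtain ⟨y', hy', hcy'⟩ := hother (c a)
    -- `A` takes the label of `a`; the rest of that part is a clique and joins the part of `y'`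
    refine ⟨fun v => if p v = p x then c a else if c v = c a then c y' else c v, x, z, ?_,
      ⟨hcxz, hxz⟩, ?_, ?_⟩
    · intro i
      by_cases hi : i = c a
      · convert hAm using 1
        ext v
        simp only [Set.mem_ofPred_eq]
        split_ifs with hv hv'
        · simp [hi, hv]
        · simp [hi, hv, hcy']
        · simp [hi, hv, hv']
      by_cases hi' : i = c y'
      · have : {v | (if p v = p x then c a else if c v = c a then c y' else c v) = i} =
            {v | c v = c y' ∧ p v ≠ p x} ∪ {v | c v = c a ∧ p v ≠ p x} := by
          ext v
          simp only [Set.mem_ofPred_eq, Set.mem_union, hi']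
          split_ifs with hv hv'
          · simp [hv, Ne.symm hcy']
          · simp [hv, hv']
          · simp [hv, hv']
        rw [this]
        constructor
        · rw [isModule_iff]
          intro u hu
          simp only [Set.mem_union, Set.mem_ofPred_eq, not_or] at hu
          by_cases hux : p u = p x
          · rintro - - v (hv | hv) -
            · exact (S1 y' hy' v hv.1 hv.2 u hux).symm
            · exact (S1 a ha v hv.1 hv.2 u hux).symm
          · intro v hv v' hv' huv
            refine (S3 y' a hy' ha).adj_of_adj ?_ (x := v) ?_ ?_ huv
            · simp only [Set.mem_union, Set.mem_ofPred_eq, not_or]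
              exact ⟨fun h => hu.1 ⟨h, hux⟩, fun h => hu.2 ⟨h, hux⟩⟩
            · exact hv.imp And.left And.left
            · exact hv'.imp And.left And.left
        · refine ((hcc (c y')).2.mono fun v hv => hv.1).join_clique ?_ ?_
          · intro v hv w hw hvw
            have := (hcc (c a)).2.noC4On v hv.1 w hw.1 a rfl a' hcaa.symm
              (S1 a ha v hv.1 hv.2 a ha) (S1 a ha v hv.1 hv.2 a' ha')
              (S1 a ha w hw.1 hw.2 a ha) (S1 a ha w hw.1 hw.2 a' ha') hvw hne
            exact this.resolve_right hna
          · intro v hv w hw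
            exact S2 y' a hy' ha hcy' v w hv.1 hw.1
      · have : {v | (if p v = p x then c a else if c v = c a then c y' else c v) = i} =
            {v | c v = i} \ {v | p v = p x} := by
          ext v
          simp only [Set.mem_ofPred_eq, Set.mem_sdiff]
          split_ifs with hv hv'
          · simp [hv, Ne.symm hi]
          · simp only [Ne.symm hi', hv, hv', Ne.symm hi, false_and]
          · simp [hv]
        rw [this]
        exact ⟨(hcc i).1.diff hAm.1 ⟨a, ha, fun h => hi (Eq.symm h)⟩,
          (hcc i).2.mono Set.sdiff_subset⟩
    · intro v w hv
      simp only [hv, if_true]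
      split_ifs with hw hw'
      · simp [hw]
      · simp [hw, Ne.symm hcy']
      · simp [hw, Ne.symm hw']
    · intro v
      dsimp only
      split_ifs with hv hv'
      · exact Or.inr ⟨⟨v, hv, rfl⟩, ⟨a, ha, rfl⟩⟩
      · exact Or.inr ⟨⟨a, ha, hv'⟩, ⟨y', hy', rfl⟩⟩
      · exact Or.inl rfl

/-- An unmergeable partition has the least possible number of parts: a minimum partition can be
exchanged step by step until it is the given one. -/
theorem IsUnmergeable.exists_minimum_eq [Fintype V] [DecidableEq κ] {p : V → ι}
    (hp : G.IsIntervalModularColoring p) (hpm : G.IsUnmergeable p) {c : V → κ}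
    (hc : G.IsMinimumColoring c) :
    ∃ c' : V → κ, G.IsMinimumColoring c' ∧ ∀ x y, p x = p y ↔ c' x = c' y := by
  classical
  -- the number of vertices on whose part the two partitions agree
  let m : (V → κ) → ℕ := fun c => (Finset.univ.filter fun v => ∀ w, p v = p w ↔ c v = c w).card
  suffices H : ∀ (k : ℕ) (c : V → κ), G.IsMinimumColoring c → Fintype.card V - m c = k →
      ∃ c' : V → κ, G.IsMinimumColoring c' ∧ ∀ x y, p x = p y ↔ c' x = c' y from H _ c hc rfl
  intro k
  induction k using Nat.strong_induction_on with
  | _ k ih =>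
    intro c hc hk
    by_cases h : ∀ x y, p x = p y ↔ c x = c y
    · exact ⟨c, hc, h⟩
    · obtain ⟨c', x, z, h1, ⟨hcxz, hxz⟩, h2, h3⟩ := hc.exchange hp hpm h
      have himg : Finset.univ.image c' ⊆ Finset.univ.image c := by
        intro i hi
        obtain ⟨v, -, rfl⟩ := Finset.mem_image.1 hi
        rcases h3 v with h | ⟨-, a, -, h⟩ <;> rw [h] <;> simp
      have hmin : G.IsMinimumColoring c' :=
        ⟨h1, fun c'' h'' => (Finset.card_le_card himg).trans (hc.2 c'' h'')⟩
      have hlt : m c < m c' := by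
        refine Finset.card_lt_card ⟨fun v hv => ?_, fun hsub => ?_⟩
        · simp only [Finset.mem_filter, Finset.mem_univ, true_and] at hv ⊢
          by_cases hvx : p v = p x
          · intro w
            rw [h2 v w hvx, hvx, eq_comm]
          · have hna : ∀ a, p a = p x → c v ≠ c a := fun a ha hva =>
              hvx (((hv a).2 hva).trans ha)
            have hcv : c' v = c v := by
              rcases h3 v with h | ⟨⟨a, ha, h⟩, -⟩
              · exact h
              · exact absurd h (hna a ha)
            intro w
            rw [hv w, hcv]
            rcases h3 w with h | ⟨⟨a, ha, h⟩, ⟨a', ha', h'⟩⟩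
            · rw [h]
            · rw [h, h']
              exact iff_of_false (hna a ha) (hna a' ha')
        · have hx : x ∈ Finset.univ.filter fun v => ∀ w, p v = p w ↔ c' v = c' w := by
            simp only [Finset.mem_filter, Finset.mem_univ, true_and]
            intro w
            rw [h2 x w rfl, eq_comm]
          have := hsub hx
          simp only [Finset.mem_filter, Finset.mem_univ, true_and] at this
          exact hxz ((this z).2 hcxz)
      have hle : m c' ≤ Fintype.card V := Finset.card_le_univ _
      exact ih (Fintype.card V - m c') (by omega) c' hmin rfl

end Coloring

/-! ### The interval-modular cardinality -/

section Cardinality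

variable {V ι : Type*} {G : SimpleGraph V}

theorem IsIntervalModularColoring.adj_congr {p : V → ι} (hp : G.IsIntervalModularColoring p)
    {x y x' y' : V} (hx : p x = p x') (hy : p y = p y') (hne : p x ≠ p y) (h : G.Adj x y) :
    G.Adj x' y' := by
  have h1 := (hp (p y)).1.adj_of_adj (v := x) hne rfl hy.symm h
  exact ((hp (p x)).1.adj_of_adj (v := y') (fun h => hne (Eq.trans h.symm hy.symm)) rfl hx.symm
    h1.symm).symm

theorem isIntervalModularPartition_iff [Fintype V] [DecidableEq V]
    (P : Finpartition (Finset.univ : Finset V)) :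
    G.IsIntervalModularPartition P ↔ G.IsIntervalModularColoring P.part := by
  have hpart : ∀ M ∈ P.parts, {v | P.part v = M} = (M : Set V) := by
    intro M hM
    ext v
    simp only [Set.mem_ofPred_eq, Finset.mem_coe]
    exact P.part_eq_iff_mem hM
  constructor
  · intro h M
    by_cases hM : M ∈ P.parts
    · rw [hpart M hM]
      exact ⟨(h M hM).1, isIntervalGraph_induce_iff.1 (h M hM).2⟩
    · have : {v | P.part v = M} = ∅ := by
        ext v
        simp only [Set.mem_ofPred_eq, Set.mem_empty_iff_false, iff_false]
        rintro rfl
        exact hM (P.part_mem.2 (Finset.mem_univ v))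
      rw [this]
      exact ⟨fun v _ => by simp, fun _ _ => False, by simp, by simp, by simp⟩
  · intro h M hM
    have := h M
    rw [hpart M hM] at this
    exact ⟨this.1, isIntervalGraph_induce_iff.2 this.2⟩

theorem _root_.Finpartition.image_part [Fintype V] [DecidableEq V]
    (P : Finpartition (Finset.univ : Finset V)) : Finset.univ.image P.part = P.parts := by
  ext M
  simp only [Finset.mem_image, Finset.mem_univ, true_and]
  constructor
  · rintro ⟨v, rfl⟩
    exact P.part_mem.2 (Finset.mem_univ v)
  · intro hM
    obtain ⟨v, hv⟩ := P.nonempty_of_mem_parts hM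
    exact ⟨v, (P.part_eq_iff_mem hM).2 hv⟩

theorem _root_.Finset.card_image_le_of_ker_le {α β γ : Type*} [DecidableEq β] [DecidableEq γ]
    {s : Finset α} {f : α → β} {g : α → γ} (h : ∀ x y, f x = f y → g x = g y) :
    (s.image g).card ≤ (s.image f).card := by
  rcases s.eq_empty_or_nonempty with rfl | ⟨a, -⟩
  · simp
  have : Nonempty α := ⟨a⟩
  choose! k hk using fun b (hb : b ∈ s.image f) => Finset.mem_image.1 hb
  refine (Finset.card_le_card ?_).trans
    (Finset.card_image_le (s := s.image f) (f := fun b => g (k b)))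
  intro i hi
  obtain ⟨x, hx, rfl⟩ := Finset.mem_image.1 hi
  have hm := Finset.mem_image_of_mem f hx
  exact Finset.mem_image.2 ⟨f x, hm, h _ _ (hk _ hm).2⟩

theorem _root_.Finset.card_image_eq_of_ker_eq {α β γ : Type*} [DecidableEq β] [DecidableEq γ]
    {s : Finset α} {f : α → β} {g : α → γ} (h : ∀ x y, f x = f y ↔ g x = g y) :
    (s.image f).card = (s.image g).card :=
  le_antisymm (Finset.card_image_le_of_ker_le fun x y => (h x y).2)
    (Finset.card_image_le_of_ker_le fun x y => (h x y).1)

/-- Every interval-modular coloring comes from a partition. -/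
theorem IsIntervalModularColoring.exists_finpartition [Fintype V] [DecidableEq V] {p : V → ι}
    (hp : G.IsIntervalModularColoring p) :
    ∃ P : Finpartition (Finset.univ : Finset V), G.IsIntervalModularPartition P ∧
      ∀ x y, P.part x = P.part y ↔ p x = p y := by
  classical
  have key : ∀ x y, (Finpartition.ofSetoid (Setoid.ker p)).part x =
      (Finpartition.ofSetoid (Setoid.ker p)).part y ↔ p x = p y := by
    intro x y
    rw [eq_comm, Finpartition.part_eq_iff_mem _ (Finpartition.part_mem _ |>.2 (Finset.mem_univ x)),
      Finpartition.mem_part_ofSetoid_iff_rel]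
    rfl
  refine ⟨Finpartition.ofSetoid (Setoid.ker p), (isIntervalModularPartition_iff _).2 ?_, key⟩
  intro M
  by_cases hM : ∃ v, (Finpartition.ofSetoid (Setoid.ker p)).part v = M
  · obtain ⟨v, rfl⟩ := hM
    convert hp (p v) using 1
    ext w
    exact key w v
  · have : {v | (Finpartition.ofSetoid (Setoid.ker p)).part v = M} = ∅ := by
      ext v
      exact iff_of_false (fun h => hM ⟨v, h⟩) (fun h => h)
    rw [this]
    exact ⟨fun v _ => by simp, fun _ _ => False, by simp, by simp, by simp⟩

theorem exists_isOptimalIntervalModularPartition [Fintype V] [DecidableEq V] (G : SimpleGraph V) :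
    ∃ P : Finpartition (Finset.univ : Finset V), G.IsOptimalIntervalModularPartition P := by
  have hid : G.IsIntervalModularColoring (id : V → V) := fun i =>
    isIntervalModule_of_forall_eq (v := i) fun x hx => hx
  obtain ⟨P, hP, -⟩ := hid.exists_finpartition
  exact Nat.sInf_mem (s := {k | ∃ P : Finpartition (Finset.univ : Finset V),
    G.IsIntervalModularPartition P ∧ P.parts.card = k}) ⟨_, P, hP, rfl⟩

theorem IsIntervalModularColoring.intervalModularCardinality_le [Fintype V] [DecidableEq V]
    [DecidableEq ι] {p : V → ι} (hp : G.IsIntervalModularColoring p) :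
    G.intervalModularCardinality ≤ (Finset.univ.image p).card := by
  obtain ⟨P, hP, hk⟩ := hp.exists_finpartition
  rw [← Finset.card_image_eq_of_ker_eq hk, P.image_part]
  exact Nat.sInf_le ⟨P, hP, rfl⟩

theorem IsOptimalIntervalModularPartition.isMinimumColoring [Fintype V] [DecidableEq V]
    {P : Finpartition (Finset.univ : Finset V)} (hP : G.IsOptimalIntervalModularPartition P) :
    G.IsMinimumColoring P.part := by
  refine ⟨(isIntervalModularPartition_iff P).1 hP.1, fun c' hc' => ?_⟩
  rw [P.image_part, hP.2]
  exact hc'.intervalModularCardinality_le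

/-- Unmergeable partitions are optimal. -/
theorem IsUnmergeable.card_image_eq [Fintype V] [DecidableEq V] [DecidableEq ι] {p : V → ι}
    (hpm : G.IsUnmergeable p) (hp : G.IsIntervalModularColoring p) :
    (Finset.univ.image p).card = G.intervalModularCardinality := by
  obtain ⟨P, hP⟩ := exists_isOptimalIntervalModularPartition G
  obtain ⟨c, hc, hpc⟩ := hpm.exists_minimum_eq hp hP.isMinimumColoring
  rw [Finset.card_image_eq_of_ker_eq hpc, ← hP.2, ← P.image_part]
  exact le_antisymm (hc.2 _ hP.isMinimumColoring.1) (hP.isMinimumColoring.2 _ hc.1)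

end Cardinality

/-! ### Thinness of induced subgraphs -/

section Thinness

variable {V W : Type*} {G : SimpleGraph V} {H : SimpleGraph W}

theorem IsThin.of_embedding {k : ℕ} (hG : G.IsThin k) (f : H ↪g G) : H.IsThin k := by
  obtain ⟨lt, cls, hlt, h⟩ := hG
  refine ⟨fun a b => lt (f a) (f b), fun a => cls (f a), ?_, fun a b c hab hbc hcl hac => ?_⟩
  · exact (RelEmbedding.preimage f.toEmbedding lt).isStrictTotalOrder
  · rw [← f.map_adj_iff] at hac ⊢
    exact h _ _ _ hab hbc hcl hac

theorem isThin_card [Fintype V] (G : SimpleGraph V) : G.IsThin (Fintype.card V) := by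
  let e := Fintype.equivFin V
  refine ⟨fun a b => e a < e b, e, ?_, fun a b c _ _ hab h => ?_⟩
  · exact (RelEmbedding.preimage e.toEmbedding (· < ·)).isStrictTotalOrder
  · rwa [← e.injective hab]

theorem thinness_le_card [Fintype V] (G : SimpleGraph V) : G.thinness ≤ Fintype.card V :=
  Nat.sInf_le G.isThin_card

theorem isThin_thinness [Fintype V] (G : SimpleGraph V) : G.IsThin G.thinness :=
  Nat.sInf_mem (s := {k | G.IsThin k}) ⟨_, G.isThin_card⟩

end Thinness

/-! ### Contracting the parts -/

section Contraction

variable {V W ι : Type*} {G : SimpleGraph V} {H : SimpleGraph W}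

/-- The image of `f` has exactly one vertex in every complete part, and exactly two, nonadjacent,
vertices in every other part. -/
structure IsContraction (p : V → ι) (f : H ↪g G) : Prop where
  exists_mem : ∀ v, ∃ s, p (f s) = p v
  not_adj : ∀ s t, p (f s) = p (f t) → ¬ H.Adj s t
  exists_pair : ∀ v w, p v = p w → v ≠ w → ¬ G.Adj v w →
    ∃ s t, p (f s) = p v ∧ p (f t) = p v ∧ s ≠ t
  le_two : ∀ s t u, p (f s) = p (f t) → p (f s) = p (f u) → s = t ∨ s = u ∨ t = u

theorem IsIntervalModule.comap {A : Set V} (hA : G.IsIntervalModule A) (f : H ↪g G) :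
    H.IsIntervalModule {w | f w ∈ A} := by
  obtain ⟨h1, R, h2, h3, h4⟩ := hA
  refine ⟨isModule_iff.2 fun v hv x hx y hy hvx => ?_, fun x y => R (f x) (f y),
    fun x hx => h2 _ hx, fun x hx y hy z hz w hw => h3 _ hx _ hy _ hz _ hw,
    fun x hx y hy hxy => ?_⟩
  · rw [← f.map_adj_iff] at hvx ⊢
    exact h1.adj_of_adj hv hx hy hvx
  · rw [← f.map_adj_iff]
    exact h4 _ hx _ hy (fun h => hxy (f.injective h))

/-- A system of representatives that depends on the part only. -/
theorem IsContraction.exists_section {p : V → ι} {f : H ↪g G} (hf : IsContraction p f) :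
    ∃ ρ : V → W, (∀ v, p (f (ρ v)) = p v) ∧ ∀ v w, p v = p w → ρ v = ρ w := by
  have : ∀ i : Set.range p, ∃ w, p (f w) = i := by
    rintro ⟨_, v, rfl⟩
    exact hf.exists_mem v
  choose g hg using this
  refine ⟨fun v => g ⟨p v, v, rfl⟩, fun v => hg _, fun v w h => ?_⟩
  simp only [h]

/-- Nonadjacent vertices are represented by nonadjacent vertices of the contraction. -/
theorem IsContraction.exists_not_adj {p : V → ι} {f : H ↪g G} (hf : IsContraction p f)
    (hp : G.IsIntervalModularColoring p) {x y : V} (hxy : x ≠ y) (h : ¬ G.Adj x y) :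
    ∃ s t, p (f s) = p x ∧ p (f t) = p y ∧ s ≠ t ∧ ¬ H.Adj s t := by
  by_cases e : p x = p y
  · obtain ⟨s, t, hs, ht, hst⟩ := hf.exists_pair x y e hxy h
    exact ⟨s, t, hs, ht.trans e, hst, hf.not_adj s t (hs.trans ht.symm)⟩
  · obtain ⟨s, hs⟩ := hf.exists_mem x
    obtain ⟨t, ht⟩ := hf.exists_mem y
    refine ⟨s, t, hs, ht, ?_, fun hadj => h ?_⟩
    · rintro rfl
      exact e (hs.symm.trans ht)
    · rw [← f.map_adj_iff] at hadj
      refine hp.adj_congr hs ht ?_ hadj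
      rwa [hs, ht]

theorem IsContraction.isIntervalModularColoring {p : V → ι} (f : H ↪g G)
    (hp : G.IsIntervalModularColoring p) : H.IsIntervalModularColoring fun w => p (f w) :=
  fun i => (hp i).comap f

/-- An interval module of the contraction that is a union of parts expands to an interval module:
parts with two representatives have a clique as their neighbourhood, since two nonadjacent
neighbours would close an induced cycle of length four. -/
theorem IsContraction.isUnmergeable {p : V → ι} {f : H ↪g G} (hf : IsContraction p f)
    (hp : G.IsIntervalModularColoring p) (hm : G.IsUnmergeable p) :
    H.IsUnmergeable fun w => p (f w) := by
  intro Y hY hsat x hx y hy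
  obtain ⟨ρ, hρ, hρp⟩ := hf.exists_section
  have hadj : ∀ {s t : W} {v w : V}, p (f s) = p v → p (f t) = p w → p v ≠ p w →
      (G.Adj v w ↔ H.Adj s t) := by
    intro s t v w hs ht hne
    rw [← f.map_adj_iff]
    exact ⟨hp.adj_congr hs.symm ht.symm hne, hp.adj_congr hs ht (by rwa [hs, ht])⟩
  refine hm {v | ρ v ∈ Y} ⟨?_, ?_⟩ ?_ (f x) ?_ (f y) ?_
  · rw [isModule_iff]
    intro v hv a ha b hb hva
    have hne : ∀ u, ρ u ∈ Y → p v ≠ p u := by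
      intro u hu h
      rw [← hρp _ _ h] at hu
      exact hv hu
    rw [hadj (hρ v) (hρ a) (hne a ha)] at hva
    rw [hadj (hρ v) (hρ b) (hne b hb)]
    exact hY.1.adj_of_adj hv ha hb hva
  · obtain ⟨R, h1, h2, h3⟩ := hY.2
    refine isIntervalOn_of_quotient ρ R (fun a ha => h1 _ ha)
      (fun a ha b hb c hc d hd => h2 _ ha _ hb _ hc _ hd) ?_ ?_ ?_
    · intro a ha b hb hab
      rw [hadj (hρ a) (hρ b) (fun h => hab (hρp _ _ h))]
      exact h3 _ ha _ hb hab
    · intro i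
      refine (hp (p (f i))).2.mono ?_
      rintro v ⟨-, hv⟩
      rw [← hv]
      exact (hρ v).symm
    · intro a ha b hb c hc d hd hac had hbc hbd hab hcd
      by_contra hcon
      rw [not_or] at hcon
      -- a cycle with two consecutive vertices in one part lies in that part
      have key : ∀ a b c d, G.Adj a c → G.Adj a d → G.Adj b c → G.Adj b d → a ≠ b → c ≠ d →
          ¬ G.Adj a b → ¬ G.Adj c d → p a ≠ p c := by
        intro a b c d hac had hbc hbd hab hcd nab ncd e
        have hb : p b = p a := by
          by_contra h
          exact nab ((hp (p a)).1.adj_of_adj h e.symm rfl hbc).symm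
        have hd : p d = p a := by
          by_contra h
          exact ncd ((hp (p a)).1.adj_of_adj h rfl e.symm had.symm).symm
        rcases (hp (p a)).2.noC4On a rfl b hb c e.symm d hd hac had hbc hbd hab hcd with h | h
        · exact nab h
        · exact ncd h
      have n1 := key a b c d hac had hbc hbd hab hcd hcon.1 hcon.2
      have n2 := key a b d c had hac hbd hbc hab hcd.symm hcon.1 (fun h => hcon.2 h.symm)
      have n3 := key b a c d hbc hbd hac had hab.symm hcd (fun h => hcon.1 h.symm) hcon.2
      have n4 := key b a d c hbd hbc had hac hab.symm hcd.symm (fun h => hcon.1 h.symm)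
        (fun h => hcon.2 h.symm)
      obtain ⟨s, t, hs, ht, hst, nst⟩ := hf.exists_not_adj hp hab hcon.1
      obtain ⟨s', t', hs', ht', hst', nst'⟩ := hf.exists_not_adj hp hcd hcon.2
      have hmem : ∀ {v s}, ρ v ∈ Y → p (f s) = p v → s ∈ Y := fun {v s} hv hs =>
        hsat _ hv _ (hs.trans (hρ v).symm)
      rcases hY.2.noC4On s (hmem ha hs) t (hmem hb ht) s' (hmem hc hs') t' (hmem hd ht')
        ((hadj hs hs' n1).1 hac) ((hadj hs ht' n2).1 had) ((hadj ht hs' n3).1 hbc)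
        ((hadj ht ht' n4).1 hbd) hst hst' with h | h
      · exact nst h
      · exact nst' h
  · intro v hv w hw
    change ρ w ∈ Y
    rw [hρp _ _ hw]
    exact hv
  · exact hsat x hx _ (hρ _)
  · exact hsat y hy _ (hρ _)

theorem IsContraction.intervalModularCardinality_eq [Fintype V] [DecidableEq V] [Fintype W]
    [DecidableEq W] {p : V → ι} {f : H ↪g G} (hf : IsContraction p f)
    (hp : G.IsIntervalModularColoring p) (hm : G.IsUnmergeable p) :
    H.intervalModularCardinality = G.intervalModularCardinality := by
  classical
  rw [← hm.card_image_eq hp,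
    ← (hf.isUnmergeable hp hm).card_image_eq (IsContraction.isIntervalModularColoring f hp)]
  congr 1
  ext i
  simp only [Finset.mem_image, Finset.mem_univ, true_and]
  constructor
  · rintro ⟨w, rfl⟩
    exact ⟨f w, rfl⟩
  · rintro ⟨v, rfl⟩
    exact hf.exists_mem v

/-- Every part is inserted, ordered by right endpoints, in the place of its first representative,
and it gets the class of that representative. -/
theorem IsContraction.isThin [Finite V] {p : V → ι} {f : H ↪g G} (hf : IsContraction p f)
    (hp : G.IsIntervalModularColoring p) {k : ℕ} (h : H.IsThin k) : G.IsThin k := by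
  obtain ⟨lt, cls, hlt, h⟩ := h
  have : Finite W := Finite.of_injective f f.injective
  have hwf : WellFounded lt := Finite.wellFounded_of_trans_of_irrefl lt
  have hmin : ∀ v, ∃ s, p (f s) = p v ∧ ∀ t, p (f t) = p v → t ≠ s → lt s t := by
    intro v
    obtain ⟨s, hs, hmin⟩ := hwf.has_min {s | p (f s) = p v} (hf.exists_mem v)
    refine ⟨s, hs, fun t ht hts => ?_⟩
    rcases trichotomous_of lt s t with h | h | h
    · exact h
    · exact absurd h.symm hts
    · exact absurd h (hmin t ht)
  choose π hπ hπmin using hmin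
  have hπp : ∀ v w, p v = p w → π v = π w := by
    intro v w e
    by_contra hne
    have h1 := hπmin v (π w) ((hπ w).trans e.symm) (Ne.symm hne)
    have h2 := hπmin w (π v) ((hπ v).trans e) hne
    exact irrefl (r := lt) _ (_root_.trans h1 h2)
  have hπp' : ∀ v w, π v = π w → p v = p w := fun v w e => by rw [← hπ v, ← hπ w, e]
  choose r hr using fun i => (hp i).2.exists_right_endpoint
  obtain ⟨n, ⟨e⟩⟩ := Finite.exists_equiv_fin V
  have hadj : ∀ v w, p v ≠ p w → (G.Adj v w ↔ H.Adj (π v) (π w)) := by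
    intro v w hne
    rw [← f.map_adj_iff]
    exact ⟨hp.adj_congr (hπ v).symm (hπ w).symm hne,
      hp.adj_congr (hπ v) (hπ w) (by rwa [hπ v, hπ w])⟩
  let sub : V → V → Prop := fun v w =>
    r (p v) v < r (p v) w ∨ (r (p v) v = r (p v) w ∧ e v < e w)
  refine ⟨fun v w => lt (π v) (π w) ∨ (p v = p w ∧ sub v w), fun v => cls (π v), ?_, ?_⟩
  · refine { trichotomous := ?_, irrefl := ?_, trans := ?_ }
    · intro a b hab hba
      rw [not_or] at hab hba
      have e1 : π a = π b := by
        rcases trichotomous_of lt (π a) (π b) with h | h | h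
        · exact absurd h hab.1
        · exact h
        · exact absurd h hba.1
      have e2 := hπp' _ _ e1
      have h1 : ¬ sub a b := fun h => hab.2 ⟨e2, h⟩
      have h2 : ¬ sub b a := fun h => hba.2 ⟨e2.symm, h⟩
      simp only [sub, e2, not_or, not_and, not_lt] at h1 h2
      have e3 := le_antisymm h2.1 h1.1
      exact e.injective (le_antisymm (h2.2 e3.symm) (h1.2 e3))
    · rintro a (h | ⟨-, h | ⟨-, h⟩⟩)
      · exact irrefl (r := lt) _ h
      · exact lt_irrefl _ h
      · exact lt_irrefl _ h
    · rintro a b c (hab | ⟨eab, hab⟩) (hbc | ⟨ebc, hbc⟩)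
      · exact Or.inl (_root_.trans hab hbc)
      · exact Or.inl (hπp _ _ ebc ▸ hab)
      · exact Or.inl (hπp _ _ eab ▸ hbc)
      · refine Or.inr ⟨eab.trans ebc, ?_⟩
        simp only [sub, ← eab] at hab hbc ⊢
        rcases hab with hab | ⟨hab, hab'⟩ <;> rcases hbc with hbc | ⟨hbc, hbc'⟩
        · exact Or.inl (hab.trans hbc)
        · exact Or.inl (hbc ▸ hab)
        · exact Or.inl (hab ▸ hbc)
        · exact Or.inr ⟨hab.trans hbc, hab'.trans hbc'⟩
  · intro a b c hab hbc hcl hac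
    have hsub : ∀ v w, sub v w → r (p v) v ≤ r (p v) w ∧ v ≠ w := by
      rintro v w (h | ⟨h, h'⟩)
      · refine ⟨h.le, ?_⟩
        rintro rfl
        exact lt_irrefl _ h
      · refine ⟨h.le, ?_⟩
        rintro rfl
        exact lt_irrefl _ h'
    rcases hab with hab | ⟨eab, hab⟩ <;> rcases hbc with hbc | ⟨ebc, hbc⟩
    · have e1 : p a ≠ p c := fun e =>
        irrefl (r := lt) _ (_root_.trans hab (hπp _ _ e ▸ hbc))
      have e2 : p b ≠ p c := fun e => irrefl (r := lt) (π b) (by rw [← hπp _ _ e] at hbc; exact hbc)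
      rw [hadj _ _ e1] at hac
      rw [hadj _ _ e2]
      exact h _ _ _ hab hbc hcl hac
    · have e1 : p a ≠ p b := fun e => irrefl (r := lt) (π b) (by rw [hπp _ _ e] at hab; exact hab)
      by_contra hnbc
      obtain ⟨s, t, hs, ht, hst⟩ := hf.exists_pair b c ebc (hsub _ _ hbc).2 hnbc
      -- a representative of the part of `b` and `c` after the first one
      obtain ⟨u, hu, hub⟩ : ∃ u, p (f u) = p b ∧ u ≠ π b := by
        by_cases e : s = π b
        · exact ⟨t, ht, fun h => hst (e.trans h.symm)⟩
        · exact ⟨s, hs, e⟩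
      have h1 : H.Adj (π a) u := by
        rw [← f.map_adj_iff]
        exact hp.adj_congr (hπ a).symm (ebc.symm.trans hu.symm) (ebc ▸ e1) hac
      exact hf.not_adj _ _ ((hπ b).trans hu.symm) (h _ _ _ hab (hπmin b u hu hub) hcl h1)
    · exact hp.adj_congr eab rfl
        (fun e => irrefl (r := lt) (π b) (by
          rw [← hπp _ _ e, hπp _ _ eab] at hbc; exact hbc)) hac
    · have h1 := hsub _ _ hab
      have h2 := hsub _ _ hbc
      rw [← eab] at h2
      exact hr (p a) a rfl b eab.symm c (eab.trans ebc).symm h1.1 h2.1 h2.2 hac.ne hac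

theorem IsContraction.thinness_eq [Fintype V] {p : V → ι} {f : H ↪g G} (hf : IsContraction p f)
    (hp : G.IsIntervalModularColoring p) : H.thinness = G.thinness := by
  have : Finite W := Finite.of_injective f f.injective
  have := Fintype.ofFinite W
  exact le_antisymm (Nat.sInf_le (G.isThin_thinness.of_embedding f))
    (Nat.sInf_le (hf.isThin hp H.isThin_thinness))

/-- Every partition admits a contraction inside the graph: choose two nonadjacent vertices, or else
one vertex, in every part. -/
theorem exists_isContraction (G : SimpleGraph V) (p : V → ι) :
    ∃ T : Set V, IsContraction p (Embedding.induce (G := G) T) := by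
  classical
  have : ∀ i : Set.range p, ∃ a b : V, p a = i ∧ p b = i ∧ ¬ G.Adj a b ∧
      ((∃ v w, p v = i ∧ p w = i ∧ v ≠ w ∧ ¬ G.Adj v w) → a ≠ b) := by
    rintro ⟨_, v, rfl⟩
    by_cases h : ∃ a b, p a = p v ∧ p b = p v ∧ a ≠ b ∧ ¬ G.Adj a b
    · obtain ⟨a, b, ha, hb, hne, hab⟩ := h
      exact ⟨a, b, ha, hb, hab, fun _ => hne⟩
    · exact ⟨v, v, rfl, rfl, G.loopless.irrefl v, fun h' => absurd h' h⟩
  choose a b ha hb hab hne using this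
  have hT : ∀ (i : Set.range p) (v : V), (∃ j, v = a j ∨ v = b j) → p v = i →
      v = a i ∨ v = b i := by
    rintro i v ⟨j, hj⟩ hv
    have : j = i := Subtype.ext (by
      rcases hj with rfl | rfl
      · exact (ha j).symm.trans hv
      · exact (hb j).symm.trans hv)
    rwa [this] at hj
  refine ⟨{v | ∃ j, v = a j ∨ v = b j}, fun v => ?_, fun s t e hst => ?_, fun v w e hvw hnvw => ?_,
    fun s t u hst hsu => ?_⟩
  · exact ⟨⟨a ⟨p v, v, rfl⟩, _, Or.inl rfl⟩, ha _⟩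
  · rw [← (Embedding.induce (G := G) _).map_adj_iff] at hst
    rcases hT ⟨p s, s, rfl⟩ s s.2 rfl with h | h <;>
      rcases hT ⟨p s, s, rfl⟩ t t.2 e.symm with h' | h' <;>
      change G.Adj s t at hst <;> rw [h, h'] at hst
    · exact hst.ne rfl
    · exact hab _ hst
    · exact hab _ hst.symm
    · exact hst.ne rfl
  · exact ⟨⟨a ⟨p v, v, rfl⟩, _, Or.inl rfl⟩, ⟨b ⟨p v, v, rfl⟩, _, Or.inr rfl⟩, ha _, hb _,
      fun h => hne _ ⟨v, w, rfl, e.symm, hvw, hnvw⟩ (congrArg Subtype.val h)⟩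
  · simp only [Subtype.ext_iff]
    rcases hT ⟨p s, s, rfl⟩ s s.2 rfl with h | h <;>
      rcases hT ⟨p s, s, rfl⟩ t t.2 hst.symm with h' | h' <;>
      rcases hT ⟨p s, s, rfl⟩ u u.2 hsu.symm with h'' | h'' <;>
      rw [h, h', h''] <;> tauto

/-- Any contraction in the sense of `IsContraction` is isomorphic to the contracted graph. -/
theorem IsContraction.nonempty_iso {V : Type u} [Fintype V] [DecidableEq V] {W : Type*}
    {G : SimpleGraph V} {H : SimpleGraph W}
    {P : Finpartition (Finset.univ : Finset V)} {f : H ↪g G} (hf : IsContraction P.part f)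
    (hP : G.IsIntervalModularPartition P) : Nonempty (H ≃g G.contractPartition P) := by
  classical
  have hp := (isIntervalModularPartition_iff P).1 hP
  have : Finite W := Finite.of_injective f f.injective
  let q : W → {M : Finset V // M ∈ P.parts} := fun w =>
    ⟨P.part (f w), P.part_mem.2 (Finset.mem_univ _)⟩
  have hq : ∀ w M, q w = M ↔ P.part (f w) = M.1 := fun w M => Subtype.ext_iff
  have hcard : ∀ M : {M : Finset V // M ∈ P.parts}, Nat.card {w // q w = M} =
      if G.IsClique (M.1 : Set V) then 1 else 2 := by
    intro M
    obtain ⟨v, hv⟩ := P.nonempty_of_mem_parts M.2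
    have hvM := (P.part_eq_iff_mem M.2).2 hv
    split_ifs with hcl
    · rw [Nat.card_eq_one_iff_unique]
      obtain ⟨s, hs⟩ := hf.exists_mem v
      refine ⟨⟨fun a b => ?_⟩, ⟨⟨s, (hq _ _).2 (hs.trans hvM)⟩⟩⟩
      by_contra hne
      have ha := (hq _ _).1 a.2
      have hb := (hq _ _).1 b.2
      refine hf.not_adj a b (ha.trans hb.symm) ?_
      rw [← f.map_adj_iff]
      refine hcl ((P.part_eq_iff_mem M.2).1 ha) ((P.part_eq_iff_mem M.2).1 hb) fun h => hne ?_
      exact Subtype.ext (f.injective h)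
    · rw [Nat.card_eq_two_iff]
      simp only [IsClique, Set.Pairwise, not_forall, exists_prop] at hcl
      obtain ⟨x, hx, y, hy, hxy, hadj⟩ := hcl
      have hx' := (P.part_eq_iff_mem M.2).2 hx
      have hy' := (P.part_eq_iff_mem M.2).2 hy
      obtain ⟨s, t, hs, ht, hst⟩ := hf.exists_pair x y (hx'.trans hy'.symm) hxy hadj
      refine ⟨⟨s, (hq _ _).2 (hs.trans hx')⟩, ⟨t, (hq _ _).2 (ht.trans hx')⟩,
        fun h => hst (congrArg Subtype.val h), Set.eq_univ_of_forall fun u => ?_⟩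
      have hu := (hq _ _).1 u.2
      rcases hf.le_two s t u (hs.trans ht.symm) (hs.trans (hx'.trans hu.symm)) with h | h | h
      · exact absurd h hst
      · exact Or.inl (Subtype.ext h.symm)
      · exact Or.inr (Subtype.ext h.symm)
  let e : W ≃ G.ContractVertex P := (Equiv.sigmaFiberEquiv q).symm.trans
    (Equiv.sigmaCongrRight fun M => Finite.equivFinOfCardEq (hcard M))
  have he : ∀ w, (e w).1 = q w := fun w => rfl
  refine ⟨⟨e, fun {s t} => ?_⟩⟩
  change ((e s).1 ≠ (e t).1 ∧ ∃ v ∈ (e s).1.1, ∃ w ∈ (e t).1.1, G.Adj v w) ↔ H.Adj s t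
  rw [he, he]
  have hne : q s ≠ q t ↔ P.part (f s) ≠ P.part (f t) := by rw [Ne, hq]
  rw [hne]
  constructor
  · rintro ⟨hst, v, hv, w, hw, hvw⟩
    rw [← f.map_adj_iff]
    have hv' := (P.part_eq_iff_mem (q s).2).2 hv
    have hw' := (P.part_eq_iff_mem (q t).2).2 hw
    exact hp.adj_congr hv' hw' (by rw [hv', hw']; exact hst) hvw
  · intro hst
    exact ⟨fun h => hf.not_adj s t h hst, f s, P.mem_part (Finset.mem_univ _), f t,
      P.mem_part (Finset.mem_univ _), f.map_adj_iff.2 hst⟩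

theorem card_contractVertex_le [Fintype V] [DecidableEq V] (G : SimpleGraph V)
    (P : Finpartition (Finset.univ : Finset V)) :
    Nat.card (G.ContractVertex P) ≤ 2 * P.parts.card := by
  classical
  change Nat.card (Σ M : {M : Finset V // M ∈ P.parts},
    Fin (if G.IsClique (M.1 : Set V) then 1 else 2)) ≤ _
  rw [Nat.card_sigma]
  calc _ ≤ ∑ M : {M : Finset V // M ∈ P.parts}, 2 := Finset.sum_le_sum fun M _ => by
        rw [Nat.card_fin]
        split_ifs <;> omega
    _ = 2 * P.parts.card := by simp [mul_comm]

theorem thinness_contractPartition {V : Type u} [Fintype V] [DecidableEq V] {G : SimpleGraph V}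
    {P : Finpartition (Finset.univ : Finset V)} (hP : G.IsIntervalModularPartition P) :
    (G.contractPartition P).thinness = G.thinness := by
  obtain ⟨T, hT⟩ := exists_isContraction G P.part
  obtain ⟨e⟩ := hT.nonempty_iso hP
  rw [← hT.thinness_eq ((isIntervalModularPartition_iff P).1 hP)]
  have := Fintype.ofFinite T
  have := Fintype.ofEquiv _ e.toEquiv
  exact le_antisymm (Nat.sInf_le ((isThin_thinness _).of_embedding e.symm.toEmbedding))
    (Nat.sInf_le ((isThin_thinness _).of_embedding e.toEmbedding))

theorem thinness_le_two_mul {V : Type u} [Fintype V] [DecidableEq V] (G : SimpleGraph V) :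
    G.thinness ≤ 2 * G.intervalModularCardinality := by
  obtain ⟨P, hP⟩ := exists_isOptimalIntervalModularPartition G
  have h := card_contractVertex_le G P
  obtain ⟨T, hT⟩ := exists_isContraction G P.part
  obtain ⟨e⟩ := hT.nonempty_iso hP.1
  have := Fintype.ofFinite T
  have := Fintype.ofEquiv _ e.toEquiv
  rw [← hP.2, ← thinness_contractPartition hP.1]
  refine (thinness_le_card _).trans ?_
  rwa [← Nat.card_eq_fintype_card]

end Contraction

end SimpleGraph

/-! ### Fixed points of inflationary maps -/

/-- Iterating an inflationary map as often as a bounded rank allows reaches a fixed point. -/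
theorem iterate_isFixedPt_of_rank {β : Type*} [PartialOrder β] (Φ : β → β) (hΦ : ∀ b, b ≤ Φ b)
    (m : β → ℕ) (hm : StrictMono m) {N : ℕ} (hN : ∀ b, m b ≤ N) (b : β) :
    Φ (Φ^[N] b) = Φ^[N] b := by
  have key : ∀ k, Φ (Φ^[k] b) = Φ^[k] b ∨ k + 1 ≤ m (Φ^[k + 1] b) := by
    intro k
    induction k with
    | zero =>
      by_cases h : Φ b = b
      · exact Or.inl h
      · exact Or.inr (Nat.succ_le_of_lt ((Nat.zero_le _).trans_lt
          (hm (lt_of_le_of_ne (hΦ b) (Ne.symm h)))))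
    | succ k ih =>
      rw [Function.iterate_succ_apply' Φ (k + 1)]
      rcases ih with ih | ih
      · left
        rw [Function.iterate_succ_apply' Φ k, ih, ih]
      · by_cases h : Φ (Φ^[k + 1] b) = Φ^[k + 1] b
        · exact Or.inl h
        · have := hm (lt_of_le_of_ne (hΦ (Φ^[k + 1] b)) (Ne.symm h))
          right
          omega
  rcases key N with h | h
  · exact h
  · exact absurd (hN (Φ^[N + 1] b)) (by omega)

/-- If folding inflationary steps over a list has no effect, no single step has. -/
theorem List.eq_of_foldl_eq {α β : Type*} [PartialOrder β] (f : β → α → β)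
    (hf : ∀ b x, b ≤ f b x) (L : List α) :
    ∀ b, b ≤ L.foldl f b ∧ (L.foldl f b = b → ∀ x ∈ L, f b x = b) := by
  induction L with
  | nil => simp
  | cons a L ih =>
    intro b
    obtain ⟨h1, h2⟩ := ih (f b a)
    refine ⟨(hf b a).trans h1, fun h => ?_⟩
    rw [List.foldl_cons] at h
    have hb : f b a = b := le_antisymm (h1.trans_eq h) (hf b a)
    rw [hb] at h h2
    intro x hx
    rcases List.mem_cons.1 hx with rfl | hx
    · exact hb
    · exact h2 h x hx

theorem iterate_pred_isFixedPt {V : Type*} [Fintype V] (Φ : (V → Prop) → V → Prop)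
    (hΦ : ∀ X, X ≤ Φ X) (X : V → Prop) :
    Φ (Φ^[Fintype.card V * Fintype.card V] X) = Φ^[Fintype.card V * Fintype.card V] X := by
  classical
  refine iterate_isFixedPt_of_rank Φ hΦ (fun X => (Finset.univ.filter X).card) ?_ ?_ X
  · intro X Y hXY
    refine Finset.card_lt_card ⟨fun v hv => ?_, fun h => hXY.2 fun v hv => ?_⟩
    · simp only [Finset.mem_filter, Finset.mem_univ, true_and] at hv ⊢
      exact hXY.1 v hv
    · have := h (Finset.mem_filter.2 ⟨Finset.mem_univ v, hv⟩)
      exact (Finset.mem_filter.1 this).2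
  · exact fun X => (Finset.card_le_univ _).trans (Nat.le_mul_self _)

theorem iterate_rel_isFixedPt {V : Type*} [Fintype V] (Φ : (V → V → Prop) → V → V → Prop)
    (hΦ : ∀ R, R ≤ Φ R) (R : V → V → Prop) :
    Φ (Φ^[Fintype.card V * Fintype.card V] R) = Φ^[Fintype.card V * Fintype.card V] R := by
  classical
  refine iterate_isFixedPt_of_rank Φ hΦ
    (fun R => (Finset.univ.filter fun p : V × V => R p.1 p.2).card) ?_ ?_ R
  · intro X Y hXY
    refine Finset.card_lt_card ⟨fun v hv => ?_, fun h => hXY.2 fun v w hv => ?_⟩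
    · simp only [Finset.mem_filter, Finset.mem_univ, true_and] at hv ⊢
      exact hXY.1 v.1 v.2 hv
    · have := h (Finset.mem_filter.2 ⟨Finset.mem_univ (v, w), hv⟩)
      exact (Finset.mem_filter.1 this).2
  · intro R
    refine (Finset.card_le_univ _).trans ?_
    rw [Fintype.card_prod]

theorem iterate_induction {β : Type*} {Φ : β → β} {p : β → Prop} (h : ∀ b, p b → p (Φ b)) {b : β}
    (hb : p b) (N : ℕ) : p (Φ^[N] b) := by
  induction N with
  | zero => exact hb
  | succ N ih =>
    rw [Function.iterate_succ_apply']
    exact h _ ih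

/-! ### Computing an optimal partition -/

namespace SimpleGraph

section Algorithm

variable {V : Type*} (G : SimpleGraph V)

/-- Add to `X` all vertices equivalent to one in `X`, and all vertices that distinguish two elements
of `X`. -/
def splitStep (E : V → V → Prop) (X : V → Prop) : V → Prop := fun x =>
  X x ∨ (∃ z, X z ∧ E z x) ∨ ∃ z w, (X z ∧ X w) ∧ G.Adj x z ∧ ¬ G.Adj x w

/-- The least module that contains `u` and `v` and is a union of classes of `E`. -/
def splitClosure [Fintype V] (E : V → V → Prop) (u v : V) : V → Prop :=
  (G.splitStep E)^[Fintype.card V * Fintype.card V] fun x => E x u ∨ E x v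

/-- The vertices of `X` that are the first in their class. -/
def firstIn [LinearOrder V] (E : V → V → Prop) (X : V → Prop) : V → Prop := fun x =>
  X x ∧ ¬ ∃ z, E z x ∧ ¬ x ≤ z

/-- In an interval representation, let `R x y` mean that `x` lies to the left of `y`.  A vertex
that meets `x` but not `y` then also lies to the left of `y`, and symmetrically.  This step adds
all such pairs within `T`. -/
def forceStep (T : V → Prop) (R : V → V → Prop) : V → V → Prop := fun x y =>
  R x y ∨ (T x ∧ T y) ∧ ∃ z, (R z y ∧ G.Adj z x ∧ ¬ G.Adj x y) ∨ (R x z ∧ G.Adj z y ∧ ¬ G.Adj x y)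

/-- The pairs that are forced to be ordered from left to right if `a` is a leftmost vertex. -/
def forced [Fintype V] (T : V → Prop) (a : V) : V → V → Prop :=
  (G.forceStep T)^[Fintype.card V * Fintype.card V] fun x y =>
    (T x ∧ T y) ∧ x = a ∧ x ≠ y ∧ ¬ G.Adj x y

/-- The relation `R` decides all nonadjacent pairs of `T`, and it is an interval order. -/
def Decides (T : V → Prop) (R : V → V → Prop) : Prop :=
  (¬ ∃ x y, (T x ∧ T y) ∧ (x ≠ y ∧ ¬ G.Adj x y) ∧ ¬ R x y ∧ ¬ R y x) ∧
    ¬ ∃ x y z w, (R x y ∧ R z w) ∧ ¬ R x w ∧ ¬ R z y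

/-- No induced cycle of length four in `X`. -/
def HasNoC4 (X : V → Prop) : Prop :=
  ¬ ∃ x y z w, ((X x ∧ X y) ∧ X z ∧ X w) ∧ ((G.Adj x z ∧ G.Adj x w) ∧ G.Adj y z ∧ G.Adj y w) ∧
    (x ≠ y ∧ z ≠ w) ∧ ¬ G.Adj x y ∧ ¬ G.Adj z w

/-- Merge all classes in the closure of `u` and `v` if this is recognized as an interval graph. -/
def mergeStep [Fintype V] [LinearOrder V] (E : V → V → Prop) (u v : V) : V → V → Prop :=
  fun x y => E x y ∨ ((∃ a, firstIn E (G.splitClosure E u v) a ∧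
    G.Decides (firstIn E (G.splitClosure E u v)) (G.forced (firstIn E (G.splitClosure E u v)) a)) ∧
      G.HasNoC4 (G.splitClosure E u v)) ∧ G.splitClosure E u v x ∧ G.splitClosure E u v y

/-- An equivalence relation whose classes are interval modules.  The classes are the fibers of
`E`, seen as a map to predicates. -/
def IsIntervalModularRel (E : V → V → Prop) : Prop :=
  Equivalence E ∧ G.IsIntervalModularColoring E

variable {G}

theorem _root_.Equivalence.apply_eq_iff {E : V → V → Prop} (hE : Equivalence E) {x y : V} :
    E x = E y ↔ E x y := by
  constructor
  · intro h
    rw [h]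
    exact hE.refl y
  · intro h
    funext z
    exact propext ⟨fun h' => hE.trans (hE.symm h) h', fun h' => hE.trans h h'⟩

theorem splitStep_le (E : V → V → Prop) (X : V → Prop) : X ≤ G.splitStep E X :=
  fun _ h => Or.inl h

theorem forceStep_le (T : V → Prop) (R : V → V → Prop) : R ≤ G.forceStep T R :=
  fun _ _ h => Or.inl h

theorem firstIn_unique [LinearOrder V] {E : V → V → Prop} (hE : Equivalence E)
    {X X' : V → Prop} {x y : V} (hx : firstIn E X x)
    (hy : firstIn E X' y) (hxy : E x y) : x = y := by
  refine le_antisymm (by_contra fun h => hx.2 ⟨y, hE.symm hxy, h⟩)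
    (by_contra fun h => hy.2 ⟨x, hxy, h⟩)

theorem firstIn_of_forall_le [LinearOrder V] {E : V → V → Prop} (hE : Equivalence E)
    {X : V → Prop} {x v : V} (hx : X x) (hxv : E x v) (h : ∀ z, E z v → x ≤ z) : firstIn E X x :=
  ⟨hx, fun ⟨z, hz, hxz⟩ => hxz (h z (hE.trans hz hxv))⟩

variable [Fintype V] {E : V → V → Prop}

theorem splitClosure_left (hE : Equivalence E) (u v : V) : G.splitClosure E u v u := by
  unfold splitClosure
  exact iterate_induction (p := fun X : V → Prop => X u) (fun X hX => splitStep_le E X u hX)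
    (Or.inl (hE.refl u)) _

theorem splitClosure_right (hE : Equivalence E) (u v : V) : G.splitClosure E u v v := by
  unfold splitClosure
  exact iterate_induction (p := fun X : V → Prop => X v) (fun X hX => splitStep_le E X v hX)
    (Or.inr (hE.refl v)) _

theorem splitStep_splitClosure (u v : V) :
    G.splitStep E (G.splitClosure E u v) = G.splitClosure E u v :=
  iterate_pred_isFixedPt _ (splitStep_le E) _

theorem splitClosure_saturated {u v x y : V} (hx : G.splitClosure E u v x) (h : E x y) :
    G.splitClosure E u v y := by
  rw [← splitStep_splitClosure]
  exact Or.inr (Or.inl ⟨x, hx, h⟩)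

theorem splitClosure_isModule {u v : V} : G.IsModule {x | G.splitClosure E u v x} := by
  rw [isModule_iff]
  intro w hw x hx y hy hwx
  by_contra hwy
  refine hw ?_
  change G.splitClosure E u v w
  rw [← splitStep_splitClosure]
  exact Or.inr (Or.inr ⟨x, y, ⟨hx, hy⟩, hwx, hwy⟩)

theorem splitClosure_subset {Y : Set V} (hY : G.IsModule Y) (hsat : ∀ x ∈ Y, ∀ y, E y x → y ∈ Y)
    (hsymm : ∀ x y, E x y → E y x) {u v : V} (hu : u ∈ Y) (hv : v ∈ Y) {x : V}
    (hx : G.splitClosure E u v x) : x ∈ Y := by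
  suffices H : ∀ x, G.splitClosure E u v x → x ∈ Y from H x hx
  unfold splitClosure
  refine iterate_induction (p := fun X : V → Prop => ∀ x, X x → x ∈ Y) ?_ ?_ _
  · rintro X hX x (h | ⟨z, hz, hzx⟩ | ⟨z, w, ⟨hz, hw⟩, h1, h2⟩)
    · exact hX x h
    · exact hsat z (hX z hz) x (hsymm _ _ hzx)
    · by_contra hxY
      exact h2 (hY.adj_of_adj hxY (hX z hz) (hX w hw) h1)
  · rintro x (h | h)
    · exact hsat u hu x h
    · exact hsat v hv x h

theorem forced_closed {T : V → Prop} {a x y z : V} (hx : T x) (hy : T y) (hxy : ¬ G.Adj x y)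
    (h : (G.forced T a z y ∧ G.Adj z x) ∨ (G.forced T a x z ∧ G.Adj z y)) : G.forced T a x y := by
  have : G.forceStep T (G.forced T a) = G.forced T a := iterate_rel_isFixedPt _ (forceStep_le T) _
  rw [← this]
  refine Or.inr ⟨⟨hx, hy⟩, z, ?_⟩
  tauto

theorem forced_init {T : V → Prop} {a y : V} (ha : T a) (hy : T y) (hne : a ≠ y)
    (h : ¬ G.Adj a y) : G.forced T a a y := by
  unfold forced
  exact iterate_induction (p := fun R : V → V → Prop => R a y) (fun R hR => forceStep_le T R _ _ hR)
    ⟨⟨ha, hy⟩, rfl, hne, h⟩ _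

theorem forced_imp {T : V → Prop} {a x y : V} (h : G.forced T a x y) :
    (T x ∧ T y) ∧ x ≠ y ∧ ¬ G.Adj x y := by
  suffices H : ∀ x y, G.forced T a x y → (T x ∧ T y) ∧ x ≠ y ∧ ¬ G.Adj x y from H x y h
  unfold forced
  refine iterate_induction (p := fun R : V → V → Prop => ∀ x y, R x y →
    (T x ∧ T y) ∧ x ≠ y ∧ ¬ G.Adj x y) ?_ ?_ _
  · rintro R hR x y (h | ⟨hT, z, ⟨h1, h2, h3⟩ | ⟨h1, h2, h3⟩⟩)
    · exact hR x y h
    · refine ⟨hT, ?_, h3⟩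
      rintro rfl
      exact (hR _ _ h1).2.2 h2
    · refine ⟨hT, ?_, h3⟩
      rintro rfl
      exact (hR _ _ h1).2.2 h2.symm
  · rintro x y ⟨h1, -, h2, h3⟩
    exact ⟨h1, h2, h3⟩

/-- Forced pairs are ordered correctly by every interval order in which `a` is leftmost. -/
theorem forced_le {T : V → Prop} {Y : Set V} {R : V → V → Prop} (hR : G.IntervalOrderOn Y R)
    (hT : ∀ x, T x → x ∈ Y) {a : V} (ha : ∀ y, T y → a ≠ y → ¬ G.Adj a y → R a y) {x y : V}
    (h : G.forced T a x y) : R x y := by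
  obtain ⟨h1, h2, h3⟩ := hR
  suffices H : ∀ x y, G.forced T a x y → (T x ∧ T y) ∧ R x y from (H x y h).2
  unfold forced
  refine iterate_induction (p := fun F : V → V → Prop => ∀ x y, F x y → (T x ∧ T y) ∧ R x y) ?_ ?_ _
  · rintro F hF x y (h | ⟨⟨hx, hy⟩, z, ⟨k1, k2, k3⟩ | ⟨k1, k2, k3⟩⟩)
    · exact hF x y h
    · obtain ⟨⟨hz, -⟩, hzy⟩ := hF _ _ k1
      have hzx := (h3 z (hT z hz) x (hT x hx) k2.ne).1 k2
      refine ⟨⟨hx, hy⟩, ?_⟩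
      by_cases hxy : x = y
      · exact absurd (hxy ▸ hzy) hzx.1
      by_contra hcon
      have hyx : R y x := by
        by_contra hyx
        exact k3 ((h3 x (hT x hx) y (hT y hy) hxy).2 ⟨hcon, hyx⟩)
      rcases h2 z (hT z hz) y (hT y hy) y (hT y hy) x (hT x hx) hzy hyx with h | h
      · exact hzx.1 h
      · exact h1 y (hT y hy) h
    · obtain ⟨⟨-, hz⟩, hxz⟩ := hF _ _ k1
      have hzy := (h3 z (hT z hz) y (hT y hy) k2.ne).1 k2
      refine ⟨⟨hx, hy⟩, ?_⟩
      by_cases hxy : x = y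
      · exact absurd (hxy ▸ hxz) hzy.2
      by_contra hcon
      have hyx : R y x := by
        by_contra hyx
        exact k3 ((h3 x (hT x hx) y (hT y hy) hxy).2 ⟨hcon, hyx⟩)
      rcases h2 y (hT y hy) x (hT x hx) x (hT x hx) z (hT z hz) hyx hxz with h | h
      · exact hzy.2 h
      · exact h1 x (hT x hx) h
  · rintro x y ⟨⟨hx, hy⟩, rfl, hne, hadj⟩
    exact ⟨⟨hx, hy⟩, ha y hy hne hadj⟩

variable [LinearOrder V]

theorem exists_first (hE : Equivalence E) (v : V) : ∃ x, E x v ∧ ∀ z, E z v → x ≤ z := by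
  classical
  obtain ⟨x, hx, hmin⟩ := (Finset.univ.filter fun z => E z v).exists_min_image id
    ⟨v, by simp [hE.refl v]⟩
  simp only [Finset.mem_filter, Finset.mem_univ, true_and, id] at hx hmin
  exact ⟨x, hx, hmin⟩

/-- Merging keeps all classes interval modules: in a set that has passed the test, the forced pairs
form an interval order on the classes, so that `isIntervalOn_of_quotient` applies. -/
theorem IsIntervalModularRel.mergeStep (h : G.IsIntervalModularRel E) (u v : V) :
    G.IsIntervalModularRel (G.mergeStep E u v) := by
  obtain ⟨hE, hc⟩ := h
  by_cases hpass : (∃ a, firstIn E (G.splitClosure E u v) a ∧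
    G.Decides (firstIn E (G.splitClosure E u v)) (G.forced (firstIn E (G.splitClosure E u v)) a)) ∧
      G.HasNoC4 (G.splitClosure E u v)
  swap
  · have : G.mergeStep E u v = E := by
      funext x y
      simp only [SimpleGraph.mergeStep, hpass, false_and, or_false]
    rw [this]
    exact ⟨hE, hc⟩
  have hstep : ∀ x y, G.mergeStep E u v x y ↔
      E x y ∨ (G.splitClosure E u v x ∧ G.splitClosure E u v y) := by
    intro x y
    simp only [SimpleGraph.mergeStep, hpass, true_and]
  obtain ⟨⟨a, ha, hdec, hfer⟩, hC4⟩ := hpass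
  set X := G.splitClosure E u v with hX
  have hsat : ∀ {x y}, X x → E x y → X y := fun hx h => splitClosure_saturated hx h
  have hX : G.IsIntervalModule {x | X x} := by
    refine ⟨splitClosure_isModule, ?_⟩
    choose q hq hqmin using exists_first hE
    have hqT : ∀ x, X x → firstIn E X (q x) := fun x hx =>
      firstIn_of_forall_le hE (hsat hx (hE.symm (hq x))) (hq x) (hqmin x)
    have hqE : ∀ {x y}, q x = q y → E x y := fun {x y} h =>
      hE.trans (hE.symm (hq x)) (h ▸ hq y)
    refine isIntervalOn_of_quotient q (G.forced (firstIn E X) a) ?_ ?_ ?_ ?_ ?_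
    · exact fun x _ h => (forced_imp h).2.1 rfl
    · intro x _ y _ z _ w _ hxy hzw
      by_contra hcon
      exact hfer ⟨_, _, _, _, ⟨hxy, hzw⟩, not_or.1 hcon⟩
    · intro x hx y hy hxy
      have hne : ¬ E x y := fun h => hxy (firstIn_unique hE (hqT x hx) (hqT y hy)
        (hE.trans (hq x) (hE.trans h (hE.symm (hq y)))))
      have hadj : G.Adj x y ↔ G.Adj (q x) (q y) := by
        have e1 := hE.apply_eq_iff.2 (hq x)
        have e2 := hE.apply_eq_iff.2 (hq y)
        have e3 : E x ≠ E y := fun h => hne (hE.apply_eq_iff.1 h)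
        exact ⟨hc.adj_congr e1.symm e2.symm e3, hc.adj_congr e1 e2 (by rwa [e1, e2])⟩
      rw [hadj]
      constructor
      · exact fun h => ⟨fun h' => (forced_imp h').2.2 h, fun h' => (forced_imp h').2.2 h.symm⟩
      · rintro ⟨h1, h2⟩
        by_contra hna
        exact hdec ⟨_, _, ⟨hqT x hx, hqT y hy⟩, ⟨hxy, hna⟩, h1, h2⟩
    · intro i
      by_cases hi : ∃ x, q x = i
      · obtain ⟨x, rfl⟩ := hi
        refine (hc (E x)).2.mono ?_
        rintro y ⟨-, hy⟩
        exact hE.apply_eq_iff.2 (hqE hy)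
      · exact ⟨fun _ _ => False, fun _ _ => id, fun _ _ _ _ _ _ _ _ h => h.elim,
          fun x hx => absurd ⟨x, hx.2⟩ hi⟩
    · intro x hx y hy z hz w hw h1 h2 h3 h4 h5 h6
      by_contra hcon
      exact hC4 ⟨x, y, z, w, ⟨⟨hx, hy⟩, hz, hw⟩, ⟨⟨h1, h2⟩, h3, h4⟩, ⟨h5, h6⟩, not_or.1 hcon⟩
  have hE' : Equivalence (G.mergeStep E u v) := by
    refine ⟨fun x => (hstep _ _).2 (Or.inl (hE.refl x)), fun {x y} h => ?_, fun {x y z} h h' => ?_⟩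
    · rw [hstep] at h ⊢
      exact h.imp hE.symm And.symm
    · rw [hstep] at h h' ⊢
      rcases h with h | h <;> rcases h' with h' | h'
      · exact Or.inl (hE.trans h h')
      · exact Or.inr ⟨hsat h'.1 (hE.symm h), h'.2⟩
      · exact Or.inr ⟨h.1, hsat h.2 h'⟩
      · exact Or.inr ⟨h.1, h'.2⟩
  refine ⟨hE', fun i => ?_⟩
  by_cases hi : ∃ x, G.mergeStep E u v x = i
  · obtain ⟨x, rfl⟩ := hi
    have e1 : {y | G.mergeStep E u v y = G.mergeStep E u v x} = {y | G.mergeStep E u v y x} := by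
      ext y
      exact hE'.apply_eq_iff
    rw [e1]
    by_cases hx : X x
    · convert hX using 1
      ext y
      simp only [Set.mem_ofPred_eq, hstep]
      exact ⟨fun h => h.elim (fun h => hsat hx (hE.symm h)) And.left, fun h => Or.inr ⟨h, hx⟩⟩
    · convert hc (E x) using 1
      ext y
      simp only [Set.mem_ofPred_eq, hstep, hx, and_false, or_false]
      exact hE.apply_eq_iff.symm
  · exact ⟨isModule_iff.2 fun _ _ x hx => absurd ⟨x, hx⟩ hi, fun _ _ => False, fun _ _ => id,
      fun _ _ _ _ _ _ _ _ h => h.elim, fun x hx => absurd ⟨x, hx⟩ hi⟩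

/-- If no merging step has an effect, the partition is unmergeable.  Take a smallest interval
module `Y` that is a union of at least two classes, and a leftmost vertex `a` among the first
elements of its classes.  Pairs of nonadjacent classes that are not forced form a graph on the
classes; the union of the classes of a connected component is a module that avoids `a`, so by
minimality there are no such pairs. -/
theorem IsIntervalModularRel.isUnmergeable (h : G.IsIntervalModularRel E)
    (hstab : ∀ u v, G.mergeStep E u v = E) : G.IsUnmergeable E := by
  classical
  obtain ⟨hE, hc⟩ := h
  by_contra hcon
  simp only [IsUnmergeable, not_forall, hE.apply_eq_iff, exists_prop] at hcon
  -- a smallest counterexample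
  let Bad : Set V → Prop := fun Y => G.IsIntervalModule Y ∧ (∀ x ∈ Y, ∀ y, E y x → y ∈ Y) ∧
    ∃ x ∈ Y, ∃ y ∈ Y, ¬ E x y
  obtain ⟨Y, hY, hmin⟩ := (measure (fun Y : Set V => Y.ncard)).wf.has_min {Y | Bad Y} (by
    obtain ⟨Y, h1, h2, x, hx, y, hy, hxy⟩ := hcon
    exact ⟨Y, h1, h2, x, hx, y, hy, hxy⟩)
  obtain ⟨hYm, hYs, u, hu, v, hv, huv⟩ := hY
  have hsmall : ∀ Y', Bad Y' → Y' ⊆ Y → Y' = Y := by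
    intro Y' hY' hsub
    by_contra hne
    exact hmin Y' hY' (Set.ncard_lt_ncard (hsub.ssubset_of_ne hne) (Set.toFinite _))
  set X := G.splitClosure E u v with hXdef
  have hXY : {x | X x} = Y := by
    have hsub : {x | X x} ⊆ Y := fun x hx =>
      splitClosure_subset hYm.1 hYs (fun _ _ => hE.symm) hu hv hx
    refine hsmall _ ⟨⟨splitClosure_isModule, hYm.2.mono hsub⟩, fun x hx y hy => ?_, u, ?_, v, ?_,
      huv⟩ hsub
    · exact splitClosure_saturated hx (hE.symm hy)
    · exact splitClosure_left hE u v
    · exact splitClosure_right hE u v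
  have hXY' : ∀ x, X x ↔ x ∈ Y := fun x => by
    rw [← hXY]
    rfl
  set T := firstIn E X with hT
  have hTY : ∀ x, T x → x ∈ Y := fun x hx => (hXY' x).1 hx.1
  obtain ⟨R, hR⟩ := hYm.2
  obtain ⟨h1, h2, h3⟩ := id hR
  obtain ⟨l, r, hlr⟩ := hR.exists_endpoints
  choose q hq hqmin using exists_first hE
  have hqT : ∀ x ∈ Y, T (q x) := fun x hx =>
    firstIn_of_forall_le hE ((hXY' _).2 (hYs x hx _ (hq x))) (hq x) (hqmin x)
  have hqE : ∀ {x y}, q x = q y ↔ E x y := by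
    intro x y
    refine ⟨fun h => hE.trans (hE.symm (hq x)) (h ▸ hq y), fun h => le_antisymm ?_ ?_⟩
    · exact hqmin x _ (hE.trans (hq y) (hE.symm h))
    · exact hqmin y _ (hE.trans (hq x) h)
  have hqq : ∀ t, T t → q t = t := fun t ht =>
    firstIn_unique hE (hqT t (hTY t ht)) ht (hq t)
  obtain ⟨a, ha, hamin⟩ := Set.exists_min_image {t | T t} r (Set.toFinite _) ⟨q u, hqT u hu⟩
  have haR : ∀ y, T y → a ≠ y → ¬ G.Adj a y → R a y := by
    intro y hy hne hadj
    by_contra hcon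
    have hya : R y a := by
      by_contra hya
      exact hadj ((h3 a (hTY a ha) y (hTY y hy) hne).2 ⟨hcon, hya⟩)
    rw [hlr _ (hTY y hy) _ (hTY a ha)] at hya
    have haa := h1 a (hTY a ha)
    rw [hlr _ (hTY a ha) _ (hTY a ha)] at haa
    have := hamin y hy
    linarith
  have hle : ∀ {x y}, G.forced T a x y → R x y := fun h => forced_le hR hTY haR h
  have hdec : ¬ ∃ x y, (T x ∧ T y) ∧ (x ≠ y ∧ ¬ G.Adj x y) ∧ ¬ G.forced T a x y ∧
      ¬ G.forced T a y x := by
    rintro ⟨s, t, ⟨hs, ht⟩, ⟨hst, nst⟩, fst, fts⟩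
    -- nonadjacent pairs that are not forced in either direction
    let U : V → V → Prop := fun x y => (T x ∧ T y) ∧ (x ≠ y ∧ ¬ G.Adj x y) ∧
      ¬ G.forced T a x y ∧ ¬ G.forced T a y x
    have hUs : Std.Symm U := ⟨fun x y ⟨hT, ⟨k1, k2⟩, k3, k4⟩ =>
      ⟨hT.symm, ⟨k1.symm, fun h => k2 h.symm⟩, k4, k3⟩⟩
    have hst' : U s t := ⟨⟨hs, ht⟩, ⟨hst, nst⟩, fst, fts⟩
    let C : V → Prop := Relation.ReflTransGen U s
    have hCT : ∀ c, C c → T c := by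
      intro c hc
      induction hc with
      | refl => exact hs
      | tail _ h _ => exact h.1.2
    have hadj : ∀ z, T z → ¬ C z → ∀ c c', C c → Relation.ReflTransGen U c c' → G.Adj z c →
        G.Adj z c' := by
      intro z hz hzC c c' hc hcc' hzc
      induction hcc' with
      | refl => exact hzc
      | @tail b d hcb hbd ih =>
        by_contra hzd
        have hCb : C b := Relation.ReflTransGen.trans hc hcb
        have hCd : C d := hCb.tail hbd
        obtain ⟨⟨hbT, hdT⟩, ⟨-, nbd⟩, fbd, fdb⟩ := hbd
        refine hzC (hCd.tail ⟨⟨hdT, hz⟩, ⟨?_, fun h => hzd h.symm⟩, fun h => ?_, fun h => ?_⟩)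
        · rintro rfl
          exact hzC hCd
        · exact fdb (forced_closed hdT hbT (fun h => nbd h.symm) (Or.inr ⟨h, ih⟩))
        · exact fbd (forced_closed hbT hdT nbd (Or.inl ⟨h, ih⟩))
    have haC : ¬ C a := by
      intro haC
      rcases Relation.ReflTransGen.cases_tail haC with h | ⟨b, -, hb⟩
      · subst h
        exact fst (forced_init hs ht hst nst)
      · exact hb.2.2.2 (forced_init ha hb.1.1 hb.2.1.1.symm fun h => hb.2.1.2 h.symm)
    have hbad : Bad {x | x ∈ Y ∧ C (q x)} := by
      refine ⟨⟨?_, hYm.2.mono fun x hx => hx.1⟩, ?_, s, ⟨hTY s hs, ?_⟩, t, ⟨hTY t ht, ?_⟩, ?_⟩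
      · rw [isModule_iff]
        rintro w hw x ⟨hx, hxC⟩ y ⟨hy, hyC⟩ hwx
        by_cases hwY : w ∈ Y
        · have hwC : ¬ C (q w) := fun h => hw ⟨hwY, h⟩
          have hne : ∀ x, C (q x) → E w ≠ E x := by
            intro x hxC h
            rw [hqE.2 (hE.apply_eq_iff.1 h)] at hwC
            exact hwC hxC
          have e1 := fun x => hE.apply_eq_iff.2 (hq x)
          have k1 := hc.adj_congr (e1 w).symm (e1 x).symm (hne x hxC) hwx
          have k2 := hadj (q w) (hqT w hwY) hwC (q x) (q y) hxC
            (Relation.ReflTransGen.trans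
              ((Relation.ReflTransGen.stdSymm (r := U)).symm _ _ hxC) hyC) k1
          refine hc.adj_congr (e1 w) (e1 y) ?_ k2
          rw [e1, e1]
          exact hne y hyC
        · exact hYm.1.adj_of_adj hwY hx hy hwx
      · rintro x ⟨hx, hxC⟩ y hyx
        refine ⟨hYs x hx y hyx, ?_⟩
        rwa [hqE.2 hyx]
      · rw [hqq s hs]
      · rw [hqq t ht]
        exact Relation.ReflTransGen.single hst'
      · intro h
        exact hst (firstIn_unique hE hs ht h)
    have := hsmall _ hbad fun x hx => hx.1
    have haY := hTY a ha
    rw [← this] at haY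
    exact haC (hqq a ha ▸ haY.2)
  have hpass : G.mergeStep E u v u v := by
    refine Or.inr ⟨⟨⟨a, ha, hdec, ?_⟩, ?_⟩, splitClosure_left hE u v, splitClosure_right hE u v⟩
    · rintro ⟨x, y, z, w, ⟨hxy, hzw⟩, nxw, nzy⟩
      have hxT := (forced_imp hxy).1
      have hzT := (forced_imp hzw).1
      have key : ∀ p s, T p → T s → R p s → G.forced T a p s := by
        intro p s hp hs hps
        have hne : p ≠ s := by
          rintro rfl
          exact h1 p (hTY p hp) hps
        by_contra hf
        refine hdec ⟨p, s, ⟨hp, hs⟩, ⟨hne, fun h => ?_⟩, hf, fun h => ?_⟩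
        · exact ((h3 p (hTY p hp) s (hTY s hs) hne).1 h).1 hps
        · rcases h2 p (hTY p hp) s (hTY s hs) s (hTY s hs) p (hTY p hp) hps (hle h) with h | h
          · exact h1 p (hTY p hp) h
          · exact h1 s (hTY s hs) h
      rcases h2 x (hTY x hxT.1) y (hTY y hxT.2) z (hTY z hzT.1) w (hTY w hzT.2) (hle hxy)
        (hle hzw) with h | h
      · exact nxw (key x w hxT.1 hzT.2 h)
      · exact nzy (key z y hzT.1 hxT.2 h)
    · rintro ⟨x, y, z, w, ⟨⟨hx, hy⟩, hz, hw⟩, ⟨⟨k1, k2⟩, k3, k4⟩, ⟨k5, k6⟩, k7, k8⟩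
      rcases hYm.2.noC4On x ((hXY' x).1 hx) y ((hXY' y).1 hy) z ((hXY' z).1 hz) w ((hXY' w).1 hw)
        k1 k2 k3 k4 k5 k6 with h | h
      · exact k7 h
      · exact k8 h
  rw [hstab] at hpass
  exact huv hpass

end Algorithm

/-! ### The final partition and its representatives -/

section Representatives

variable {n : ℕ} (G : SimpleGraph (Fin n))

/-- Try to merge for all pairs of vertices in turn. -/
def mergePass (E : Fin n → Fin n → Prop) : Fin n → Fin n → Prop :=
  (List.finRange n).foldl
    (fun E u => (List.finRange n).foldl (fun E v => G.mergeStep E u v) E) E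

/-- The partition into single vertices, merged as often as possible. -/
def finalRel : Fin n → Fin n → Prop := G.mergePass^[n * n] fun x y => x = y

variable {G}

theorem mergeStep_le {V : Type*} [Fintype V] [LinearOrder V] {G : SimpleGraph V}
    (E : V → V → Prop) (u v : V) : E ≤ G.mergeStep E u v := fun _ _ h => Or.inl h

theorem IsIntervalModularRel.mergePass {E : Fin n → Fin n → Prop} (h : G.IsIntervalModularRel E) :
    G.IsIntervalModularRel (G.mergePass E) := by
  have key : ∀ (L : List (Fin n)) (f : (Fin n → Fin n → Prop) → Fin n → Fin n → Fin n → Prop),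
      (∀ E x, G.IsIntervalModularRel E → G.IsIntervalModularRel (f E x)) →
      ∀ E, G.IsIntervalModularRel E → G.IsIntervalModularRel (L.foldl f E) := by
    intro L f hf
    induction L with
    | nil => exact fun E h => h
    | cons a L ih => exact fun E h => ih _ (hf E a h)
  exact key _ _ (fun E u hE => key _ _ (fun E v hE => hE.mergeStep u v) E hE) E h

theorem isIntervalModularRel_finalRel : G.IsIntervalModularRel G.finalRel := by
  refine iterate_induction (p := G.IsIntervalModularRel) (fun E hE => hE.mergePass) ⟨⟨fun _ => rfl,
    Eq.symm, Eq.trans⟩, fun i => ?_⟩ _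
  by_cases hi : ∃ v, (fun y => v = y) = i
  · obtain ⟨v, rfl⟩ := hi
    exact isIntervalModule_of_forall_eq (v := v) fun x hx => (congrFun hx v).mpr rfl
  · exact ⟨isModule_iff.2 fun _ _ x hx => absurd ⟨x, hx⟩ hi, fun _ _ => False, fun _ _ => id,
      fun _ _ _ _ _ _ _ _ h => h.elim, fun x hx => absurd ⟨x, hx⟩ hi⟩

theorem isUnmergeable_finalRel : G.IsUnmergeable G.finalRel := by
  have hinner : ∀ (E : Fin n → Fin n → Prop) (u : Fin n),
      E ≤ (List.finRange n).foldl (fun E v => G.mergeStep E u v) E := fun E u =>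
    (List.eq_of_foldl_eq _ (fun E v => mergeStep_le E u v) _ E).1
  have hfix : G.mergePass G.finalRel = G.finalRel := by
    have := iterate_rel_isFixedPt G.mergePass
      (fun E => (List.eq_of_foldl_eq _ hinner _ E).1) (fun x y => x = y)
    rwa [Fintype.card_fin] at this
  refine isIntervalModularRel_finalRel.isUnmergeable fun u v => ?_
  have h1 := (List.eq_of_foldl_eq _ hinner _ G.finalRel).2 hfix u (List.mem_finRange u)
  exact (List.eq_of_foldl_eq _ (fun E v => mergeStep_le E u v) _ G.finalRel).2 h1 v
    (List.mem_finRange v)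

/-- The vertex `x` has a non-neighbour in its class. -/
def HasNonNeighbor (G : SimpleGraph (Fin n)) (E : Fin n → Fin n → Prop) (x : Fin n) : Prop :=
  ∃ y, E y x ∧ y ≠ x ∧ ¬ G.Adj x y

/-- The first representative of a class: its first element with a non-neighbour in the class, or
its first element if the class is complete. -/
def IsFirstRep (G : SimpleGraph (Fin n)) (E : Fin n → Fin n → Prop) (x : Fin n) : Prop :=
  (G.HasNonNeighbor E x ∧ ¬ ∃ y, (E y x ∧ G.HasNonNeighbor E y) ∧ ¬ x ≤ y) ∨
    (¬ ∃ y, E y x ∧ G.HasNonNeighbor E y) ∧ ¬ ∃ y, E y x ∧ ¬ x ≤ y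

/-- The representatives: the first one, and its first non-neighbour in the class. -/
def IsRep (G : SimpleGraph (Fin n)) (E : Fin n → Fin n → Prop) (x : Fin n) : Prop :=
  G.IsFirstRep E x ∨ ∃ p, (G.IsFirstRep E p ∧ E p x) ∧ (p ≠ x ∧ ¬ G.Adj p x) ∧
    ¬ ∃ y, (E p y ∧ p ≠ y ∧ ¬ G.Adj p y) ∧ ¬ x ≤ y

theorem IsFirstRep.unique {E : Fin n → Fin n → Prop} (hE : Equivalence E) {x y : Fin n}
    (hx : G.IsFirstRep E x) (hy : G.IsFirstRep E y) (hxy : E x y) : x = y := by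
  rcases hx with ⟨hx, hx'⟩ | ⟨hx, hx'⟩ <;> rcases hy with ⟨hy, hy'⟩ | ⟨hy, hy'⟩
  · exact le_antisymm (by_contra fun h => hx' ⟨y, ⟨hE.symm hxy, hy⟩, h⟩)
      (by_contra fun h => hy' ⟨x, ⟨hxy, hx⟩, h⟩)
  · exact absurd ⟨x, hxy, hx⟩ hy
  · exact absurd ⟨y, hE.symm hxy, hy⟩ hx
  · exact le_antisymm (by_contra fun h => hx' ⟨y, hE.symm hxy, h⟩)
      (by_contra fun h => hy' ⟨x, hxy, h⟩)

theorem exists_isFirstRep {E : Fin n → Fin n → Prop} (hE : Equivalence E) (v : Fin n) :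
    ∃ x, G.IsFirstRep E x ∧ E x v := by
  classical
  by_cases h : ∃ y, E y v ∧ G.HasNonNeighbor E y
  · obtain ⟨y, hy, hy'⟩ := h
    obtain ⟨x, hx, hmin⟩ := (Finset.univ.filter fun z =>
      E z v ∧ G.HasNonNeighbor E z).exists_min_image id ⟨y, by simp [hy, hy']⟩
    simp only [Finset.mem_filter, Finset.mem_univ, true_and, id] at hx hmin
    refine ⟨x, Or.inl ⟨hx.2, ?_⟩, hx.1⟩
    rintro ⟨z, ⟨hz, hz'⟩, hxz⟩
    exact hxz (hmin z ⟨hE.trans hz hx.1, hz'⟩)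
  · obtain ⟨x, hx, hmin⟩ := exists_first hE v
    refine ⟨x, Or.inr ⟨?_, ?_⟩, hx⟩
    · rintro ⟨y, hy, hy'⟩
      exact h ⟨y, hE.trans hy hx, hy'⟩
    · rintro ⟨y, hy, hxy⟩
      exact hxy (hmin y (hE.trans hy hx))

/-- The representatives of a class are one vertex of a complete class, and two nonadjacent vertices
of any other class. -/
theorem isContraction_of_range {E : Fin n → Fin n → Prop} (hE : Equivalence E) {W : Type*}
    {H : SimpleGraph W} (f : H ↪g G) (hf : ∀ x, G.IsRep E x ↔ ∃ w, f w = x) :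
    IsContraction E f := by
  classical
  have hmem : ∀ w, G.IsRep E (f w) := fun w => (hf _).2 ⟨w, rfl⟩
  have hrep : ∀ w, ∃ p, G.IsFirstRep E p ∧ E p (f w) ∧ (f w = p ∨ (p ≠ f w ∧ ¬ G.Adj p (f w) ∧
      ∀ y, E p y → p ≠ y → ¬ G.Adj p y → f w ≤ y)) := by
    intro w
    rcases hmem w with h | ⟨p, ⟨h1, h2⟩, ⟨h3, h4⟩, h5⟩
    · exact ⟨f w, h, hE.refl _, Or.inl rfl⟩
    · exact ⟨p, h1, h2, Or.inr ⟨h3, h4, fun y k1 k2 k3 =>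
        by_contra fun h => h5 ⟨y, ⟨k1, k2, k3⟩, h⟩⟩⟩
  have hcommon : ∀ s t p, G.IsFirstRep E p → E p (f s) → E (f s) (f t) →
      (f t = p ∨ (p ≠ f t ∧ ¬ G.Adj p (f t) ∧ ∀ y, E p y → p ≠ y → ¬ G.Adj p y → f t ≤ y)) := by
    intro s t p hp hps hst
    obtain ⟨p', hp', hpt, h⟩ := hrep t
    obtain rfl := hp.unique hE hp' (hE.trans (hE.trans hps hst) (hE.symm hpt))
    exact h
  -- representatives other than the first one coincide, both being its first non-neighbour
  have huniq : ∀ s t p, G.IsFirstRep E p → E p (f s) → E (f s) (f t) → f s ≠ p → f t ≠ p →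
      f s = f t := by
    intro s t p hp hps hst hs ht
    obtain ⟨h1, h2, h3⟩ := (hcommon s s p hp hps (hE.refl _)).resolve_left hs
    obtain ⟨k1, k2, k3⟩ := (hcommon s t p hp hps hst).resolve_left ht
    exact le_antisymm (h3 _ (hE.trans hps hst) k1 k2) (k3 _ hps h1 h2)
  refine ⟨fun v => ?_, fun s t hst hadj => ?_, fun v w e hvw hadj => ?_, fun s t u hst hsu => ?_⟩
  · obtain ⟨x, hx, hxv⟩ := exists_isFirstRep (G := G) hE v
    obtain ⟨w, rfl⟩ := (hf x).1 (Or.inl hx)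
    exact ⟨w, hE.apply_eq_iff.2 hxv⟩
  · rw [hE.apply_eq_iff] at hst
    rw [← f.map_adj_iff] at hadj
    obtain ⟨p, hp, hps, h⟩ := hrep s
    by_cases hs : f s = p
    · rcases hcommon s t p hp hps hst with h' | ⟨-, h', -⟩
      · exact hadj.ne (hs.trans h'.symm)
      · exact h' (hs ▸ hadj)
    · by_cases ht : f t = p
      · exact (h.resolve_left hs).2.1 (ht ▸ hadj.symm)
      · exact hadj.ne (huniq s t p hp hps hst hs ht)
  · rw [hE.apply_eq_iff] at e
    obtain ⟨p, hp, hpv⟩ := exists_isFirstRep (G := G) hE v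
    have hbad : G.HasNonNeighbor E p := by
      rcases hp with hp | hp
      · exact hp.1
      · exact absurd ⟨v, hE.symm hpv, w, hE.symm e, hvw.symm, hadj⟩ hp.1
    obtain ⟨y, hy, hyp, hpy⟩ := hbad
    obtain ⟨x, hx, hmin⟩ := (Finset.univ.filter fun z =>
      E z p ∧ z ≠ p ∧ ¬ G.Adj p z).exists_min_image id ⟨y, by simp [hy, hyp, hpy]⟩
    simp only [Finset.mem_filter, Finset.mem_univ, true_and, id] at hx hmin
    obtain ⟨s, hs⟩ := (hf p).1 (Or.inl hp)
    obtain ⟨t, ht⟩ := (hf x).1 (Or.inr ⟨p, ⟨hp, hE.symm hx.1⟩, ⟨hx.2.1.symm, hx.2.2⟩, by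
      rintro ⟨z, ⟨k1, k2, k3⟩, k4⟩
      exact k4 (hmin z ⟨hE.symm k1, k2.symm, k3⟩)⟩)
    refine ⟨s, t, ?_, ?_, ?_⟩
    · rw [hs, hE.apply_eq_iff]
      exact hpv
    · rw [ht, hE.apply_eq_iff]
      exact hE.trans hx.1 hpv
    · rintro rfl
      exact hx.2.1 (ht.symm.trans hs)
  · rw [hE.apply_eq_iff] at hst hsu
    obtain ⟨p, hp, hps, -⟩ := hrep s
    have hpt := hE.trans hps hst
    have htu := hE.trans (hE.symm hst) hsu
    by_cases hs : f s = p
    · by_cases ht : f t = p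
      · exact Or.inl (f.injective (hs.trans ht.symm))
      · by_cases hu : f u = p
        · exact Or.inr (Or.inl (f.injective (hs.trans hu.symm)))
        · exact Or.inr (Or.inr (f.injective (huniq t u p hp hpt htu ht hu)))
    · by_cases ht : f t = p
      · by_cases hu : f u = p
        · exact Or.inr (Or.inr (f.injective (ht.trans hu.symm)))
        · exact Or.inr (Or.inl (f.injective (huniq s u p hp hps hsu hs hu)))
      · exact Or.inl (f.injective (huniq s t p hp hps hst hs ht))

end Representatives

end SimpleGraph

/-! ### Verified execution of random access machine programs -/

namespace RamState

/-- Overwrite one register. -/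
def setReg (s : RamState) (x a : ℕ) : RamState :=
  { s with reg := Function.update s.reg x a }

/-- Overwrite one array entry. -/
def setArr (s : RamState) (a i b : ℕ) : RamState :=
  { s with arr := Function.update s.arr a (Function.update (s.arr a) i b) }

variable (s : RamState) (x y a b i : ℕ)

@[simp] theorem arr_setReg : (s.setReg x a).arr = s.arr := rfl

@[simp] theorem reg_setArr : (s.setArr a i b).reg = s.reg := rfl

@[simp] theorem reg_setReg_self : (s.setReg x a).reg x = a := by simp [setReg]

theorem reg_setReg_of_ne {s : RamState} {x y a : ℕ} (h : y ≠ x) :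
    (s.setReg x a).reg y = s.reg y := by
  simp [setReg, h]

theorem arr_setArr_self : (s.setArr a i b).arr a i = b := by simp [setArr]

theorem arr_setArr_of_ne {s : RamState} {a i b a' i' : ℕ} (h : a' ≠ a ∨ i' ≠ i) :
    (s.setArr a i b).arr a' i' = s.arr a' i' := by
  by_cases ha : a' = a
  · subst ha
    simp [setArr, h.resolve_left (fun h => h rfl)]
  · simp [setArr, ha]

end RamState

/-- Started in `s`, the program `p` halts within `T` steps in a state that satisfies `Q`. -/
def Runs (p : RamProg) (s : RamState) (T : ℕ) (Q : RamState → Prop) : Prop :=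
  ∃ (τ : ℕ) (s' : RamState), τ ≤ T ∧ RamExec p s τ s' ∧ Q s'

namespace Runs

variable {p q : RamProg} {s : RamState} {T T₁ T₂ : ℕ} {Q Q' : RamState → Prop}

theorem mono (h : Runs p s T Q) (hT : T ≤ T₁) (hQ : ∀ s, Q s → Q' s) : Runs p s T₁ Q' := by
  obtain ⟨τ, s', h1, h2, h3⟩ := h
  exact ⟨τ, s', h1.trans hT, h2, hQ _ h3⟩

theorem skip (h : Q s) : Runs .skip s 1 Q := ⟨1, s, le_rfl, .skip s, h⟩

theorem const {x c : ℕ} (h : Q (s.setReg x c)) : Runs (.const x c) s 1 Q :=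
  ⟨1, _, le_rfl, .const x c s, h⟩

theorem add {x y z : ℕ} (h : Q (s.setReg x (s.reg y + s.reg z))) : Runs (.add x y z) s 1 Q :=
  ⟨1, _, le_rfl, .add x y z s, h⟩

theorem sub {x y z : ℕ} (h : Q (s.setReg x (s.reg y - s.reg z))) : Runs (.sub x y z) s 1 Q :=
  ⟨1, _, le_rfl, .sub x y z s, h⟩

theorem read {x a y : ℕ} (h : Q (s.setReg x (s.arr a (s.reg y)))) : Runs (.read x a y) s 1 Q :=
  ⟨1, _, le_rfl, .read x a y s, h⟩

theorem write {a x y : ℕ} (h : Q (s.setArr a (s.reg x) (s.reg y))) : Runs (.write a x y) s 1 Q :=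
  ⟨1, _, le_rfl, .write a x y s, h⟩

theorem seq (h : Runs p s T₁ fun s' => Runs q s' T₂ Q) : Runs (.seq p q) s (T₁ + T₂) Q := by
  obtain ⟨τ, s', h1, h2, τ', s'', h3, h4, h5⟩ := h
  exact ⟨τ + τ', s'', add_le_add h1 h3, .seq p q s s' s'' τ τ' h2 h4, h5⟩

theorem cond {x : ℕ} (h : s.reg x ≠ 0 → Runs p s T Q) (h' : s.reg x = 0 → Runs q s T Q) :
    Runs (.cond x p q) s (T + 1) Q := by
  by_cases hx : s.reg x = 0
  · obtain ⟨τ, s', h1, h2, h3⟩ := h' hx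
    exact ⟨τ + 1, s', by omega, .cond_zero x p q s s' τ hx h2, h3⟩
  · obtain ⟨τ, s', h1, h2, h3⟩ := h hx
    exact ⟨τ + 1, s', by omega, .cond_pos x p q s s' τ hx h2, h3⟩

theorem loop_done {x : ℕ} (hx : s.reg x = 0) (h : Q s) : Runs (.loop x p) s 1 Q :=
  ⟨1, s, le_rfl, .loop_done x p s hx, h⟩

theorem loop_step {x : ℕ} (hx : s.reg x ≠ 0)
    (h : Runs p s T₁ fun s' => Runs (.loop x p) s' T₂ Q) :
    Runs (.loop x p) s (T₁ + T₂ + 1) Q := by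
  obtain ⟨τ, s', h1, h2, τ', s'', h3, h4, h5⟩ := h
  exact ⟨τ + τ' + 1, s'', by omega, .loop_step x p s s' s'' τ τ' hx h2 h4, h5⟩

end Runs

/-! ### Counting loops -/

namespace RamProg

/-- The register of a vertex variable. -/
def rv (v : ℕ) : ℕ := 2 * v + 10

/-- The scratch register of nesting depth `d`. -/
def rt (d : ℕ) : ℕ := 2 * d + 11

theorem rv_ne_rt (v d : ℕ) : rv v ≠ rt d := by
  unfold rv rt
  omega

theorem rv_inj {v w : ℕ} : rv v = rv w ↔ v = w := by
  unfold rv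
  omega

theorem rt_inj {d e : ℕ} : rt d = rt e ↔ d = e := by
  unfold rt
  omega

theorem ne_rv {c : ℕ} (h : c < 10) (v : ℕ) : c ≠ rv v := by
  unfold rv
  omega

theorem ne_rt {c : ℕ} (h : c < 10) (d : ℕ) : c ≠ rt d := by
  unfold rt
  omega

/-- No register has changed, except for the scratch registers from depth `d` on. -/
def Same (d : ℕ) (s s' : RamState) : Prop :=
  ∀ x, (∀ j, d ≤ j → x ≠ rt j) → s'.reg x = s.reg x

/-- No register has changed, except for the one of `v` and the scratch registers from depth `d`
on. -/
def SameBut (v d : ℕ) (s s' : RamState) : Prop :=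
  ∀ x, (∀ j, d ≤ j → x ≠ rt j) → x ≠ rv v → s'.reg x = s.reg x

theorem Same.refl (d : ℕ) (s : RamState) : Same d s s := fun _ _ => rfl

theorem Same.trans {d : ℕ} {s s' s'' : RamState} (h : Same d s s') (h' : Same d s' s'') :
    Same d s s'' := fun x hx => (h' x hx).trans (h x hx)

theorem Same.mono {d d' : ℕ} {s s' : RamState} (h : Same d s s') (hd : d' ≤ d) : Same d' s s' :=
  fun x hx => h x fun j hj => hx j (hd.trans hj)

theorem Same.setReg {d d' a : ℕ} {s s' : RamState} (h : Same d s s') (hd : d ≤ d') :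
    Same d s (s'.setReg (rt d') a) := fun x hx => by
  rw [RamState.reg_setReg_of_ne (hx d' hd), h x hx]

theorem Same.rv {d : ℕ} {s s' : RamState} (h : Same d s s') (v : ℕ) :
    s'.reg (rv v) = s.reg (rv v) := h _ fun _ _ => rv_ne_rt _ _

theorem Same.low {d : ℕ} {s s' : RamState} (h : Same d s s') {c : ℕ} (hc : c < 10) :
    s'.reg c = s.reg c := h _ fun _ _ => ne_rt hc _

theorem Same.rt {d e : ℕ} {s s' : RamState} (h : Same d s s') (he : e < d) :
    s'.reg (rt e) = s.reg (rt e) := h _ fun j hj => by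
  rw [Ne, rt_inj]
  omega

theorem Same.sameBut {d : ℕ} {s s' : RamState} (h : Same d s s') (v : ℕ) : SameBut v d s s' :=
  fun x hx _ => h x hx

theorem SameBut.same {d v : ℕ} {s s' : RamState} (h : SameBut v d s s')
    (hv : s'.reg (RamProg.rv v) = s.reg (RamProg.rv v)) : Same d s s' := fun x hx => by
  by_cases hxv : x = RamProg.rv v
  · rw [hxv, hv]
  · exact h x hx hxv

theorem SameBut.trans {d v : ℕ} {s s' s'' : RamState} (h : SameBut v d s s')
    (h' : SameBut v d s' s'') : SameBut v d s s'' :=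
  fun x hx hv => (h' x hx hv).trans (h x hx hv)

theorem SameBut.mono {v d d' : ℕ} {s s' : RamState} (h : SameBut v d s s') (hd : d' ≤ d) :
    SameBut v d' s s' := fun x hx => h x fun j hj => hx j (hd.trans hj)

theorem SameBut.rv {d v : ℕ} {s s' : RamState} (h : SameBut v d s s') {w : ℕ} (hw : w ≠ v) :
    s'.reg (RamProg.rv w) = s.reg (RamProg.rv w) :=
  h _ (fun _ _ => rv_ne_rt _ _) (by rwa [Ne, rv_inj])

theorem SameBut.low {d v : ℕ} {s s' : RamState} (h : SameBut v d s s') {c : ℕ} (hc : c < 10) :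
    s'.reg c = s.reg c := h _ (fun _ _ => ne_rt hc _) (ne_rv hc _)

theorem SameBut.rt {d v e : ℕ} {s s' : RamState} (h : SameBut v d s s') (he : e < d) :
    s'.reg (RamProg.rt e) = s.reg (RamProg.rt e) :=
  h _ (fun j hj => by rw [Ne, rt_inj]; omega) (rv_ne_rt _ _).symm

/-- Run `body` with the variable `v` ranging over `0, …, n - 1`, where `n` is in register `0`.  The
old value of `v` is kept in the scratch register of depth `d` and restored in the end.  Register `3`
is expected to hold zero, and register `4` one. -/
def forProg (d v : ℕ) (body : RamProg) : RamProg :=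
  .seq (.add (rt d) (rv v) 3) <| .seq (.const (rv v) 0) <| .seq (.sub (rt (d + 1)) 0 (rv v)) <|
    .seq (.loop (rt (d + 1))
      (.seq body (.seq (.add (rv v) (rv v) 4) (.sub (rt (d + 1)) 0 (rv v)))))
    (.add (rv v) (rt d) 3)

/-- The rule for counting loops: `C i` is the invariant before round `i`.  It may not depend on the
registers that the loop itself uses. -/
theorem runs_forProg {d v n T : ℕ} {body : RamProg} (C : ℕ → RamState → Prop)
    (hC : ∀ i s s', s'.arr = s.arr → SameBut v d s s' → C i s → C i s') {s : RamState}
    (h0 : s.reg 0 = n) (h3 : s.reg 3 = 0) (h4 : s.reg 4 = 1) (hinit : C 0 s)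
    (hbody : ∀ i < n, ∀ s₁, C i s₁ → s₁.reg (rv v) = i → s₁.reg 0 = n → s₁.reg 3 = 0 →
      s₁.reg 4 = 1 → Runs body s₁ T fun s₂ => s₂.reg 0 = n ∧ s₂.reg 3 = 0 ∧ s₂.reg 4 = 1 ∧
        s₂.reg (rv v) = i ∧ s₂.reg (rt d) = s₁.reg (rt d) ∧ C (i + 1) s₂) :
    Runs (forProg d v body) s (n * (T + 3) + 5) fun s' =>
      C n s' ∧ s'.reg (rv v) = s.reg (rv v) := by
  have hset : ∀ i (s : RamState) a, C i s → C i (s.setReg (rv v) a) := fun i s a h =>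
    hC i s _ rfl (fun x _ hx => RamState.reg_setReg_of_ne hx) h
  have hset' : ∀ i (s : RamState) e a, d ≤ e → C i s → C i (s.setReg (rt e) a) :=
    fun i s e a he h => hC i s _ rfl (fun x hx _ => RamState.reg_setReg_of_ne (hx e he)) h
  have hvd : ∀ e, rv v ≠ rt e := rv_ne_rt v
  have hdd : rt d ≠ rt (d + 1) := by
    rw [Ne, rt_inj]
    omega
  have hloop : ∀ (m i : ℕ), i + m = n → ∀ s₁ : RamState, C i s₁ → s₁.reg (rv v) = i →
      s₁.reg 0 = n → s₁.reg 3 = 0 → s₁.reg 4 = 1 → s₁.reg (rt (d + 1)) = n - i →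
      s₁.reg (rt d) = s.reg (rv v) →
      Runs (.loop (rt (d + 1))
        (.seq body (.seq (.add (rv v) (rv v) 4) (.sub (rt (d + 1)) 0 (rv v))))) s₁
        (m * (T + 3) + 1)
        fun s' => C n s' ∧ s'.reg (rt d) = s.reg (rv v) ∧ s'.reg 3 = 0 := by
    intro m
    induction m with
    | zero =>
      intro i hi s₁ c1 c2 c3 c4 c5 c6 c7
      obtain rfl : i = n := by omega
      exact (Runs.loop_done (by rw [c6]; omega) ⟨c1, c7, c4⟩).mono (by omega) fun _ h => h
    | succ m ih =>
      intro i hi s₁ c1 c2 c3 c4 c5 c6 c7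
      refine (Runs.loop_step (T₁ := T + (1 + 1)) (T₂ := m * (T + 3) + 1) (by rw [c6]; omega)
        (Runs.seq ?_)).mono (by ring_nf; omega) fun _ h => h
      refine (hbody i (by omega) s₁ c1 c2 c3 c4 c5).mono le_rfl ?_
      rintro s₂ ⟨b0, b3, b4, bv, bd, bC⟩
      refine Runs.seq (Runs.add (Runs.sub (ih (i + 1) (by omega) _ ?_ ?_ ?_ ?_ ?_ ?_ ?_)))
      · exact hset' _ _ _ _ (by omega) (hset _ _ _ bC)
      · rw [RamState.reg_setReg_of_ne (hvd _), RamState.reg_setReg_self, bv, b4]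
      · rw [RamState.reg_setReg_of_ne (ne_rt (by omega) _),
          RamState.reg_setReg_of_ne (ne_rv (by omega) _), b0]
      · rw [RamState.reg_setReg_of_ne (ne_rt (by omega) _),
          RamState.reg_setReg_of_ne (ne_rv (by omega) _), b3]
      · rw [RamState.reg_setReg_of_ne (ne_rt (by omega) _),
          RamState.reg_setReg_of_ne (ne_rv (by omega) _), b4]
      · rw [RamState.reg_setReg_self, RamState.reg_setReg_self,
          RamState.reg_setReg_of_ne (ne_rv (by omega) _), b0, bv, b4]
      · rw [RamState.reg_setReg_of_ne hdd, RamState.reg_setReg_of_ne (hvd _).symm, bd, c7]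
  refine (Runs.seq (T₁ := 1) (T₂ := 1 + (1 + (n * (T + 3) + 1 + 1))) (Runs.add (Runs.seq
    (Runs.const (Runs.seq (Runs.sub (Runs.seq ?_))))))).mono (by omega) fun _ h => h
  refine (hloop n 0 (by omega) _ ?_ ?_ ?_ ?_ ?_ ?_ ?_).mono le_rfl ?_
  · exact hset' _ _ _ _ (by omega) (hset _ _ _ (hset' _ _ _ _ le_rfl hinit))
  · rw [RamState.reg_setReg_of_ne (hvd _), RamState.reg_setReg_self]
  · simp only [RamState.reg_setReg_of_ne (ne_rt (show 0 < 10 by omega) _),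
      RamState.reg_setReg_of_ne (ne_rv (show 0 < 10 by omega) _), h0]
  · simp only [RamState.reg_setReg_of_ne (ne_rt (show 3 < 10 by omega) _),
      RamState.reg_setReg_of_ne (ne_rv (show 3 < 10 by omega) _), h3]
  · simp only [RamState.reg_setReg_of_ne (ne_rt (show 4 < 10 by omega) _),
      RamState.reg_setReg_of_ne (ne_rv (show 4 < 10 by omega) _), h4]
  · simp only [RamState.reg_setReg_of_ne (ne_rt (show 0 < 10 by omega) _), RamState.reg_setReg_self,
      RamState.reg_setReg_of_ne (ne_rv (show 0 < 10 by omega) _), h0]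
  · rw [RamState.reg_setReg_of_ne hdd, RamState.reg_setReg_of_ne (hvd _).symm,
      RamState.reg_setReg_self, h3]
    rfl
  · rintro s' ⟨c1, c2, c3⟩
    refine Runs.add ⟨hset _ _ _ c1, ?_⟩
    rw [RamState.reg_setReg_self, c2, c3]
    rfl

end RamProg

/-! ### Relational programs -/

/-- First-order formulas about binary relations and the order of the vertices.  Relations and
variables are named by numbers. -/
inductive Fml : Type
  /-- the relation `r` holds for the variables `v` and `w` -/
  | rel (r v w : ℕ) : Fml
  /-- the vertex `v` comes before `w` or is equal to it -/
  | le (v w : ℕ) : Fml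
  | not (φ : Fml) : Fml
  | and (φ ψ : Fml) : Fml
  | or (φ ψ : Fml) : Fml
  /-- some vertex `v` satisfies `φ` -/
  | ex (v : ℕ) (φ : Fml) : Fml

/-- The truth value of a formula. -/
def Fml.Holds {n : ℕ} (S : ℕ → Fin n → Fin n → Prop) : Fml → (ℕ → Fin n) → Prop
  | .rel r v w, e => S r (e v) (e w)
  | .le v w, e => e v ≤ e w
  | .not φ, e => ¬ φ.Holds S e
  | .and φ ψ, e => φ.Holds S e ∧ ψ.Holds S e
  | .or φ ψ, e => φ.Holds S e ∨ ψ.Holds S e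
  | .ex v φ, e => ∃ x, φ.Holds S (Function.update e v x)

/-- Relational programs: assignments to binary relations on the vertices, given by first-order
formulas, and loops over the vertices. -/
inductive RelProg : Type
  /-- redefine the relation `r` by a formula in the variables `0` and `1` -/
  | assign (r : ℕ) (φ : Fml) : RelProg
  | seq (p q : RelProg) : RelProg
  /-- run `p` for all vertices `v`, in increasing order -/
  | each (v : ℕ) (p : RelProg) : RelProg

/-- The effect of a relational program on the relations. -/
def RelProg.run {n : ℕ} : RelProg → (ℕ → Fin n) → (ℕ → Fin n → Fin n → Prop) →
    (ℕ → Fin n → Fin n → Prop)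
  | .assign r φ, e, S =>
    Function.update S r fun x y => φ.Holds S (Function.update (Function.update e 0 x) 1 y)
  | .seq p q, e, S => q.run e (p.run e S)
  | .each v p, e, S => (List.finRange n).foldl (fun S x => p.run (Function.update e v x) S) S

open RamProg

/-- The program that puts the truth value of the formula into the scratch register of depth `d`. -/
def Fml.compile : Fml → ℕ → RamProg
  | .rel r v w, d => .seq (.read (rt d) 1 (rv v)) (.seq (.add (rt d) (rt d) (rv w))
      (.read (rt d) (2 * r) (rt d)))
  | .le v w, d => .seq (.sub (rt d) (rv v) (rv w)) (.sub (rt d) 4 (rt d))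
  | .not φ, d => .seq (φ.compile d) (.sub (rt d) 4 (rt d))
  | .and φ ψ, d => .seq (φ.compile d) (.cond (rt d) (ψ.compile d) .skip)
  | .or φ ψ, d => .seq (φ.compile d) (.cond (rt d) .skip (ψ.compile d))
  | .ex v φ, d => .seq (.const (rt d) 0) (forProg (d + 1) v
      (.seq (φ.compile (d + 3)) (.cond (rt (d + 3)) (.const (rt d) 1) .skip)))

/-- For all vertices `x` and `y` (the variables `0` and `1`), let `body` compute a value in the
scratch register of depth `d + 4`, and store it in the array `a` at position `x * n + y`. -/
def RamProg.fillProg (d a : ℕ) (body : RamProg) : RamProg :=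
  forProg d 0 (forProg (d + 2) 1 (.seq body (.seq (.read (rt (d + 5)) 1 (rv 0))
    (.seq (.add (rt (d + 5)) (rt (d + 5)) (rv 1)) (.write a (rt (d + 5)) (rt (d + 4)))))))

/-- Copy array `a` to array `b`. -/
def RamProg.copyProg (d a b : ℕ) : RamProg :=
  fillProg d b (.seq (.read (rt (d + 4)) 1 (rv 0)) (.seq (.add (rt (d + 4)) (rt (d + 4)) (rv 1))
    (.read (rt (d + 4)) a (rt (d + 4)))))

/-- The machine program of a relational program.  An assigned relation is first computed in
array `3`, since the formula refers to the old relation. -/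
def RelProg.compile : RelProg → ℕ → RamProg
  | .assign r φ, d => .seq (fillProg d 3 (φ.compile (d + 4))) (copyProg d 3 (2 * r))
  | .seq p q, d => .seq (p.compile d) (q.compile d)
  | .each v p, d => forProg d v (p.compile (d + 2))

open Classical in
/-- The memory `s` holds the relations `S`, one in every array of even number, together with the
constants and the row offsets. -/
structure Stores {n : ℕ} (S : ℕ → Fin n → Fin n → Prop) (s : RamState) : Prop where
  size : s.reg 0 = n
  zero : s.reg 3 = 0
  one : s.reg 4 = 1
  offset : ∀ i : Fin n, s.arr 1 i = i * n
  rel : ∀ r (i j : Fin n), s.arr (2 * r) (i * n + j) = if S r i j then 1 else 0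

/-- The registers of the variables hold the values `e`. -/
def StoresVars {n : ℕ} (e : ℕ → Fin n) (s : RamState) : Prop :=
  ∀ v, s.reg (rv v) = e v

theorem Stores.of_same {n d v : ℕ} {S : ℕ → Fin n → Fin n → Prop} {s s' : RamState}
    (h : Stores S s) (harr : s'.arr = s.arr) (hs : SameBut v d s s') : Stores S s' where
  size := (hs.low (by omega)).trans h.size
  zero := (hs.low (by omega)).trans h.zero
  one := (hs.low (by omega)).trans h.one
  offset := by
    rw [harr]
    exact h.offset
  rel := by
    rw [harr]
    exact h.rel

theorem StoresVars.of_same {n d : ℕ} {e : ℕ → Fin n} {s s' : RamState} (h : StoresVars e s)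
    (hs : Same d s s') : StoresVars e s' := fun v => (hs.rv v).trans (h v)

theorem StoresVars.update {n d v : ℕ} {e : ℕ → Fin n} {s s' : RamState} (h : StoresVars e s)
    (hs : SameBut v d s s') {x : Fin n} (hx : s'.reg (rv v) = x) :
    StoresVars (Function.update e v x) s' := by
  intro w
  by_cases hw : w = v
  · subst hw
    rw [Function.update_self, hx]
  · rw [Function.update_of_ne hw, hs.rv hw, h w]

open Classical in
/-- Formulas are evaluated correctly, in time polynomial in the number of vertices. -/
theorem Fml.runs_compile (φ : Fml) : ∃ q : Polynomial ℕ, ∀ (n d : ℕ)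
    (S : ℕ → Fin n → Fin n → Prop) (e : ℕ → Fin n) (s : RamState), Stores S s → StoresVars e s →
    Runs (φ.compile d) s (q.eval n) fun s' => s'.arr = s.arr ∧ Same d s s' ∧
      s'.reg (rt d) = if φ.Holds S e then 1 else 0 := by
  induction φ with
  | rel r v w =>
    refine ⟨3, fun n d S e s hS he => ?_⟩
    refine (Runs.seq (Runs.read (Runs.seq (Runs.add (Runs.read ⟨rfl, ?_, ?_⟩))))).mono
      (T := 1 + (1 + 1)) (by simp) fun _ h => h
    · exact (((Same.refl d s).setReg le_rfl).setReg le_rfl).setReg le_rfl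
    · simp only [RamState.reg_setReg_self, RamState.arr_setReg,
        RamState.reg_setReg_of_ne (rv_ne_rt _ _), he v, he w, hS.offset, hS.rel, Fml.Holds]
      congr
  | le v w =>
    refine ⟨2, fun n d S e s hS he => ?_⟩
    refine (Runs.seq (Runs.sub (Runs.sub ⟨rfl, ?_, ?_⟩))).mono
      (T := 1 + 1) (by simp) fun _ h => h
    · exact ((Same.refl d s).setReg le_rfl).setReg le_rfl
    · simp only [RamState.reg_setReg_self,
        RamState.reg_setReg_of_ne (ne_rt (show 4 < 10 by omega) _),
        he v, he w, hS.one, Fml.Holds, Fin.le_def]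
      split_ifs <;> omega
  | not φ ih =>
    obtain ⟨q, hq⟩ := ih
    refine ⟨q + 1, fun n d S e s hS he => ?_⟩
    refine (Runs.seq (T₂ := 1) ((hq n d S e s hS he).mono le_rfl ?_)).mono (by simp) fun _ h => h
    rintro s' ⟨h1, h2, h3⟩
    refine Runs.sub ⟨h1, h2.setReg le_rfl, ?_⟩
    rw [RamState.reg_setReg_self, h3, h2.low (by omega), hS.one]
    by_cases hφ : φ.Holds S e <;> simp [Fml.Holds, hφ]
  | and φ ψ ih ih' =>
    obtain ⟨q, hq⟩ := ih
    obtain ⟨q', hq'⟩ := ih'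
    refine ⟨q + (q' + 1 + 1), fun n d S e s hS he => ?_⟩
    refine (Runs.seq (T₂ := q'.eval n + 1 + 1) ((hq n d S e s hS he).mono le_rfl ?_)).mono (by simp)
      fun _ h => h
    rintro s' ⟨h1, h2, h3⟩
    refine Runs.cond (fun hc => ?_) fun hc => ?_
    · refine (hq' n d S e s' (hS.of_same h1 (h2.sameBut 0)) (he.of_same h2)).mono (by omega) ?_
      rintro s'' ⟨h1', h2', h3'⟩
      refine ⟨h1'.trans h1, h2.trans h2', ?_⟩
      have : φ.Holds S e := by
        by_contra hφ
        simp [h3, hφ] at hc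
      simp [h3', Fml.Holds, this]
    · refine (Runs.skip ⟨h1, h2, ?_⟩).mono (by omega) fun _ h => h
      have : ¬ φ.Holds S e := by
        intro hφ
        simp [h3, hφ] at hc
      simp [hc, Fml.Holds, this]
  | or φ ψ ih ih' =>
    obtain ⟨q, hq⟩ := ih
    obtain ⟨q', hq'⟩ := ih'
    refine ⟨q + (q' + 1 + 1), fun n d S e s hS he => ?_⟩
    refine (Runs.seq (T₂ := q'.eval n + 1 + 1) ((hq n d S e s hS he).mono le_rfl ?_)).mono (by simp)
      fun _ h => h
    rintro s' ⟨h1, h2, h3⟩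
    refine Runs.cond (fun hc => ?_) fun hc => ?_
    · refine (Runs.skip ⟨h1, h2, ?_⟩).mono (by omega) fun _ h => h
      have : φ.Holds S e := by
        by_contra hφ
        simp [h3, hφ] at hc
      simp [h3, Fml.Holds, this]
    · refine (hq' n d S e s' (hS.of_same h1 (h2.sameBut 0)) (he.of_same h2)).mono (by omega) ?_
      rintro s'' ⟨h1', h2', h3'⟩
      refine ⟨h1'.trans h1, h2.trans h2', ?_⟩
      have : ¬ φ.Holds S e := by
        intro hφ
        simp [h3, hφ] at hc
      simp [h3', Fml.Holds, this]
  | ex v φ ih =>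
    obtain ⟨q, hq⟩ := ih
    refine ⟨1 + (Polynomial.X * (q + 2 + 3) + 5), fun n d S e s hS he => ?_⟩
    refine (Runs.seq (T₁ := 1) (T₂ := n * (q.eval n + 2 + 3) + 5) (Runs.const ?_)).mono (by simp)
      fun _ h => h
    -- after the vertices below `i`, the result register tells whether one of them is a witness
    let C : ℕ → RamState → Prop := fun i s' => s'.arr = s.arr ∧ SameBut v d s s' ∧
      s'.reg (rt d) = if ∃ x : Fin n, x < i ∧ φ.Holds S (Function.update e v x) then 1 else 0
    have hs0 : SameBut v d s (s.setReg (rt d) 0) := ((Same.refl d s).setReg le_rfl).sameBut v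
    refine (runs_forProg (n := n) (T := q.eval n + 2) C ?_ ?_ ?_ ?_ ?_ ?_).mono le_rfl ?_
    · rintro i s₁ s₂ h1 h2 ⟨c1, c2, c3⟩
      exact ⟨h1.trans c1, c2.trans (h2.mono (by omega)), (h2.rt (by omega)).trans c3⟩
    · rw [hs0.low (by omega), hS.size]
    · rw [hs0.low (by omega), hS.zero]
    · rw [hs0.low (by omega), hS.one]
    · refine ⟨rfl, hs0, ?_⟩
      rw [RamState.reg_setReg_self]
      simp
    · rintro i hi s₁ ⟨c1, c2, c3⟩ hv h0 h3 h4
      refine (Runs.seq (T₁ := q.eval n) (T₂ := 1 + 1) ((hq n (d + 3) S _ s₁ (hS.of_same c1 c2)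
        (he.update c2 (x := ⟨i, hi⟩) hv)).mono le_rfl ?_))
      rintro s₂ ⟨b1, b2, b3⟩
      have hstep : (∃ x : Fin n, x < i + 1 ∧ φ.Holds S (Function.update e v x)) ↔
          (∃ x : Fin n, x < i ∧ φ.Holds S (Function.update e v x)) ∨
            φ.Holds S (Function.update e v ⟨i, hi⟩) := by
        constructor
        · rintro ⟨x, hx, hφ⟩
          rcases Nat.lt_succ_iff_lt_or_eq.1 hx with h | h
          · exact Or.inl ⟨x, h, hφ⟩
          · obtain rfl : x = ⟨i, hi⟩ := Fin.ext h
            exact Or.inr hφ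
        · rintro (⟨x, hx, hφ⟩ | hφ)
          · exact ⟨x, hx.trans (Nat.lt_succ_self i), hφ⟩
          · exact ⟨_, Nat.lt_succ_self i, hφ⟩
      have hsb : SameBut v d s s₂ := c2.trans ((b2.mono (by omega)).sameBut v)
      refine Runs.cond (fun hc => ?_) fun hc => ?_
      · have hφ : φ.Holds S (Function.update e v ⟨i, hi⟩) := by
          by_contra hφ
          simp [b3, hφ] at hc
        refine Runs.const ⟨?_, ?_, ?_, ?_, ?_, ?_, ?_, ?_⟩
        · rw [RamState.reg_setReg_of_ne (ne_rt (by omega) _), b2.low (by omega), h0]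
        · rw [RamState.reg_setReg_of_ne (ne_rt (by omega) _), b2.low (by omega), h3]
        · rw [RamState.reg_setReg_of_ne (ne_rt (by omega) _), b2.low (by omega), h4]
        · rw [RamState.reg_setReg_of_ne (rv_ne_rt _ _), b2.rv, hv]
        · rw [RamState.reg_setReg_of_ne (by rw [Ne, rt_inj]; omega), b2.rt (by omega)]
        · exact b1.trans c1
        · exact hsb.trans (((Same.refl d s₂).setReg le_rfl).sameBut v)
        · rw [RamState.reg_setReg_self, if_pos (hstep.2 (Or.inr hφ))]
      · have hφ : ¬ φ.Holds S (Function.update e v ⟨i, hi⟩) := by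
          intro hφ
          simp [b3, hφ] at hc
        refine Runs.skip ⟨?_, ?_, ?_, ?_, ?_, ?_, ?_, ?_⟩
        · rw [b2.low (by omega), h0]
        · rw [b2.low (by omega), h3]
        · rw [b2.low (by omega), h4]
        · rw [b2.rv, hv]
        · rw [b2.rt (by omega)]
        · exact b1.trans c1
        · exact hsb
        · rw [b2.rt (by omega), c3]
          simp only [hstep, hφ, or_false]
    · rintro s' ⟨⟨c1, c2, c3⟩, hv⟩
      refine ⟨c1, c2.same (by rw [hv, RamState.reg_setReg_of_ne (rv_ne_rt _ _)]), ?_⟩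
      rw [c3]
      simp only [Fml.Holds, Fin.is_lt, true_and]
      congr

theorem Fin.mul_add_inj {n : ℕ} {i j i' j' : Fin n} (h : (i : ℕ) * n + j = i' * n + j') :
    i = i' ∧ j = j' := by
  have hn : 0 < n := i.pos
  have h1 := congrArg (· / n) h
  have h2 := congrArg (· % n) h
  simp only [Nat.mul_add_mod', Nat.mod_eq_of_lt j.2, Nat.mod_eq_of_lt j'.2] at h2
  have hi : ∀ i j : Fin n, ((i : ℕ) * n + j) / n = i := fun i j => by
    rw [mul_comm, Nat.mul_add_div hn, Nat.div_eq_of_lt j.2, add_zero]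
  simp only [hi] at h1
  exact ⟨Fin.ext h1, Fin.ext h2⟩

theorem RamProg.runs_fillProg {n d a T : ℕ} {body : RamProg} {s : RamState}
    (h0 : s.reg 0 = n) (h3 : s.reg 3 = 0) (h4 : s.reg 4 = 1)
    (hoff : ∀ i : Fin n, s.arr 1 i = i * n) (ha : a ≠ 1) (val : Fin n → Fin n → ℕ)
    (hbody : ∀ (x y : Fin n) (s₁ : RamState), (∀ b, b ≠ a → s₁.arr b = s.arr b) →
      (∀ z, (∀ j, d ≤ j → z ≠ rt j) → z ≠ rv 0 → z ≠ rv 1 → s₁.reg z = s.reg z) →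
      s₁.reg (rv 0) = x → s₁.reg (rv 1) = y →
      Runs body s₁ T fun s₂ => s₂.arr = s₁.arr ∧ Same (d + 4) s₁ s₂ ∧
        s₂.reg (rt (d + 4)) = val x y) :
    Runs (fillProg d a body) s (n * (n * (T + 3 + 3) + 5 + 3) + 5) fun s' =>
      Same d s s' ∧ (∀ b, b ≠ a → s'.arr b = s.arr b) ∧
        ∀ i j : Fin n, s'.arr a (i * n + j) = val i j := by
  let C : ℕ → RamState → Prop := fun i s' => SameBut 0 d s s' ∧
    s'.reg (rv 1) = s.reg (rv 1) ∧ (∀ b, b ≠ a → s'.arr b = s.arr b) ∧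
    ∀ x y : Fin n, (x : ℕ) < i → s'.arr a (x * n + y) = val x y
  refine (runs_forProg (n := n) (T := n * (T + 3 + 3) + 5) C ?_ h0 h3 h4 ?_ ?_).mono le_rfl ?_
  · rintro i s₁ s₂ e1 e2 ⟨c1, c2, c3, c4⟩
    rw [← e1] at c3 c4
    exact ⟨c1.trans e2, (e2.rv (by omega)).trans c2, c3, c4⟩
  · exact ⟨fun _ _ _ => rfl, rfl, fun _ _ => rfl, fun x y h => absurd h (by omega)⟩
  · rintro i hi s₁ ⟨c1, c2, c3, c4⟩ k1 k2 k3 k4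
    let D : ℕ → RamState → Prop := fun j s' => SameBut 1 (d + 2) s₁ s' ∧
      (∀ b, b ≠ a → s'.arr b = s.arr b) ∧
      ∀ x y : Fin n, (x : ℕ) < i ∨ (x : ℕ) = i ∧ (y : ℕ) < j → s'.arr a (x * n + y) = val x y
    refine (runs_forProg (n := n) (T := T + 3) D ?_ k2 k3 k4 ?_ ?_).mono le_rfl ?_
    · rintro j s₂ s₃ e1 e2 ⟨d1, d2, d3⟩
      rw [← e1] at d2 d3
      exact ⟨d1.trans e2, d2, d3⟩
    · exact ⟨fun _ _ _ => rfl, c3, fun x y h => c4 x y (by omega)⟩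
    · rintro j hj s₂ ⟨d1, d2, d3⟩ l1 l2 l3 l4
      have hv0 : s₂.reg (rv 0) = i := (d1.rv (by omega)).trans k1
      refine (Runs.seq (T₁ := T) (T₂ := 1 + (1 + 1)) ((hbody ⟨i, hi⟩ ⟨j, hj⟩ s₂ d2 ?_ hv0
        l1).mono le_rfl ?_)).mono (by omega) fun _ h => h
      · intro z hz hz0 hz1
        rw [d1 z (fun j hj => hz j (by omega)) hz1, c1 z hz hz0]
      · rintro s₃ ⟨b1, b2, b3⟩
        refine Runs.seq (Runs.read (Runs.seq (Runs.add (Runs.write ?_))))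
        set s₄ := (s₃.setReg (rt (d + 5)) (s₃.arr 1 (s₃.reg (rv 0)))) with hs₄
        set s₅ := s₄.setReg (rt (d + 5)) (s₄.reg (rt (d + 5)) + s₄.reg (rv 1)) with hs₅
        have hb2 : Same (d + 4) s₂ s₅ := (b2.setReg (by omega)).setReg (by omega)
        have haddr : s₅.reg (rt (d + 5)) = i * n + j := by
          rw [hs₅, RamState.reg_setReg_self, hs₄, RamState.reg_setReg_self,
            RamState.reg_setReg_of_ne (rv_ne_rt _ _), b2.rv, b2.rv, hv0, l1, b1, d2 1 (Ne.symm ha)]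
          rw [hoff ⟨i, hi⟩]
        have hval : s₅.reg (rt (d + 4)) = val ⟨i, hi⟩ ⟨j, hj⟩ := by
          rw [hs₅, RamState.reg_setReg_of_ne (by rw [Ne, rt_inj]; omega), hs₄,
            RamState.reg_setReg_of_ne (by rw [Ne, rt_inj]; omega), b3]
        have harr : s₅.arr = s₂.arr := b1
        rw [haddr, hval]
        refine ⟨?_, ?_, ?_, ?_, ?_, ?_, ?_, ?_⟩
        · exact (hb2.low (by omega)).trans l2
        · exact (hb2.low (by omega)).trans l3
        · exact (hb2.low (by omega)).trans l4
        · exact (hb2.rv 1).trans l1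
        · exact hb2.rt (by omega)
        · exact d1.trans ((hb2.mono (by omega)).sameBut 1)
        · intro b hb
          funext m
          rw [RamState.arr_setArr_of_ne (Or.inl hb), harr, d2 b hb]
        · intro x y hxy
          by_cases he : (x : ℕ) = i ∧ (y : ℕ) = j
          · obtain ⟨rfl, rfl⟩ := he
            rw [RamState.arr_setArr_self]
          · rw [RamState.arr_setArr_of_ne, harr]
            · exact d3 x y (by omega)
            · refine Or.inr fun h => he ?_
              obtain ⟨h1, h2⟩ := Fin.mul_add_inj (i' := ⟨i, hi⟩) (j' := ⟨j, hj⟩) h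
              exact ⟨congrArg Fin.val h1, congrArg Fin.val h2⟩
    · rintro s₂ ⟨⟨d1, d2, d3⟩, d4⟩
      have := d1.same d4
      refine ⟨?_, ?_, ?_, ?_, ?_, ?_, ?_, ?_, ?_⟩
      · exact (this.low (by omega)).trans k2
      · exact (this.low (by omega)).trans k3
      · exact (this.low (by omega)).trans k4
      · exact (this.rv 0).trans k1
      · exact this.rt (by omega)
      · exact c1.trans ((this.mono (by omega)).sameBut 0)
      · exact d4.trans c2
      · exact d2
      · exact fun x y hx => d3 x y (by omega)
  · rintro s' ⟨⟨c1, c2, c3, c4⟩, c5⟩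
    exact ⟨c1.same c5, c3, fun i j => c4 i j i.2⟩

theorem RamProg.runs_copyProg {n d a b : ℕ} {s : RamState}
    (h0 : s.reg 0 = n) (h3 : s.reg 3 = 0) (h4 : s.reg 4 = 1)
    (hoff : ∀ i : Fin n, s.arr 1 i = i * n) (ha : b ≠ 1) (hab : a ≠ b) :
    Runs (copyProg d a b) s (n * (n * (3 + 3 + 3) + 5 + 3) + 5) fun s' =>
      Same d s s' ∧ (∀ c, c ≠ b → s'.arr c = s.arr c) ∧
        ∀ i j : Fin n, s'.arr b (i * n + j) = s.arr a (i * n + j) := by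
  refine runs_fillProg h0 h3 h4 hoff ha _ fun x y s₁ e1 e2 e3 e4 => ?_
  refine (Runs.seq (Runs.read (Runs.seq (Runs.add (Runs.read ⟨rfl, ?_, ?_⟩))))).mono
    (T := 1 + (1 + 1)) (by simp) fun _ h => h
  · exact (((Same.refl _ s₁).setReg le_rfl).setReg le_rfl).setReg le_rfl
  · simp only [RamState.reg_setReg_self, RamState.arr_setReg,
      RamState.reg_setReg_of_ne (rv_ne_rt _ _), e3, e4, e1 1 (Ne.symm ha), e1 a hab, hoff]

/-- Relational programs are executed correctly, in time polynomial in the number of vertices. -/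
theorem RelProg.runs_compile (p : RelProg) : ∃ q : Polynomial ℕ, ∀ (n d : ℕ)
    (S : ℕ → Fin n → Fin n → Prop) (e : ℕ → Fin n) (s : RamState), Stores S s → StoresVars e s →
    Runs (p.compile d) s (q.eval n) fun s' => Same d s s' ∧ Stores (p.run e S) s' := by
  classical
  induction p with
  | assign r φ =>
    obtain ⟨q, hq⟩ := φ.runs_compile
    refine ⟨(Polynomial.X * (Polynomial.X * (q + 3 + 3) + 5 + 3) + 5) +
      (Polynomial.X * (Polynomial.X * (3 + 3 + 3) + 5 + 3) + 5), fun n d S e s hS he => ?_⟩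
    refine (Runs.seq ((runs_fillProg (n := n) (T := q.eval n) hS.size hS.zero hS.one hS.offset
      (by omega) (fun x y => if φ.Holds S (Function.update (Function.update e 0 x) 1 y)
        then 1 else 0) ?_).mono le_rfl ?_)).mono
      (T := (n * (n * (q.eval n + 3 + 3) + 5 + 3) + 5) + (n * (n * (3 + 3 + 3) + 5 + 3) + 5))
      (by simp) fun _ h => h
    · intro x y s₁ e1 e2 e3 e4
      refine hq n (d + 4) S _ s₁ ?_ ?_
      · have hlow : ∀ c < 10, s₁.reg c = s.reg c := fun c hc =>
          e2 c (fun j _ => ne_rt hc j) (ne_rv hc 0) (ne_rv hc 1)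
        refine ⟨?_, ?_, ?_, ?_, ?_⟩
        · rw [hlow 0 (by omega), hS.size]
        · rw [hlow 3 (by omega), hS.zero]
        · rw [hlow 4 (by omega), hS.one]
        · rw [e1 1 (by omega)]
          exact hS.offset
        · intro r
          rw [e1 (2 * r) (by omega)]
          exact hS.rel r
      · intro v
        by_cases h1 : v = 1
        · rw [h1, Function.update_self, e4]
        by_cases h0 : v = 0
        · rw [Function.update_of_ne h1, h0, Function.update_self, e3]
        · rw [Function.update_of_ne h1, Function.update_of_ne h0, e2 _ (fun j _ => rv_ne_rt _ _)
            (by rwa [Ne, rv_inj]) (by rwa [Ne, rv_inj]), he v]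
    · rintro s₁ ⟨c1, c2, c3⟩
      have hoff : ∀ i : Fin n, s₁.arr 1 i = i * n := by
        rw [c2 1 (by omega)]
        exact hS.offset
      have h0 : s₁.reg 0 = n := (c1.low (by omega)).trans hS.size
      have h3 : s₁.reg 3 = 0 := (c1.low (by omega)).trans hS.zero
      have h4 : s₁.reg 4 = 1 := (c1.low (by omega)).trans hS.one
      refine (runs_copyProg h0 h3 h4 hoff (by omega) (by omega)).mono le_rfl ?_
      rintro s₂ ⟨b1, b2, b3⟩
      refine ⟨c1.trans b1, ?_, ?_, ?_, ?_, ?_⟩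
      · exact (b1.low (by omega)).trans h0
      · exact (b1.low (by omega)).trans h3
      · exact (b1.low (by omega)).trans h4
      · rw [b2 1 (by omega)]
        exact hoff
      · intro r' i j
        by_cases hr : r' = r
        · rw [hr, b3, c3]
          simp [RelProg.run]
        · rw [b2 (2 * r') (by omega), c2 (2 * r') (by omega), hS.rel]
          simp [RelProg.run, hr]
  | seq p p' ih ih' =>
    obtain ⟨q, hq⟩ := ih
    obtain ⟨q', hq'⟩ := ih'
    refine ⟨q + q', fun n d S e s hS he => ?_⟩
    refine (Runs.seq (T₂ := q'.eval n) ((hq n d S e s hS he).mono le_rfl ?_)).mono (by simp)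
      fun _ h => h
    rintro s₁ ⟨c1, c2⟩
    refine (hq' n d _ e s₁ c2 (he.of_same c1)).mono le_rfl ?_
    rintro s₂ ⟨b1, b2⟩
    exact ⟨c1.trans b1, b2⟩
  | each v p ih =>
    obtain ⟨q, hq⟩ := ih
    refine ⟨Polynomial.X * (q + 3) + 5, fun n d S e s hS he => ?_⟩
    let St : ℕ → ℕ → Fin n → Fin n → Prop := fun i =>
      ((List.finRange n).take i).foldl (fun S x => p.run (Function.update e v x) S) S
    let C : ℕ → RamState → Prop := fun i s' => SameBut v d s s' ∧ Stores (St i) s'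
    refine (runs_forProg (n := n) (T := q.eval n) C ?_ hS.size hS.zero hS.one ?_ ?_).mono
      (by simp) ?_
    · rintro i s₁ s₂ e1 e2 ⟨c1, c2⟩
      exact ⟨c1.trans e2, c2.of_same e1 e2⟩
    · exact ⟨fun _ _ _ => rfl, hS⟩
    · rintro i hi s₁ ⟨c1, c2⟩ k1 k2 k3 k4
      refine (hq n (d + 2) (St i) _ s₁ c2 (he.update c1 (x := ⟨i, hi⟩) k1)).mono le_rfl ?_
      rintro s₂ ⟨b1, b2⟩
      refine ⟨?_, ?_, ?_, ?_, ?_, ?_, ?_⟩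
      · exact (b1.low (by omega)).trans k2
      · exact (b1.low (by omega)).trans k3
      · exact (b1.low (by omega)).trans k4
      · exact (b1.rv v).trans k1
      · exact b1.rt (by omega)
      · exact c1.trans ((b1.mono (by omega)).sameBut v)
      · have : St (i + 1) = p.run (Function.update e v ⟨i, hi⟩) (St i) := by
          simp only [St]
          rw [List.take_succ_eq_append_getElem (by simpa using hi), List.foldl_append]
          simp
        rw [this]
        exact b2
    · rintro s' ⟨⟨c1, c2⟩, c3⟩
      refine ⟨c1.same c3, ?_⟩
      have : St n = (RelProg.each v p).run e S := by
        simp only [St, RelProg.run]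
        rw [List.take_of_length_le (by simp)]
      rwa [← this]

/-! ### The algorithm as a relational program -/

namespace Fml

/-!
Relation `0` is the adjacency of the input, `1` the current partition, `2` the closure of two
vertices, `3` its first elements of classes, `4` the forced pairs, `5` whether the closure has
passed the test, `6` the representatives, `7` the first elements of all classes, `8` the vertices
with a non-neighbour in their class, and `9` the first representatives.  A unary relation ignores
its second argument.
-/

/-- Equality of variables. -/
def eq (v w : ℕ) : Fml := .and (.le v w) (.le w v)

@[simp] theorem holds_eq {n : ℕ} {S : ℕ → Fin n → Fin n → Prop} {e : ℕ → Fin n} {v w : ℕ} :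
    (eq v w).Holds S e ↔ e v = e w := le_antisymm_iff.symm

/-- The formula of `SimpleGraph.splitStep`. -/
def close : Fml :=
  .or (.rel 2 0 0) (.or (.ex 2 (.and (.rel 2 2 2) (.rel 1 2 0)))
    (.ex 2 (.ex 3 (.and (.and (.rel 2 2 2) (.rel 2 3 3))
      (.and (.rel 0 0 2) (.not (.rel 0 0 3)))))))

/-- The formula of `SimpleGraph.firstIn`. -/
def first : Fml :=
  .and (.rel 2 0 0) (.not (.ex 2 (.and (.rel 1 2 0) (.not (.le 0 2)))))

/-- The initial pairs of `SimpleGraph.forced`, for the vertex in variable `12`. -/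
def forceInit : Fml :=
  .and (.and (.rel 3 0 0) (.rel 3 1 1)) (.and (eq 0 12) (.and (.not (eq 0 1)) (.not (.rel 0 0 1))))

/-- The formula of `SimpleGraph.forceStep`. -/
def force : Fml :=
  .or (.rel 4 0 1) (.and (.and (.rel 3 0 0) (.rel 3 1 1)) (.ex 2 (.or
    (.and (.rel 4 2 1) (.and (.rel 0 2 0) (.not (.rel 0 0 1))))
    (.and (.rel 4 0 2) (.and (.rel 0 2 1) (.not (.rel 0 0 1)))))))

/-- The formula of `SimpleGraph.Decides`. -/
def decides : Fml :=
  .and (.not (.ex 2 (.ex 3 (.and (.and (.rel 3 2 2) (.rel 3 3 3))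
      (.and (.and (.not (eq 2 3)) (.not (.rel 0 2 3)))
        (.and (.not (.rel 4 2 3)) (.not (.rel 4 3 2))))))))
    (.not (.ex 2 (.ex 3 (.ex 4 (.ex 5 (.and (.and (.rel 4 2 3) (.rel 4 4 5))
      (.and (.not (.rel 4 2 5)) (.not (.rel 4 4 3)))))))))

/-- The formula of `SimpleGraph.HasNoC4`. -/
def noC4 : Fml :=
  .not (.ex 2 (.ex 3 (.ex 4 (.ex 5 (.and
    (.and (.and (.rel 2 2 2) (.rel 2 3 3)) (.and (.rel 2 4 4) (.rel 2 5 5)))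
    (.and (.and (.and (.rel 0 2 4) (.rel 0 2 5)) (.and (.rel 0 3 4) (.rel 0 3 5)))
      (.and (.and (.not (eq 2 3)) (.not (eq 4 5)))
        (.and (.not (.rel 0 2 3)) (.not (.rel 0 4 5))))))))))

/-- The formula of `SimpleGraph.mergeStep`. -/
def merge : Fml :=
  .or (.rel 1 0 1) (.and (.and (.rel 5 0 0) noC4) (.and (.rel 2 0 0) (.rel 2 1 1)))

/-- The formula of `SimpleGraph.HasNonNeighbor`. -/
def nonNeighbor : Fml :=
  .ex 2 (.and (.rel 1 2 0) (.and (.not (eq 2 0)) (.not (.rel 0 0 2))))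

/-- The formula of `SimpleGraph.IsFirstRep`. -/
def firstRep : Fml :=
  .or (.and (.rel 8 0 0) (.not (.ex 2 (.and (.and (.rel 1 2 0) (.rel 8 2 2)) (.not (.le 0 2))))))
    (.and (.not (.ex 2 (.and (.rel 1 2 0) (.rel 8 2 2))))
      (.not (.ex 2 (.and (.rel 1 2 0) (.not (.le 0 2))))))

/-- The formula of `SimpleGraph.IsRep`. -/
def rep : Fml :=
  .or (.rel 9 0 0) (.ex 2 (.and (.and (.rel 9 2 2) (.rel 1 2 0))
    (.and (.and (.not (eq 2 0)) (.not (.rel 0 2 0)))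
      (.not (.ex 3 (.and (.and (.rel 1 2 3) (.and (.not (eq 2 3)) (.not (.rel 0 2 3))))
        (.not (.le 0 3))))))))

end Fml

namespace RelProg

/-- Run `p` as often as there are pairs of vertices. -/
def iterate (p : RelProg) : RelProg := .each 30 (.each 31 p)

/-- The body of the test for interval graphs, for the leftmost vertex in variable `12`. -/
def tryLeftmost : RelProg :=
  .seq (.assign 4 Fml.forceInit) <| .seq (.iterate (.assign 4 Fml.force)) <|
    .assign 5 (.or (.rel 5 0 0) (.and (.rel 3 12 12) Fml.decides))

/-- The program of `SimpleGraph.mergeStep`, for the vertices in the variables `10` and `11`. -/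
def tryMerge : RelProg :=
  .seq (.assign 2 (.or (.rel 1 0 10) (.rel 1 0 11))) <| .seq (.iterate (.assign 2 Fml.close)) <|
    .seq (.assign 3 Fml.first) <| .seq (.assign 5 (.not (.le 0 0))) <|
    .seq (.each 12 tryLeftmost) (.assign 1 Fml.merge)

/-- Compute the final partition and its representatives. -/
def solve : RelProg :=
  .seq (.assign 1 (.eq 0 1)) <| .seq (.iterate (.each 10 (.each 11 tryMerge))) <|
    .seq (.assign 8 Fml.nonNeighbor) <| .seq (.assign 9 Fml.firstRep) <|
    .seq (.assign 6 Fml.rep) (.assign 7 (.not (.ex 2 (.and (.rel 1 2 0) (.not (.le 0 2))))))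

variable {n : ℕ} {β : Type*}

/-- Loops of programs that simulate an abstract step. -/
theorem run_each {p : RelProg} {v : ℕ} {e : ℕ → Fin n}
    (P : (ℕ → Fin n → Fin n → Prop) → β → Prop) (F : β → Fin n → β)
    (h : ∀ x S b, P S b → P (p.run (Function.update e v x) S) (F b x))
    {S : ℕ → Fin n → Fin n → Prop} {b : β} (hS : P S b) :
    P ((each v p).run e S) ((List.finRange n).foldl F b) := by
  simp only [run]
  generalize List.finRange n = L
  induction L generalizing S b with
  | nil => exact hS
  | cons x L ih => exact ih (h x S b hS)

theorem run_iterate {p : RelProg} {e : ℕ → Fin n}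
    (P : (ℕ → Fin n → Fin n → Prop) → β → Prop) (F : β → β)
    (h : ∀ x y S b, P S b →
      P (p.run (Function.update (Function.update e 30 x) 31 y) S) (F b))
    {S : ℕ → Fin n → Fin n → Prop} {b : β} (hS : P S b) :
    P ((iterate p).run e S) (F^[n * n] b) := by
  have h1 : ∀ x S b, P S b → P ((each 31 p).run (Function.update e 30 x) S) (F^[n] b) := by
    intro x S b hS
    have := run_each (v := 31) P (fun b _ => F b) (fun y S b hb => h x y S b hb) hS
    rwa [List.foldl_const, List.length_finRange] at this
  have := run_each (v := 30) P (fun b _ => F^[n] b) (fun x S b hb => h1 x S b hb) hS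
  rwa [List.foldl_const, List.length_finRange, ← Function.iterate_mul] at this

theorem foldl_or {α : Type*} (p : α → Prop) (L : List α) (b : Prop) :
    L.foldl (fun b x => b ∨ p x) b ↔ b ∨ ∃ x ∈ L, p x := by
  induction L generalizing b with
  | nil => simp
  | cons a L ih => simp [ih, or_assoc]

variable {G : SimpleGraph (Fin n)}

theorem run_tryLeftmost {e : ℕ → Fin n} {S : ℕ → Fin n → Fin n → Prop} {T : Fin n → Prop} {b : Prop}
    (h0 : S 0 = G.Adj) (h3 : S 3 = fun x _ => T x) (h5 : S 5 = fun _ _ => b) :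
    (tryLeftmost.run e S) 5 = (fun _ _ => b ∨ T (e 12) ∧ G.Decides T (G.forced T (e 12))) ∧
      ∀ r, r ≠ 4 → r ≠ 5 → (tryLeftmost.run e S) r = S r := by
  -- the state once the forced pairs have been computed
  let P : (ℕ → Fin n → Fin n → Prop) → (Fin n → Fin n → Prop) → Prop := fun S' R =>
    S' 4 = R ∧ ∀ r, r ≠ 4 → S' r = S r
  have h1 := run_iterate (e := e) (p := .assign 4 Fml.force) P (G.forceStep T) (by
    rintro x y S' R ⟨k1, k2⟩
    refine ⟨?_, fun r hr => ?_⟩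
    · have e0 := (k2 0 (by omega)).trans h0
      have e3 := (k2 3 (by omega)).trans h3
      funext x y
      simp [run, Fml.force, Fml.Holds, SimpleGraph.forceStep, k1, e0, e3]
    · simp [run, hr, k2 r hr]) (S := (RelProg.assign 4 Fml.forceInit).run e S)
    (b := fun x y => (T x ∧ T y) ∧ x = e 12 ∧ x ≠ y ∧ ¬ G.Adj x y) ⟨by
      funext x y
      simp [run, Fml.forceInit, Fml.Holds, h0, h3], fun r hr => by
      simp [run, hr]⟩
  obtain ⟨k1, k2⟩ := h1
  have hf : (G.forceStep T)^[n * n] (fun x y => (T x ∧ T y) ∧ x = e 12 ∧ x ≠ y ∧ ¬ G.Adj x y) =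
      G.forced T (e 12) := by
    rw [SimpleGraph.forced, Fintype.card_fin]
  rw [hf] at k1
  constructor
  · have e0 := (k2 0 (by omega)).trans h0
    have e3 := (k2 3 (by omega)).trans h3
    have e5 := (k2 5 (by omega)).trans h5
    simp only [tryLeftmost, run] at k1 e0 e3 e5 ⊢
    funext x y
    simp [Fml.decides, Fml.Holds, SimpleGraph.Decides, k1, e0, e3, e5]
  · intro r hr hr5
    have := k2 r hr
    simp only [tryLeftmost, run] at this ⊢
    simp [hr5, this]

theorem run_tryMerge {e : ℕ → Fin n} {S : ℕ → Fin n → Fin n → Prop} (h0 : S 0 = G.Adj) :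
    (tryMerge.run e S) 0 = G.Adj ∧
      (tryMerge.run e S) 1 = G.mergeStep (S 1) (e 10) (e 11) := by
  set E := S 1 with hE
  set X := G.splitClosure E (e 10) (e 11) with hX
  set T := SimpleGraph.firstIn E X with hT
  let P : (ℕ → Fin n → Fin n → Prop) → (Fin n → Prop) → Prop := fun S' X' =>
    S' 0 = G.Adj ∧ S' 1 = E ∧ S' 2 = fun x _ => X' x
  have h1 := run_iterate (e := e) (p := .assign 2 Fml.close) P (G.splitStep E) (by
    rintro x y S' R ⟨k0, k1, k2⟩
    refine ⟨by simp [run, k0], by simp [run, k1], ?_⟩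
    funext x y
    simp [run, Fml.close, Fml.Holds, SimpleGraph.splitStep, k0, k1, k2])
    (S := (RelProg.assign 2 (.or (.rel 1 0 10) (.rel 1 0 11))).run e S)
    (b := fun x => E x (e 10) ∨ E x (e 11)) ⟨by simp [run, h0], by simp [run, hE], by
      funext x y
      simp [run, Fml.Holds, hE]⟩
  have hf : (G.splitStep E)^[n * n] (fun x => E x (e 10) ∨ E x (e 11)) = X := by
    rw [hX, SimpleGraph.splitClosure, Fintype.card_fin]
  rw [hf] at h1
  set S₁ := (iterate (.assign 2 Fml.close)).run e
    ((RelProg.assign 2 (.or (.rel 1 0 10) (.rel 1 0 11))).run e S) with hS₁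
  obtain ⟨k0, k1, k2⟩ := h1
  let Q : (ℕ → Fin n → Fin n → Prop) → Prop → Prop := fun S' b =>
    S' 0 = G.Adj ∧ S' 1 = E ∧ (S' 2 = fun x _ => X x) ∧ (S' 3 = fun x _ => T x) ∧
      S' 5 = fun _ _ => b
  have h2 := run_each (e := e) (v := 12) (p := tryLeftmost) Q
    (fun b a => b ∨ T a ∧ G.Decides T (G.forced T a)) (by
      rintro a S' b ⟨q0, q1, q2, q3, q5⟩
      obtain ⟨r5, r⟩ := run_tryLeftmost (e := Function.update e 12 a) q0 q3 q5
      rw [Function.update_self] at r5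
      exact ⟨(r 0 (by omega) (by omega)).trans q0, (r 1 (by omega) (by omega)).trans q1,
        (r 2 (by omega) (by omega)).trans q2, (r 3 (by omega) (by omega)).trans q3, r5⟩)
    (S := (RelProg.assign 5 (.not (.le 0 0))).run e ((RelProg.assign 3 Fml.first).run e S₁))
    (b := False) ⟨by simp [run, k0], by simp [run, k1], by simp [run, k2], by
      funext x y
      simp [run, Fml.first, Fml.Holds, hT, SimpleGraph.firstIn, k1, k2], by
      funext x y
      simp [run, Fml.Holds]⟩
  have hb : ((List.finRange n).foldl (fun b a => b ∨ T a ∧ G.Decides T (G.forced T a)) False) =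
      ∃ a, T a ∧ G.Decides T (G.forced T a) := by
    apply propext
    rw [foldl_or]
    simp
  rw [hb] at h2
  obtain ⟨q0, q1, q2, q3, q5⟩ := h2
  have hrun : tryMerge.run e S = (RelProg.assign 1 Fml.merge).run e ((each 12 tryLeftmost).run e
      ((RelProg.assign 5 (.not (.le 0 0))).run e ((RelProg.assign 3 Fml.first).run e S₁))) := rfl
  rw [hrun]
  set S₂ := (each 12 tryLeftmost).run e
      ((RelProg.assign 5 (.not (.le 0 0))).run e ((RelProg.assign 3 Fml.first).run e S₁))
  refine ⟨by simp [run, q0], ?_⟩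
  funext x y
  simp [run, Fml.merge, Fml.noC4, Fml.Holds, SimpleGraph.mergeStep, SimpleGraph.HasNoC4, q0, q1, q2,
    q5, ← hX, ← hT]

/-- The relational program computes the final partition and its representatives. -/
theorem run_solve {e : ℕ → Fin n} {S : ℕ → Fin n → Fin n → Prop} (h0 : S 0 = G.Adj) :
    (solve.run e S) 0 = G.Adj ∧ ((solve.run e S) 6 = fun x _ => G.IsRep G.finalRel x) ∧
      ((solve.run e S) 7 = fun x _ => ¬ ∃ z, G.finalRel z x ∧ ¬ x ≤ z) := by
  let P : (ℕ → Fin n → Fin n → Prop) → (Fin n → Fin n → Prop) → Prop := fun S' E =>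
    S' 0 = G.Adj ∧ S' 1 = E
  have h1 := run_iterate (e := e) (p := .each 10 (.each 11 tryMerge)) P G.mergePass (by
    intro x y S' E hS'
    refine run_each P _ (fun u S'' E' h' => ?_) hS'
    refine run_each P _ (fun v S'' E' h' => ?_) h'
    obtain ⟨r0, r1⟩ := run_tryMerge (e := Function.update (Function.update
      (Function.update (Function.update e 30 x) 31 y) 10 u) 11 v) h'.1
    refine ⟨r0, r1.trans ?_⟩
    rw [h'.2, Function.update_self, Function.update_of_ne (by omega), Function.update_self])
    (S := (RelProg.assign 1 (.eq 0 1)).run e S) (b := fun x y => x = y) ⟨by simp [run, h0], by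
      funext x y
      simp [run]⟩
  obtain ⟨k0, k1⟩ := h1
  rw [← SimpleGraph.finalRel] at k1
  set S₁ := (iterate (.each 10 (.each 11 tryMerge))).run e ((RelProg.assign 1 (.eq 0 1)).run e S)
  have hrun : solve.run e S = (RelProg.assign 7 (.not (.ex 2 (.and (.rel 1 2 0)
      (.not (.le 0 2)))))).run e ((RelProg.assign 6 Fml.rep).run e
      ((RelProg.assign 9 Fml.firstRep).run e ((RelProg.assign 8 Fml.nonNeighbor).run e S₁))) := rfl
  rw [hrun]
  have e8 : ((RelProg.assign 8 Fml.nonNeighbor).run e S₁) 8 =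
      fun x _ => G.HasNonNeighbor G.finalRel x := by
    funext x y
    simp [run, Fml.nonNeighbor, Fml.Holds, SimpleGraph.HasNonNeighbor, k0, k1]
  have e0 : ((RelProg.assign 8 Fml.nonNeighbor).run e S₁) 0 = G.Adj := by simp [run, k0]
  have e1 : ((RelProg.assign 8 Fml.nonNeighbor).run e S₁) 1 = G.finalRel := by simp [run, k1]
  set S₂ := (RelProg.assign 8 Fml.nonNeighbor).run e S₁
  have f9 : ((RelProg.assign 9 Fml.firstRep).run e S₂) 9 =
      fun x _ => G.IsFirstRep G.finalRel x := by
    funext x y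
    simp [run, Fml.firstRep, Fml.Holds, SimpleGraph.IsFirstRep, e8, e1]
  have f0 : ((RelProg.assign 9 Fml.firstRep).run e S₂) 0 = G.Adj := by simp [run, e0]
  have f1 : ((RelProg.assign 9 Fml.firstRep).run e S₂) 1 = G.finalRel := by simp [run, e1]
  set S₃ := (RelProg.assign 9 Fml.firstRep).run e S₂
  refine ⟨by simp [run, f0], ?_, ?_⟩
  · funext x y
    simp [run, Fml.rep, Fml.Holds, SimpleGraph.IsRep, f0, f1, f9]
  · funext x y
    simp [run, Fml.Holds, f1]

end RelProg

/-! ### The kernel -/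

theorem Nat.exists_count_eq {p : ℕ → Prop} [DecidablePred p] {n i : ℕ} (h : i < Nat.count p n) :
    ∃ x, x < n ∧ p x ∧ Nat.count p x = i := by
  induction n with
  | zero => simp at h
  | succ n ih =>
    by_cases hi : i < Nat.count p n
    · obtain ⟨x, hx, hp⟩ := ih hi
      exact ⟨x, hx.trans (Nat.lt_succ_self n), hp⟩
    · rw [Nat.count_succ] at h
      split_ifs at h with hp
      · exact ⟨n, Nat.lt_succ_self n, hp, by omega⟩
      · omega

open Classical in
/-- The number of elements below `i` that satisfy `p`. -/
noncomputable def countBelow {n : ℕ} (p : Fin n → Prop) (i : ℕ) : ℕ :=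
  Nat.count (fun x => ∃ h : x < n, p ⟨x, h⟩) i

section CountBelow

variable {n : ℕ} {p : Fin n → Prop}

open Classical in
theorem countBelow_succ {i : ℕ} (hi : i < n) :
    countBelow p (i + 1) = countBelow p i + if p ⟨i, hi⟩ then 1 else 0 := by
  rw [countBelow, Nat.count_succ, countBelow]
  congr 1
  simp [hi]

open Classical in
theorem countBelow_le (i : ℕ) : countBelow p i ≤ i := Nat.count_le _

open Classical in
theorem countBelow_mono {i j : ℕ} (h : i ≤ j) : countBelow p i ≤ countBelow p j :=
  Nat.count_monotone _ h

theorem countBelow_lt {x : Fin n} (hx : p x) {j : ℕ} (h : (x : ℕ) < j) :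
    countBelow p x < countBelow p j := by
  have := countBelow_mono (p := p) (Nat.succ_le_of_lt h)
  rw [Nat.succ_eq_add_one, countBelow_succ x.2, if_pos hx] at this
  omega

theorem countBelow_inj {x y : Fin n} (hx : p x) (hy : p y)
    (h : countBelow p x = countBelow p y) : x = y := by
  rcases lt_trichotomy (x : ℕ) y with hlt | heq | hlt
  · exact absurd h (countBelow_lt hx hlt).ne
  · exact Fin.ext heq
  · exact absurd h.symm (countBelow_lt hy hlt).ne

open Classical in
theorem countBelow_eq_card : countBelow p n = (Finset.univ.filter p).card := by
  rw [countBelow, Nat.count_eq_card_filter_range, ← Finset.card_map Fin.valEmbedding]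
  congr 1
  ext x
  simp only [Finset.mem_filter, Finset.mem_range, Finset.mem_map, Finset.mem_univ, true_and,
    Fin.valEmbedding_apply]
  constructor
  · rintro ⟨_, h, hp⟩
    exact ⟨_, hp, rfl⟩
  · rintro ⟨a, ha, rfl⟩
    exact ⟨a.2, a.2, ha⟩

open Classical in
/-- The elements that satisfy `p`, in increasing order. -/
noncomputable def nthElement (p : Fin n → Prop) (i : Fin (countBelow p n)) : Fin n :=
  ⟨_, (Nat.exists_count_eq i.2).choose_spec.1⟩

open Classical in
theorem nthElement_spec (i : Fin (countBelow p n)) :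
    p (nthElement p i) ∧ countBelow p (nthElement p i) = i := by
  obtain ⟨h1, ⟨_, h2⟩, h3⟩ := (Nat.exists_count_eq i.2).choose_spec
  exact ⟨h2, h3⟩

theorem nthElement_injective : Function.Injective (nthElement p) := fun i j h => Fin.ext (by
  rw [← (nthElement_spec i).2, h, (nthElement_spec j).2])

theorem exists_nthElement_eq (x : Fin n) : p x ↔ ∃ i, nthElement p i = x := by
  constructor
  · intro hx
    refine ⟨⟨countBelow p x, countBelow_lt hx x.2⟩, ?_⟩
    exact countBelow_inj (nthElement_spec _).1 hx (nthElement_spec _).2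
  · rintro ⟨i, rfl⟩
    exact (nthElement_spec i).1

end CountBelow

namespace SimpleGraph

variable {n : ℕ} (G : SimpleGraph (Fin n))

/-- The subgraph induced by the representatives, numbered in increasing order. -/
noncomputable def kernelGraph : SimpleGraph (Fin (countBelow (G.IsRep G.finalRel) n)) :=
  G.comap (nthElement (G.IsRep G.finalRel))

/-- The number of classes of the final partition, counted by their first elements. -/
noncomputable def partCount : ℕ :=
  countBelow (fun x => ¬ ∃ z, G.finalRel z x ∧ ¬ x ≤ z) n

/-- The kernel as a subgraph. -/
noncomputable def kernelEmbedding : G.kernelGraph ↪g G :=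
  Embedding.comap ⟨_, nthElement_injective⟩ G

theorem isContraction_kernelEmbedding : IsContraction G.finalRel G.kernelEmbedding :=
  isContraction_of_range isIntervalModularRel_finalRel.1 _ fun x => exists_nthElement_eq x

theorem partCount_eq : G.partCount = G.intervalModularCardinality := by
  classical
  have hE := (isIntervalModularRel_finalRel (G := G)).1
  rw [← isUnmergeable_finalRel.card_image_eq isIntervalModularRel_finalRel.2, partCount,
    countBelow_eq_card]
  rw [← Finset.card_image_of_injOn (f := G.finalRel)]
  · congr 1
    ext i
    simp only [Finset.mem_image, Finset.mem_filter, Finset.mem_univ, true_and]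
    constructor
    · rintro ⟨x, -, h⟩
      exact ⟨x, h⟩
    · rintro ⟨v, rfl⟩
      obtain ⟨x, hx, hmin⟩ := exists_first hE v
      refine ⟨x, ?_, hE.apply_eq_iff.2 hx⟩
      rintro ⟨z, hz, hxz⟩
      exact hxz (hmin z (hE.trans hz hx))
  · intro x hx y hy hxy
    simp only [Finset.coe_filter, Finset.mem_univ, true_and, Set.mem_ofPred_eq] at hx hy
    rw [hE.apply_eq_iff] at hxy
    exact le_antisymm (by_contra fun h => hx ⟨y, hE.symm hxy, h⟩)
      (by_contra fun h => hy ⟨x, hxy, h⟩)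

/-- The final partition is optimal, and the kernel is the graph contracted along it. -/
theorem exists_optimal_iso : ∃ P : Finpartition (Finset.univ : Finset (Fin n)),
    G.IsOptimalIntervalModularPartition P ∧ Nonempty (G.kernelGraph ≃g G.contractPartition P) := by
  classical
  obtain ⟨P, hP, hk⟩ := (isIntervalModularRel_finalRel (G := G)).2.exists_finpartition
  refine ⟨P, ⟨hP, ?_⟩, ?_⟩
  · rw [← isUnmergeable_finalRel.card_image_eq isIntervalModularRel_finalRel.2, ← P.image_part]
    exact Finset.card_image_eq_of_ker_eq hk
  · have h := G.isContraction_kernelEmbedding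
    have hf : IsContraction P.part G.kernelEmbedding := by
      refine ⟨fun v => ?_, fun s t => ?_, fun v w => ?_, fun s t u => ?_⟩
      · simpa only [hk] using h.exists_mem v
      · simpa only [hk] using h.not_adj s t
      · simpa only [hk] using h.exists_pair v w
      · simpa only [hk] using h.le_two s t u
    exact hf.nonempty_iso hP

theorem kernelGraph_card_le :
    countBelow (G.IsRep G.finalRel) n ≤ 2 * G.intervalModularCardinality := by
  obtain ⟨P, hP, ⟨e⟩⟩ := G.exists_optimal_iso
  have h := card_contractVertex_le G P
  rw [hP.2] at h
  rwa [← Nat.card_congr e.toEquiv, Nat.card_eq_fintype_card, Fintype.card_fin] at h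

end SimpleGraph

/-- The kernelization.  If the parameter is not the interval-modular cardinality, the result is the
empty graph with parameter one, which is a negative instance. -/
noncomputable def kernelMap (y : ThinInstance × ℕ) : ThinInstance × ℕ :=
  if y.1.graph.partCount = y.2 then (⟨_, y.1.graph.kernelGraph, min y.1.t (2 * y.2)⟩, y.2)
  else (⟨0, ⊥, 0⟩, 1)

namespace RamProg

/-- Set up the constant one and the row offsets. -/
def initProg : RamProg :=
  .seq (.const 4 1) (.seq (forProg 0 0 (.seq (.write 1 (rv 0) 7) (.add 7 7 0))) (.const 7 0))

/-- Add the number of vertices (variable `0`) that satisfy `φ` to register `c`. -/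
def countProg (c : ℕ) (φ : Fml) : RamProg :=
  forProg 0 0 (.seq (φ.compile 2) (.cond (rt 2) (.add c c 4) .skip))

/-- Write the adjacency matrix of the representatives to array `5`.  Register `7` holds the next
position: as the pairs of vertices are visited in lexicographic order, the entries for pairs of
representatives are appended row by row. -/
def matrixProg : RamProg :=
  forProg 0 0 (forProg 2 1 (.seq ((Fml.and (.rel 6 0 0) (.rel 6 1 1)).compile 4)
    (.cond (rt 4) (.seq ((Fml.rel 0 0 1).compile 4) (.seq (.write 5 7 (rt 4)) (.add 7 7 4)))
      .skip)))

/-- Output the kernel.  With truncated subtraction, `t - (t - 2 * k)` is `min t (2 * k)`. -/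
def acceptProg : RamProg :=
  .seq matrixProg <| .seq (copyProg 0 5 0) <| .seq (.add (rt 0) 2 2) <|
    .seq (.sub (rt 0) 1 (rt 0)) <| .seq (.sub 1 1 (rt 0)) (.add 0 6 3)

/-- Output the empty graph with parameter one. -/
def rejectProg : RamProg :=
  .seq (.const 0 0) (.seq (.const 1 0) (.const 2 1))

/-- The machine program of `kernelMap`.  Register `5` counts the classes and register `6` the
representatives; the sum of the two truncated differences of register `5` and the parameter vanishes
if and only if they are equal. -/
def kernelProg : RamProg :=
  .cond 0 (.seq initProg <| .seq (RelProg.solve.compile 0) <| .seq (countProg 5 (.rel 7 0 0)) <|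
      .seq (countProg 6 (.rel 6 0 0)) <| .seq (.sub (rt 0) 5 2) <| .seq (.sub (rt 1) 2 5) <|
      .seq (.add (rt 0) (rt 0) (rt 1)) <| .cond (rt 0) rejectProg acceptProg)
    (.seq (.const 1 0) (.cond 2 (.const 2 1) .skip))

theorem runs_initProg (y : ThinInstance × ℕ) (h : 0 < y.1.n) :
    Runs initProg (ramInput y) (y.1.n * (2 + 3) + 7) fun s =>
      Stores (fun r i j => r = 0 ∧ y.1.graph.Adj i j) s ∧ StoresVars (fun _ => ⟨0, h⟩) s ∧
        s.reg 1 = y.1.t ∧ s.reg 2 = y.2 ∧ s.reg 5 = 0 ∧ s.reg 6 = 0 ∧ s.reg 7 = 0 := by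
  set n := y.1.n with hn
  set s := ramInput y with hs
  refine (Runs.seq (T₁ := 1) (T₂ := (n * (2 + 3) + 5) + 1) (Runs.const ?_)).mono (by omega)
    fun _ h => h
  set s₁ := s.setReg 4 1 with hs₁
  let C : ℕ → RamState → Prop := fun i s' =>
    (∀ x, (∀ j, x ≠ rt j) → x ≠ rv 0 → x ≠ 7 → s'.reg x = s₁.reg x) ∧ s'.reg 7 = i * n ∧
    (∀ a, a ≠ 1 → s'.arr a = s.arr a) ∧ ∀ x, x < i → s'.arr 1 x = x * n
  have e4 : ∀ c, c ≠ 4 → s₁.reg c = s.reg c := fun c hc => RamState.reg_setReg_of_ne hc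
  have s3 : ∀ c, c ≠ 0 → c ≠ 1 → c ≠ 2 → s.reg c = 0 := by
    intro c h0 h1 h2
    simp [hs, ramInput, h0, h1, h2]
  refine Runs.seq ((runs_forProg (n := n) (T := 2) C ?_ ?_ ?_ ?_ ?_ ?_).mono le_rfl ?_)
  · rintro i t t' h1 h2 ⟨c1, c2, c3, c4⟩
    rw [← h1] at c3 c4
    exact ⟨fun x k1 k2 k3 => (h2 x (fun j _ => k1 j) k2).trans (c1 x k1 k2 k3),
      (h2.low (by omega)).trans c2, c3, c4⟩
  · rw [e4 0 (by omega)]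
    simp [hs, ramInput, hn]
  · rw [e4 3 (by omega), s3 3 (by omega) (by omega) (by omega)]
  · exact RamState.reg_setReg_self _ _ _
  · refine ⟨fun _ _ _ _ => rfl, ?_, fun _ _ => rfl, fun x hx => absurd hx (by omega)⟩
    rw [e4 7 (by omega), s3 7 (by omega) (by omega) (by omega)]
    simp
  · rintro i hi t ⟨c1, c2, c3, c4⟩ k1 k2 k3 k4
    refine Runs.seq (T₁ := 1) (T₂ := 1) (Runs.write (Runs.add ?_))
    have hr : ∀ c, c ≠ 7 → ((t.setArr 1 (t.reg (rv 0)) (t.reg 7)).setReg 7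
        ((t.setArr 1 (t.reg (rv 0)) (t.reg 7)).reg 7 +
          (t.setArr 1 (t.reg (rv 0)) (t.reg 7)).reg 0)).reg c = t.reg c := fun c hc =>
      RamState.reg_setReg_of_ne hc
    refine ⟨?_, ?_, ?_, ?_, ?_, ?_, ?_, ?_, ?_⟩
    · rw [hr 0 (by omega), k2]
    · rw [hr 3 (by omega), k3]
    · rw [hr 4 (by omega), k4]
    · rw [hr _ (ne_rv (by omega) 0).symm, k1]
    · rw [hr _ (ne_rt (by omega) 0).symm]
    · intro x h1 h2 h3
      rw [hr x h3, c1 x h1 h2 h3]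
    · rw [RamState.reg_setReg_self, RamState.reg_setArr, c2, k2]
      ring
    · intro a ha
      funext m
      rw [RamState.arr_setReg, RamState.arr_setArr_of_ne (Or.inl ha), c3 a ha]
    · intro x hx
      rw [RamState.arr_setReg, k1, c2]
      by_cases hxi : x = i
      · rw [hxi, RamState.arr_setArr_self]
      · rw [RamState.arr_setArr_of_ne (Or.inr hxi)]
        exact c4 x (by omega)
  · rintro t ⟨⟨c1, c2, c3, c4⟩, c5⟩
    refine Runs.const ?_
    have hlow : ∀ c, c < 10 → c ≠ 7 → (t.setReg 7 0).reg c = s₁.reg c := by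
      intro c hc h7
      rw [RamState.reg_setReg_of_ne h7]
      exact c1 c (fun j => ne_rt hc j) (ne_rv hc 0) h7
    have hlow' : ∀ c, 2 < c → c < 10 → c ≠ 4 → c ≠ 7 → (t.setReg 7 0).reg c = 0 := by
      intro c h2 hc h4 h7
      rw [hlow c hc h7, e4 c h4, s3 c (by omega) (by omega) (by omega)]
    refine ⟨⟨?_, ?_, ?_, ?_, ?_⟩, fun v => ?_, ?_, ?_, ?_, ?_, ?_⟩
    · rw [hlow 0 (by omega) (by omega), e4 0 (by omega)]
      simp [hs, ramInput]
    · exact hlow' 3 (by omega) (by omega) (by omega) (by omega)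
    · rw [hlow 4 (by omega) (by omega)]
      exact RamState.reg_setReg_self _ _ _
    · exact fun i => c4 i i.2
    · intro r i j
      rw [RamState.arr_setReg, c3 (2 * r) (by omega)]
      by_cases hr : r = 0
      · subst hr
        simp only [hs, ramInput, mul_zero]
        split_ifs with h1 h2 h2
        · rfl
        · obtain ⟨-, i', j', h3, h4⟩ := h1
          obtain ⟨rfl, rfl⟩ := Fin.mul_add_inj h3
          exact absurd ⟨rfl, h4⟩ h2
        · exact absurd ⟨rfl, i, j, rfl, h2.2⟩ h1
        · rfl
      · simp [hs, ramInput, hr]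
    · have hv : rv v ≠ 7 := (ne_rv (by omega) v).symm
      have : s₁.reg (rv v) = 0 := by
        rw [e4 _ (ne_rv (by omega) v).symm]
        exact s3 _ (ne_rv (by omega) v).symm (ne_rv (by omega) v).symm (ne_rv (by omega) v).symm
      rw [RamState.reg_setReg_of_ne hv]
      by_cases hv0 : v = 0
      · rw [hv0] at this ⊢
        rw [c5, this]
      · rw [c1 _ (fun j => rv_ne_rt v j) (by rwa [Ne, rv_inj]) hv, this]
    · rw [hlow 1 (by omega) (by omega), e4 1 (by omega)]
      simp [hs, ramInput]
    · rw [hlow 2 (by omega) (by omega), e4 2 (by omega)]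
      simp [hs, ramInput]
    · exact hlow' 5 (by omega) (by omega) (by omega) (by omega)
    · exact hlow' 6 (by omega) (by omega) (by omega) (by omega)
    · exact RamState.reg_setReg_self _ _ _

theorem runs_countProg {c : ℕ} (hc : 4 < c) (hc' : c < 10) (φ : Fml) :
    ∃ q : Polynomial ℕ, ∀ (n : ℕ) (S : ℕ → Fin n → Fin n → Prop) (e : ℕ → Fin n) (s : RamState),
      Stores S s → StoresVars e s → Runs (countProg c φ) s (q.eval n) fun s' =>
        Stores S s' ∧ StoresVars e s' ∧ (∀ x, x < 10 → x ≠ c → s'.reg x = s.reg x) ∧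
        s'.reg c = s.reg c + countBelow (fun x => φ.Holds S (Function.update e 0 x)) n := by
  classical
  obtain ⟨q, hq⟩ := φ.runs_compile
  refine ⟨Polynomial.X * (q + 2 + 3) + 5, fun n S e s hS he => ?_⟩
  set p : Fin n → Prop := fun x => φ.Holds S (Function.update e 0 x) with hp
  let C : ℕ → RamState → Prop := fun i s' =>
    s'.arr = s.arr ∧ (∀ x, (∀ j, x ≠ rt j) → x ≠ rv 0 → x ≠ c → s'.reg x = s.reg x) ∧
      s'.reg c = s.reg c + countBelow p i
  have hst : ∀ s' : RamState, s'.arr = s.arr → (∀ x, x < 10 → x ≠ c → s'.reg x = s.reg x) →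
      Stores S s' := by
    intro s' h1 h2
    refine ⟨?_, ?_, ?_, ?_, ?_⟩
    · rw [h2 0 (by omega) (by omega), hS.size]
    · rw [h2 3 (by omega) (by omega), hS.zero]
    · rw [h2 4 (by omega) (by omega), hS.one]
    · rw [h1]
      exact hS.offset
    · rw [h1]
      exact hS.rel
  refine (runs_forProg (n := n) (T := q.eval n + 2) C ?_ hS.size hS.zero hS.one ?_ ?_).mono
    (by simp) ?_
  · rintro i t t' h1 h2 ⟨c1, c2, c3⟩
    exact ⟨h1.trans c1, fun x k1 k2 k3 => (h2 x (fun j _ => k1 j) k2).trans (c2 x k1 k2 k3),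
      (h2.low hc').trans c3⟩
  · exact ⟨rfl, fun _ _ _ _ => rfl, by simp [countBelow]⟩
  · rintro i hi t ⟨c1, c2, c3⟩ k1 k2 k3 k4
    have he' : StoresVars (Function.update e 0 ⟨i, hi⟩) t := by
      intro v
      by_cases hv : v = 0
      · rw [hv, Function.update_self, k1]
      · rw [Function.update_of_ne hv, c2 _ (fun j => rv_ne_rt v j) (by rwa [Ne, rv_inj])
          (ne_rv hc' v).symm, he v]
    refine Runs.seq (T₁ := q.eval n) (T₂ := 1 + 1) ((hq n 2 S _ t (hst t c1 fun x hx =>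
      c2 x (fun j => ne_rt hx j) (ne_rv hx 0)) he').mono le_rfl ?_)
    rintro t' ⟨b1, b2, b3⟩
    refine Runs.cond (fun hcond => ?_) fun hcond => ?_
    · have hpi : p ⟨i, hi⟩ := by
        by_contra h
        simp [b3, hp] at hcond h
        exact h hcond
      have hr : ∀ x, x ≠ c → (t'.setReg c (t'.reg c + t'.reg 4)).reg x = t'.reg x := fun x hx =>
        RamState.reg_setReg_of_ne hx
      refine Runs.add ⟨?_, ?_, ?_, ?_, ?_, ?_, ?_, ?_⟩
      · rw [hr 0 (by omega), b2.low (by omega), k2]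
      · rw [hr 3 (by omega), b2.low (by omega), k3]
      · rw [hr 4 (by omega), b2.low (by omega), k4]
      · rw [hr _ (ne_rv hc' 0).symm, b2.rv, k1]
      · rw [hr _ (ne_rt hc' 0).symm, b2.rt (by omega)]
      · exact b1.trans c1
      · intro x h1 h2 h3
        rw [hr x h3, b2 x (fun j _ => h1 j), c2 x h1 h2 h3]
      · rw [RamState.reg_setReg_self, b2.low hc', c3, b2.low (by omega), k4, countBelow_succ hi,
          if_pos hpi, add_assoc]
    · have hpi : ¬ p ⟨i, hi⟩ := by
        intro h
        simp only [hp] at h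
        simp [b3, h] at hcond
      refine Runs.skip ⟨?_, ?_, ?_, ?_, ?_, ?_, ?_, ?_⟩
      · rw [b2.low (by omega), k2]
      · rw [b2.low (by omega), k3]
      · rw [b2.low (by omega), k4]
      · rw [b2.rv, k1]
      · rw [b2.rt (by omega)]
      · exact b1.trans c1
      · intro x h1 h2 h3
        rw [b2 x (fun j _ => h1 j), c2 x h1 h2 h3]
      · rw [b2.low hc', c3, countBelow_succ hi, if_neg hpi, add_zero]
  · rintro t ⟨⟨c1, c2, c3⟩, c4⟩
    have hlow : ∀ x, x < 10 → x ≠ c → t.reg x = s.reg x := fun x hx =>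
      c2 x (fun j => ne_rt hx j) (ne_rv hx 0)
    refine ⟨hst t c1 hlow, fun v => ?_, hlow, c3⟩
    by_cases hv : v = 0
    · rw [hv, c4, he 0]
    · rw [c2 _ (fun j => rv_ne_rt v j) (by rwa [Ne, rv_inj]) (ne_rv hc' v).symm, he v]

open Classical in
/-- Entries for pairs of elements that satisfy `p` are written in the places that they have in the
adjacency matrix of the subgraph induced by these elements. -/
theorem runs_matrixProg : ∃ q : Polynomial ℕ, ∀ (n : ℕ) (S : ℕ → Fin n → Fin n → Prop)
    (e : ℕ → Fin n) (s : RamState) (p : Fin n → Prop), Stores S s → StoresVars e s →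
    s.reg 7 = 0 → (∀ x, S 6 x x ↔ p x) → Runs matrixProg s (q.eval n) fun s' =>
      (∀ a, a ≠ 5 → s'.arr a = s.arr a) ∧ (∀ x, x < 10 → x ≠ 7 → s'.reg x = s.reg x) ∧
      ∀ x y, p x → p y → s'.arr 5 (countBelow p x * countBelow p n + countBelow p y) =
        if S 0 x y then 1 else 0 := by
  obtain ⟨q, hq⟩ := (Fml.and (.rel 6 0 0) (.rel 6 1 1)).runs_compile
  obtain ⟨q', hq'⟩ := (Fml.rel 0 0 1).runs_compile
  refine ⟨Polynomial.X * ((Polynomial.X * ((q + (q' + 2 + 1)) + 3) + 5) + 3) + 5,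
    fun n S e s p hS he h7 hp => ?_⟩
  set m := countBelow p n with hm
  -- the invariant: all pairs before `(i, j)` in lexicographic order have been written
  let K : ℕ → ℕ → RamState → Prop := fun i j s' => (∀ a, a ≠ 5 → s'.arr a = s.arr a) ∧
    s'.reg 7 = countBelow p i * m + (if ∃ h : i < n, p ⟨i, h⟩ then countBelow p j else 0) ∧
    ∀ x y : Fin n, p x → p y → ((x : ℕ) < i ∨ (x : ℕ) = i ∧ (y : ℕ) < j) →
      s'.arr 5 (countBelow p x * m + countBelow p y) = if S 0 x y then 1 else 0
  let C : ℕ → RamState → Prop := fun i s' =>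
    (∀ x, (∀ j, x ≠ rt j) → x ≠ rv 0 → x ≠ 7 → s'.reg x = s.reg x) ∧ K i 0 s'
  refine (runs_forProg (n := n) (T := n * ((q.eval n + (q'.eval n + 2 + 1)) + 3) + 5) C ?_ hS.size
    hS.zero hS.one ?_ ?_).mono (by simp) ?_
  · rintro i t t' h1 h2 ⟨c1, c2, c3, c4⟩
    rw [← h1] at c2 c4
    exact ⟨fun x k1 k2 k3 => (h2 x (fun j _ => k1 j) k2).trans (c1 x k1 k2 k3), c2,
      (h2.low (by omega)).trans c3, c4⟩
  · refine ⟨fun _ _ _ _ => rfl, fun _ _ => rfl, ?_, fun x y _ _ h => absurd h (by omega)⟩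
    rw [h7]
    simp [countBelow]
  · rintro i hi t ⟨c1, cK⟩ k1 k2 k3 k4
    let D : ℕ → RamState → Prop := fun j s' =>
      (∀ x, (∀ j, 2 ≤ j → x ≠ rt j) → x ≠ rv 1 → x ≠ 7 → s'.reg x = t.reg x) ∧ K i j s'
    refine (runs_forProg (n := n) (T := q.eval n + (q'.eval n + 2 + 1)) D ?_ k2 k3 k4 ?_ ?_).mono
      le_rfl ?_
    · rintro j u u' h1 h2 ⟨d1, d2, d3, d4⟩
      rw [← h1] at d2 d4
      exact ⟨fun x k1 k2 k3 => (h2 x k1 k2).trans (d1 x k1 k2 k3), d2,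
        (h2.low (by omega)).trans d3, d4⟩
    · exact ⟨fun _ _ _ _ => rfl, cK⟩
    · rintro j hj u ⟨d1, d2, d3, d4⟩ l1 l2 l3 l4
      have hu0 : u.reg (rv 0) = i :=
        (d1 _ (fun j _ => rv_ne_rt 0 j) (by rw [Ne, rv_inj]; omega)
          (ne_rv (by omega) 0).symm).trans k1
      have hSu : Stores S u := ⟨l2, l3, l4, by rw [d2 1 (by omega)]; exact hS.offset, fun r => by
        rw [d2 (2 * r) (by omega)]; exact hS.rel r⟩
      have heu : StoresVars (Function.update (Function.update e 0 ⟨i, hi⟩) 1 ⟨j, hj⟩) u := by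
        intro v
        by_cases hv1 : v = 1
        · rw [hv1, Function.update_self, l1]
        rw [Function.update_of_ne hv1]
        by_cases hv0 : v = 0
        · rw [hv0, Function.update_self, hu0]
        · rw [Function.update_of_ne hv0, d1 _ (fun j _ => rv_ne_rt v j) (by rwa [Ne, rv_inj])
            (ne_rv (by omega) v).symm, c1 _ (fun j => rv_ne_rt v j) (by rwa [Ne, rv_inj])
            (ne_rv (by omega) v).symm, he v]
      refine Runs.seq ((hq n 4 S _ u hSu heu).mono le_rfl ?_)
      rintro u' ⟨b1, b2, b3⟩
      have hval : (Fml.and (.rel 6 0 0) (.rel 6 1 1)).Holds S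
          (Function.update (Function.update e 0 ⟨i, hi⟩) 1 ⟨j, hj⟩) ↔
          p ⟨i, hi⟩ ∧ p ⟨j, hj⟩ := by
        simp [Fml.Holds, hp]
      rw [if_congr hval rfl rfl] at b3
      refine Runs.cond (T := q'.eval n + 2) (fun hcond => ?_) fun hcond => ?_
      · obtain ⟨hpi, hpj⟩ : p ⟨i, hi⟩ ∧ p ⟨j, hj⟩ := by
          by_contra h
          simp [b3, h] at hcond
        refine Runs.seq (T₂ := 1 + 1) ((hq' n 4 S _ u' (hSu.of_same b1 (b2.sameBut 0))
          (heu.of_same b2)).mono le_rfl ?_)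
        rintro w ⟨f1, f2, f3⟩
        have hw : Same 4 u w := b2.trans f2
        have hval' : w.reg (rt 4) = if S 0 ⟨i, hi⟩ ⟨j, hj⟩ then 1 else 0 := by
          rw [f3]
          simp [Fml.Holds]
        have hw7 : w.reg 7 = countBelow p i * m + countBelow p j := by
          rw [hw.low (by omega), d3, if_pos ⟨hi, hpi⟩]
        refine Runs.seq (T₁ := 1) (T₂ := 1) (Runs.write (Runs.add ?_))
        set w' := w.setArr 5 (w.reg 7) (w.reg (rt 4)) with hw'
        have hr : ∀ x, x ≠ 7 → (w'.setReg 7 (w'.reg 7 + w'.reg 4)).reg x = w.reg x := fun x hx =>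
          RamState.reg_setReg_of_ne hx
        refine ⟨?_, ?_, ?_, ?_, ?_, ?_, ?_, ?_, ?_⟩
        · rw [hr 0 (by omega), hw.low (by omega), l2]
        · rw [hr 3 (by omega), hw.low (by omega), l3]
        · rw [hr 4 (by omega), hw.low (by omega), l4]
        · rw [hr _ (ne_rv (by omega) 1).symm, hw.rv, l1]
        · rw [hr _ (ne_rt (by omega) 2).symm, hw.rt (by omega)]
        · intro x h1 h2 h3
          rw [hr x h3, hw x (fun j hj => h1 j (by omega)), d1 x h1 h2 h3]
        · intro a ha
          funext z
          rw [RamState.arr_setReg, hw', RamState.arr_setArr_of_ne (Or.inl ha), f1, b1, d2 a ha]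
        · rw [RamState.reg_setReg_self, hw', RamState.reg_setArr, hw7, hw.low (by omega), l4,
            if_pos ⟨hi, hpi⟩, countBelow_succ hj, if_pos hpj, add_assoc]
        · intro x y hx hy hxy
          rw [RamState.arr_setReg, hw', hw7]
          by_cases hxy' : (x : ℕ) = i ∧ (y : ℕ) = j
          · obtain ⟨rfl, rfl⟩ := hxy'
            rw [RamState.arr_setArr_self, hval']
          · rw [RamState.arr_setArr_of_ne, f1, b1]
            · exact d4 x y hx hy (by omega)
            · refine Or.inr fun h => hxy' ?_
              obtain ⟨e1, e2⟩ := Fin.mul_add_inj (n := m)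
                (i := ⟨countBelow p x, countBelow_lt hx x.2⟩)
                (j := ⟨countBelow p y, countBelow_lt hy y.2⟩)
                (i' := ⟨countBelow p i, countBelow_lt (x := ⟨i, hi⟩) hpi hi⟩)
                (j' := ⟨countBelow p j, countBelow_lt (x := ⟨j, hj⟩) hpj hj⟩) h
              exact ⟨congrArg Fin.val (countBelow_inj (y := ⟨i, hi⟩) hx hpi (congrArg Fin.val e1)),
                congrArg Fin.val (countBelow_inj (y := ⟨j, hj⟩) hy hpj (congrArg Fin.val e2))⟩
      · have hnp : ¬ (p ⟨i, hi⟩ ∧ p ⟨j, hj⟩) := by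
          intro h
          simp [b3, h] at hcond
        refine (Runs.skip ⟨?_, ?_, ?_, ?_, ?_, ?_, ?_, ?_, ?_⟩).mono (by omega) fun _ h => h
        · rw [b2.low (by omega), l2]
        · rw [b2.low (by omega), l3]
        · rw [b2.low (by omega), l4]
        · rw [b2.rv, l1]
        · rw [b2.rt (by omega)]
        · intro x h1 h2 h3
          rw [b2 x (fun j hj => h1 j (by omega)), d1 x h1 h2 h3]
        · intro a ha
          rw [b1, d2 a ha]
        · rw [b2.low (by omega), d3, countBelow_succ hj]
          congr 1
          by_cases hpi : p ⟨i, hi⟩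
          · have hpj : ¬ p ⟨j, hj⟩ := fun h => hnp ⟨hpi, h⟩
            simp [hpj]
          · have : ¬ ∃ h : i < n, p ⟨i, h⟩ := fun ⟨_, h⟩ => hpi h
            simp [this]
        · intro x y hx hy hxy
          rw [b1]
          refine d4 x y hx hy ?_
          by_contra hcon
          obtain ⟨e1, e2⟩ : (x : ℕ) = i ∧ (y : ℕ) = j := by omega
          refine hnp ⟨?_, ?_⟩
          · subst e1
            exact hx
          · subst e2
            exact hy
    · rintro u ⟨⟨d1, d2, d3, d4⟩, d5⟩
      have hlow : ∀ x, x < 10 → x ≠ 7 → u.reg x = t.reg x := fun x hx =>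
        d1 x (fun j _ => ne_rt hx j) (ne_rv hx 1)
      refine ⟨?_, ?_, ?_, ?_, ?_, ?_, d2, ?_, ?_⟩
      · rw [hlow 0 (by omega) (by omega), k2]
      · rw [hlow 3 (by omega) (by omega), k3]
      · rw [hlow 4 (by omega) (by omega), k4]
      · rw [d1 _ (fun j _ => rv_ne_rt 0 j) (by rw [Ne, rv_inj]; omega)
          (ne_rv (by omega) 0).symm, k1]
      · exact d1 _ (fun j hj => by rw [Ne, rt_inj]; omega) (rv_ne_rt _ _).symm
          (ne_rt (by omega) 0).symm
      · intro x h1 h2 h3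
        by_cases hx : x = rv 1
        · rw [hx, d5, c1 _ (fun j => rv_ne_rt 1 j) (by rw [Ne, rv_inj]; omega)
            (ne_rv (by omega) 1).symm]
        · rw [d1 x (fun j _ => h1 j) hx h3, c1 x h1 h2 h3]
      · rw [d3, countBelow_succ hi]
        by_cases hpi : p ⟨i, hi⟩
        · have : ∃ h : i < n, p ⟨i, h⟩ := ⟨hi, hpi⟩
          have hz : countBelow p 0 = 0 := by simp [countBelow]
          rw [if_pos this, if_pos hpi, hz, ite_self, ← hm]
          ring
        · simp [hpi, countBelow]
      · exact fun x y hx hy hxy => d4 x y hx hy (by omega)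
  · rintro t ⟨⟨c1, c2, c3, c4⟩, c5⟩
    exact ⟨c2, fun x hx => c1 x (fun j => ne_rt hx j) (ne_rv hx 0),
      fun x y hx hy => c4 x y hx hy (Or.inl x.2)⟩

theorem runs_kernelProg : ∃ q : Polynomial ℕ, ∀ y : ThinInstance × ℕ,
    Runs kernelProg (ramInput y) (q.eval y.1.n) fun s => RamOutput s (kernelMap y) := by
  classical
  obtain ⟨q₁, h₁⟩ := RelProg.solve.runs_compile
  obtain ⟨q₂, h₂⟩ := runs_countProg (c := 5) (by omega) (by omega) (.rel 7 0 0)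
  obtain ⟨q₃, h₃⟩ := runs_countProg (c := 6) (by omega) (by omega) (.rel 6 0 0)
  obtain ⟨q₄, h₄⟩ := runs_matrixProg
  refine ⟨(Polynomial.X * (2 + 3) + 7) + (q₁ + (q₂ + (q₃ + (3 + (q₄ +
    (Polynomial.X * (Polynomial.X * (3 + 3 + 3) + 5 + 3) + 5) + 4 + 1))))) + 3, fun y => ?_⟩
  set n := y.1.n with hn
  set G := y.1.graph with hG
  rcases Nat.eq_zero_or_pos n with h0 | hpos
  · -- without vertices the result depends on the parameter only
    have hcb : ∀ p : Fin n → Prop, countBelow p n = 0 := fun p =>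
      Nat.le_zero.1 ((countBelow_le n).trans h0.le)
    have hr0 : (ramInput y).reg 0 = 0 := by simp [ramInput, ← hn, h0]
    refine (Runs.cond (T := 1 + (1 + 1)) (fun h => absurd hr0 h) fun _ => Runs.seq (Runs.const
      (Runs.cond (T := 1) (fun h2 => Runs.const ?_) fun h2 => Runs.skip ?_))).mono
      (by simp only [Polynomial.eval_add, Polynomial.eval_ofNat, Polynomial.eval_one]; omega)
      fun _ h => h
    · have hk : y.2 ≠ 0 := by
        simpa [RamState.setReg, ramInput] using h2
      have : kernelMap y = (⟨0, ⊥, 0⟩, 1) := by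
        rw [kernelMap, if_neg]
        rw [SimpleGraph.partCount, hcb]
        exact fun h => hk h.symm
      rw [this]
      exact ⟨by simp [RamState.setReg, hr0], by simp [RamState.setReg], by simp [RamState.setReg],
        fun i => i.elim0⟩
    · have hk : y.2 = 0 := by
        simpa [RamState.setReg, ramInput] using h2
      have : kernelMap y = (⟨_, y.1.graph.kernelGraph, min y.1.t (2 * y.2)⟩, y.2) := by
        rw [kernelMap, if_pos]
        rw [SimpleGraph.partCount, hcb, hk]
      rw [this]
      refine ⟨?_, ?_, ?_, fun i => ?_⟩
      · have h := hcb (y.1.graph.IsRep y.1.graph.finalRel)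
        simp only [RamState.setReg]
        exact hr0.trans h.symm
      · simp [RamState.setReg, hk]
      · simp [RamState.setReg, ramInput]
      · have h : (i : ℕ) < countBelow (y.1.graph.IsRep y.1.graph.finalRel) y.1.n := i.2
        exact absurd (h.trans_eq (hcb _)) (Nat.not_lt_zero _)
  have hr0 : (ramInput y).reg 0 ≠ 0 := by
    simp only [ramInput, if_true]
    omega
  refine (Runs.cond (T := (n * (2 + 3) + 7) + (q₁.eval n + (q₂.eval n + (q₃.eval n + (1 + (1 + (1 +
    ((q₄.eval n + ((n * (n * (3 + 3 + 3) + 5 + 3) + 5) + (1 + (1 + (1 + 1))))) + 1))))))))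
    (fun _ => Runs.seq ((runs_initProg y hpos).mono le_rfl ?_)) fun h => absurd h hr0).mono (by
      simp
      omega) fun _ h => h
  rintro s ⟨hS, he, a1, a2, a5, a6, a7⟩
  refine Runs.seq ((h₁ n 0 _ _ s hS he).mono le_rfl ?_)
  rintro s₁ ⟨b1, b2⟩
  obtain ⟨r0, r6, r7⟩ := RelProg.run_solve (G := G) (e := fun _ => ⟨0, hpos⟩)
    (S := fun r i j => r = 0 ∧ y.1.graph.Adj i j) (by
      funext i j
      simp [hG])
  set S := RelProg.solve.run (fun _ => ⟨0, hpos⟩) fun r i j => r = 0 ∧ y.1.graph.Adj i j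
  refine Runs.seq ((h₂ n S _ s₁ b2 (he.of_same b1)).mono le_rfl ?_)
  rintro s₂ ⟨c1, c2, c3, c4⟩
  refine Runs.seq ((h₃ n S _ s₂ c1 c2).mono le_rfl ?_)
  rintro s₃ ⟨d1, d2, d3, d4⟩
  have e5 : s₃.reg 5 = G.partCount := by
    rw [d3 5 (by omega) (by omega), c4, b1.low (by omega), a5, zero_add]
    simp only [Fml.Holds, r7, Function.update_self]
    rfl
  have e6 : s₃.reg 6 = countBelow (G.IsRep G.finalRel) n := by
    rw [d4, c3 6 (by omega) (by omega), b1.low (by omega), a6, zero_add]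
    simp only [Fml.Holds, r6, Function.update_self]
  have elow : ∀ c, c < 10 → c ≠ 5 → c ≠ 6 → s₃.reg c = s.reg c := fun c hc h5 h6 => by
    rw [d3 c hc h6, c3 c hc h5, b1.low hc]
  have e1 := (elow 1 (by omega) (by omega) (by omega)).trans a1
  have e2 := (elow 2 (by omega) (by omega) (by omega)).trans a2
  have e7 := (elow 7 (by omega) (by omega) (by omega)).trans a7
  have ht : rt 0 ≠ rt 1 := by
    rw [Ne, rt_inj]
    omega
  have hlt : ∀ {c d : ℕ}, c < 10 → c ≠ rt d := fun hc => ne_rt hc _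
  refine Runs.seq (Runs.sub (Runs.seq (Runs.sub (Runs.seq (Runs.add ?_)))))
  set s₄ := s₃.setReg (rt 0) (s₃.reg 5 - s₃.reg 2) with hs₄
  set s₅ := s₄.setReg (rt 1) (s₄.reg 2 - s₄.reg 5) with hs₅
  set s₆ := s₅.setReg (rt 0) (s₅.reg (rt 0) + s₅.reg (rt 1)) with hs₆
  have hsame : Same 0 s₃ s₆ :=
    (((Same.refl 0 s₃).setReg le_rfl).setReg (by omega)).setReg le_rfl
  have htest : s₆.reg (rt 0) = (G.partCount - y.2) + (y.2 - G.partCount) := by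
    rw [hs₆, RamState.reg_setReg_self, hs₅, RamState.reg_setReg_of_ne ht, hs₄,
      RamState.reg_setReg_self, RamState.reg_setReg_self,
      RamState.reg_setReg_of_ne (hlt (by omega)), RamState.reg_setReg_of_ne (hlt (by omega)),
      e5, e2]
  refine Runs.cond (fun hc => ?_) fun hc => ?_
  · have hne : ¬ y.1.graph.partCount = y.2 := by
      intro h
      have h' : G.partCount = y.2 := h
      rw [htest] at hc
      omega
    refine (Runs.seq (T₁ := 1) (T₂ := 1 + 1) (Runs.const (Runs.seq (Runs.const
      (Runs.const ?_))))).mono (by omega) fun _ h => h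
    rw [kernelMap, if_neg hne]
    exact ⟨by simp [RamState.setReg], by simp [RamState.setReg], by simp [RamState.setReg],
      fun i => i.elim0⟩
  · have heq : y.1.graph.partCount = y.2 := by
      have h' : G.partCount = y.2 := by
        rw [htest] at hc
        omega
      exact h'
    rw [kernelMap, if_pos heq]
    refine Runs.seq ((h₄ n S _ s₆ (G.IsRep G.finalRel) (d1.of_same rfl (hsame.sameBut 0))
      (d2.of_same hsame) ((hsame.low (by omega)).trans e7) (fun x => by rw [r6])).mono le_rfl ?_)
    rintro s₇ ⟨f1, f2, f3⟩
    have g : ∀ c, c < 10 → c ≠ 7 → s₇.reg c = s₃.reg c := fun c hc h7 =>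
      (f2 c hc h7).trans (hsame.low hc)
    refine Runs.seq ((runs_copyProg (n := n) (d := 0) (a := 5) (b := 0) ?_ ?_ ?_ ?_ (by omega)
      (by omega)).mono le_rfl ?_)
    · rw [g 0 (by omega) (by omega), d1.size]
    · rw [g 3 (by omega) (by omega), d1.zero]
    · rw [g 4 (by omega) (by omega), d1.one]
    · rw [f1 1 (by omega)]
      exact d1.offset
    rintro s₈ ⟨k1, -, k3⟩
    have g' : ∀ c, c < 10 → c ≠ 7 → s₈.reg c = s₃.reg c := fun c hc h7 =>
      (k1.low hc).trans (g c hc h7)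
    refine Runs.seq (Runs.add (Runs.seq (Runs.sub (Runs.seq (Runs.sub (Runs.add ?_))))))
    have g0 := g' 1 (by omega) (by omega)
    have g2 := g' 2 (by omega) (by omega)
    have g3 := g' 3 (by omega) (by omega)
    have g6 := g' 6 (by omega) (by omega)
    have n1 : ∀ c, c < 10 → c ≠ rt 0 := fun c hc => ne_rt hc 0
    have hle : countBelow (G.IsRep G.finalRel) n ≤ n := countBelow_le n
    refine ⟨?_, ?_, ?_, fun i j => ?_⟩
    · simp [RamState.setReg, n1, g6, g3, e6, d1.zero, ← hn]
      rfl
    · simp [RamState.setReg, n1, g0, g2, e1, e2]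
      omega
    · simp [RamState.setReg, n1, g2, e2]
    · simp only [RamState.arr_setReg]
      change Fin (countBelow (G.IsRep G.finalRel) n) at i j
      change s₈.arr 0 (i.1 * countBelow (G.IsRep G.finalRel) n + j.1) = _
      -- the kernel has at most `n` vertices, so its matrix fits into the part that was copied
      have hb : i.1 * countBelow (G.IsRep G.finalRel) n + j.1 < n * n := by
        have hi : i.1 + 1 ≤ countBelow (G.IsRep G.finalRel) n := i.2
        have hj := j.2
        calc _ < (i.1 + 1) * countBelow (G.IsRep G.finalRel) n := by
              rw [add_mul, one_mul]
              omega
          _ ≤ n * n := Nat.mul_le_mul (hi.trans hle) hle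
      obtain ⟨i', j', hij⟩ : ∃ i' j' : Fin n,
          i.1 * countBelow (G.IsRep G.finalRel) n + j.1 = i'.1 * n + j'.1 :=
        ⟨⟨_, Nat.div_lt_of_lt_mul hb⟩, ⟨_, Nat.mod_lt _ hpos⟩, (Nat.div_add_mod' _ _).symm⟩
      rw [hij, k3, ← hij]
      have hi := nthElement_spec (p := G.IsRep G.finalRel) i
      have hj := nthElement_spec (p := G.IsRep G.finalRel) j
      rw [← hi.2, ← hj.2, f3 _ _ hi.1 hj.1, r0]
      rfl

end RamProg

theorem kernelMap_of_eq {x : ThinInstance} {k : ℕ} (h : x.graph.intervalModularCardinality = k) :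
    kernelMap (x, k) = (⟨_, x.graph.kernelGraph, min x.t (2 * k)⟩, k) := by
  rw [kernelMap, if_pos]
  rw [SimpleGraph.partCount_eq]
  exact h

theorem kernelMap_of_ne {x : ThinInstance} {k : ℕ} (h : x.graph.intervalModularCardinality ≠ k) :
    kernelMap (x, k) = (⟨0, ⊥, 0⟩, 1) := by
  rw [kernelMap, if_neg]
  rw [SimpleGraph.partCount_eq]
  exact h

theorem isKernelization_kernelMap :
    IsKernelization thinnessByIntervalModularCardinality kernelMap := by
  refine ⟨?_, ?_, fun k => 2 * k + 2 * k * (2 * k) + 2 * k + 1, ?_, ?_⟩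
  · obtain ⟨q, hq⟩ := RamProg.runs_kernelProg
    exact ⟨RamProg.kernelProg, q, hq⟩
  · rintro ⟨x, k⟩
    by_cases h : x.graph.intervalModularCardinality = k
    · rw [kernelMap_of_eq h]
      have e1 := x.graph.isContraction_kernelEmbedding.intervalModularCardinality_eq
        SimpleGraph.isIntervalModularRel_finalRel.2 SimpleGraph.isUnmergeable_finalRel
      have e2 := x.graph.isContraction_kernelEmbedding.thinness_eq
        SimpleGraph.isIntervalModularRel_finalRel.2
      have e3 := x.graph.thinness_le_two_mul
      change (x.graph.kernelGraph.intervalModularCardinality = k ∧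
        x.graph.kernelGraph.thinness ≤ min x.t (2 * k)) ↔
        (x.graph.intervalModularCardinality = k ∧ x.graph.thinness ≤ x.t)
      rw [e1, e2, h, le_min_iff]
      rw [h] at e3
      tauto
    · rw [kernelMap_of_ne h]
      refine iff_of_false (fun hQ => ?_) fun hQ => h hQ.1
      have h1 : (⊥ : SimpleGraph (Fin 0)).intervalModularCardinality = 1 := hQ.1
      obtain ⟨P, hP⟩ :=
        SimpleGraph.exists_isOptimalIntervalModularPartition (⊥ : SimpleGraph (Fin 0))
      have h2 := hP.2
      rw [h1] at h2
      obtain ⟨M, hM⟩ := Finset.card_pos.1 (by omega : 0 < P.parts.card)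
      obtain ⟨v, -⟩ := P.nonempty_of_mem_parts hM
      exact v.elim0
  · have h2 : Primrec fun k : ℕ => 2 * k := Primrec.nat_mul.comp (Primrec.const 2) Primrec.id
    exact (Primrec.nat_add.comp (Primrec.nat_add.comp (Primrec.nat_add.comp h2
      (Primrec.nat_mul.comp h2 h2)) h2) (Primrec.const 1)).to_comp
  · rintro ⟨x, k⟩
    have hsize : ∀ m, Nat.size m ≤ m := fun m => Nat.size_le.2 Nat.lt_two_pow_self
    by_cases h : x.graph.intervalModularCardinality = k
    · rw [kernelMap_of_eq h]
      have hm := x.graph.kernelGraph_card_le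
      rw [h] at hm
      refine ⟨?_, ?_⟩
      · simp only [ThinInstance.size]
        have h1 := (hsize _).trans hm
        have h2 := Nat.mul_le_mul hm hm
        have h3 := (hsize (min x.t (2 * k))).trans (min_le_right _ _)
        omega
      · simp only
        omega
    · rw [kernelMap_of_ne h]
      simp [ThinInstance.size]

theorem mainTheorem1 :
    -- the bound on the thinness
    (∀ (V : Type u) [Fintype V] [DecidableEq V] (G : SimpleGraph V),
      G.thinness ≤ 2 * G.intervalModularCardinality) ∧
    -- contracting the parts of an optimal partition
    (∀ (V : Type u) [Fintype V] [DecidableEq V] (G : SimpleGraph V)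
        (P : Finpartition (Finset.univ : Finset V)),
      G.IsOptimalIntervalModularPartition P →
        Nat.card (G.ContractVertex P) ≤ 2 * G.intervalModularCardinality ∧
        (G.contractPartition P).thinness = G.thinness) ∧
    -- the kernel, which is linear: at most `2 * k` vertices
    (∃ f : ThinInstance × ℕ → ThinInstance × ℕ,
      IsKernelization thinnessByIntervalModularCardinality f ∧
      (∀ (x : ThinInstance) (k : ℕ), (f (x, k)).1.n ≤ 2 * k) ∧
      ∀ (x : ThinInstance) (k : ℕ), x.graph.intervalModularCardinality = k →
        (f (x, k)).2 = k ∧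
        (f (x, k)).1.t = min x.t (2 * k) ∧
        (f (x, k)).1.graph.thinness = x.graph.thinness ∧
        ∃ P : Finpartition (Finset.univ : Finset (Fin x.n)),
          x.graph.IsOptimalIntervalModularPartition P ∧
          Nonempty ((f (x, k)).1.graph ≃g x.graph.contractPartition P)) := by
  refine ⟨fun V _ _ G => G.thinness_le_two_mul, fun V _ _ G P hP => ⟨?_, ?_⟩, kernelMap,
    isKernelization_kernelMap, fun x k => ?_, fun x k h => ?_⟩
  · rw [← hP.2]
    exact G.card_contractVertex_le P
  · exact SimpleGraph.thinness_contractPartition hP.1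
  · by_cases h : x.graph.intervalModularCardinality = k
    · rw [kernelMap_of_eq h, ← h]
      exact x.graph.kernelGraph_card_le
    · rw [kernelMap_of_ne h]
      exact Nat.zero_le _
  · rw [kernelMap_of_eq h]
    exact ⟨rfl, rfl, x.graph.isContraction_kernelEmbedding.thinness_eq
      SimpleGraph.isIntervalModularRel_finalRel.2, x.graph.exists_optimal_iso⟩
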